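/- Let $S$ be a scheme and let $Sch/S$ be the category of all $S$-schemes. Smooth morphisms $f$ below have a constant relative dimension $\dim f$, and line bundles are considered with their isomorphisms, pullbacks and tensor products. An *oriented Borel–Moore functor with products* $A^*$ on $Sch/S$ assigns to every $S$-scheme $\pi_X : X \to S$ a $\mathbb Z$-graded abelian group $A^*(X)=A^*(X\xrightarrow{\pi_X} S)$, together with: functorial pushforwards $f_*:A^i(X)\to A^i(Y)$ for proper $S$-morphisms $f:X\to Y$, such that $A^*$ is additive ($A^*(\emptyset)=0$ and $A^*(X)\oplus A^*(Y)\cong A^*(X\sqcup Y)$); functorial pullbacks $f^*:A^i(Y)\to A^{i-\dim f}(X)$ for smooth $S$-morphisms (with $\mathrm{id}^*=\mathrm{id}$); additive Chern operators $\widetilde c_1(L):A^i(X)\to A^{i+1}(X)$ for line bundles $L$ on $X$, which commute with each other and depend only on the isomorphism class of $L$; a biadditive, commutative, associative external product $\times_S:A^i(X)\times A^j(Y)\to A^{i+j}(X\times_S Y)$ with a unit $1_S\in A^0(S)$. These satisfy: $g^*f_*=f'_*g'^*$ for fibre squares with $f$ proper and $g$ smooth; $f_*\widetilde c_1(f^*M)=\widetilde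 c_1(M)f_*$ for $f$ proper; $\widetilde c_1(f^*M)f^*=f^*\widetilde c_1(M)$ for $f$ smooth; $f_*\alpha\times_S g_*\beta=(f\times_S g)_*(\alpha\times_S\beta)$ for $f,g$ proper; $f^*\alpha\times_S g^*\beta=(f\times_S g)^*(\alpha\times_S\beta)$ for $f,g$ smooth; $\widetilde c_1(L)(\alpha)\times_S\beta=\widetilde c_1(p_1^*L)(\alpha\times_S\beta)$. Let $\mathbb L_*$ be the Lazard ring, graded homologically, with universal (commutative) formal group law $F_{\mathbb L}(u,v)=\sum a_{ij}u^iv^j$, where $a_{ij}$ has degree $i+j-1$. $A^*$ is *of geometric type* if it carries a graded ring homomorphism $\Phi:\mathbb L_*\to A^{-*}(S)$ (the product of $A^*(S)$ being the external product; this makes every $A^*(X)$ an $\mathbb L_*$-module through $\times_S$) such that, for all smooth $\pi_X:X\to S$: 1. $\widetilde c_1(L_1)\cdots\widetilde c_1(L_n)(\pi_X^*1_S)=0$ for all line bundles $L_1,\dots,L_n$ on $X$ with $n>\dim\pi_X$; 2. $\widetilde c_1(L)(\pi_X^*1_S)=i_*(\pi_Z^*1_S)$ for every section $s$ of a line bundle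 $L$ on $X$ that is transverse to the zero section on every fibre of $\pi_X$, where $i:Z=s^{-1}(0)\to X$ is its zero scheme (so that $\pi_Z=\pi_X\circ i$ is smooth of relative dimension $\dim\pi_X-1$); 3. $F_A(\widetilde c_1(L),\widetilde c_1(M))(\pi_X^*1_S)=\widetilde c_1(L\otimes M)(\pi_X^*1_S)$ for all line bundles $L,M$ on $X$, where $F_A$ is the image of $F_{\mathbb L}$ under $\Phi$. Let $\mathcal Z^*(X\to S)$ be the abelian group generated by the isomorphism classes of cobordism cycles $[h:V\to X;L_1,\dots,L_r]$ ($h$ proper, $\pi_X\circ h$ smooth, the $L_i$ line bundles on $V$, isomorphisms being allowed to permute the $L_i$), a cycle on a disjoint union $V_1\sqcup V_2$ being identified with the sum of its restrictions to $V_1$ and $V_2$; such a cycle has degree $r-\dim(\pi_X\circ h)$. Let $\Omega^*(X\to S)$ be obtained from it by * dividing by the subgroup generated by the $[h:V\to X;\pi^*L_1,\dots,\pi^*L_r,M_1,\dots,M_s]$ with $\pi:V\to S'$ and $\nu:S'\to S$ smooth, $\nu\circ\pi=\pi_X\circ h$, $r>\dim\nu$, the $L_i$ line bundles on $S'$ and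 the $M_j$ on $V$; * dividing the result by the subgroup generated by the $[h:V\to X;L_1,\dots,L_r]-[h\circ i:Z\to X;i^*L_1,\dots,i^*L_{r-1}]$ with $r>0$, where $i:Z\to V$ is the zero scheme of a section of $L_r$ that is transverse to the zero section on every fibre of $\pi_X\circ h$; * tensoring the result with $\mathbb L_*$ over $\mathbb Z$ and dividing by the $\mathbb L_*$-submodule generated by the $[h:V\to X;L_1,\dots,L_r,F_{\mathbb L}(L,M)]-[h:V\to X;L_1,\dots,L_r,L\otimes M]$, where $[\dots,F_{\mathbb L}(L,M)]=\sum_{i,j}a_{ij}[\dots,L,\dots,L,M,\dots,M]$ with $i$ copies of $L$ and $j$ copies of $M$ (a finite sum, because almost all terms vanish). Then the following ($\mathbb L_*$-linear resp. $\mathbb L_*$-bilinear) operations are well defined on $\Omega^*(-\to S)$ and make it an oriented Borel–Moore functor with products of geometric type, with $1_S=[\mathrm{id}_S]$ and $\Phi(a)=a[\mathrm{id}_S]$: $f_*[h;L_\bullet]=[f\circ h;L_\bullet]$; $f^*[k:W\to Y;L_\bullet]=[k':W\times_YX\to X;f'^*L_\bullet]$, where $f':W\times_YX\to W$ and $k'$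 are the projections; $\widetilde c_1(L)[h;L_\bullet]=[h;L_\bullet,h^*L]$; $[V\to X;L_\bullet]\times_S[W\to Y;M_\bullet]=[V\times_SW\to X\times_SY;p_1^*L_\bullet,p_2^*M_\bullet]$. Moreover $\Omega^*(-\to S)$ is universal: for every oriented Borel–Moore functor with products of geometric type $A^*$ on $Sch/S$ there is a unique natural transformation $\tau:\Omega^*(-\to S)\to A^*$ (additive maps $\Omega^*(X\to S)\to A^*(X)$ for all $X$) that preserves the gradings, pushforwards, pullbacks, Chern operators, external products and the $\mathbb L_*$-structures, and sends $1_S$ to $1_S$. -/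

import Mathlib

open CategoryTheory Limits AlgebraicGeometry MonoidalCategory CartesianMonoidalCategory
open scoped TensorProduct

universe u w

noncomputable section

namespace RelCobordism

/-! ### Line bundles on a scheme, given by a trivialising cover and transition functions -/

/-- Restriction of functions from `U` to a smaller open set `V`. -/
def res {X : Scheme.{u}} {U V : X.Opens} (h : V ≤ U) : Γ(X, U) →+* Γ(X, V) :=
  (X.presheaf.map (homOfLE h).op).hom

/-- A line bundle on `X`: an open cover `U i` of `X` with transition functions
`g i j ∈ 𝒪(U i ∩ U j)ˣ` that satisfy the cocycle condition. The local coordinates of a section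
satisfy `s i = g i j * s j`. -/
structure LineBundle (X : Scheme.{u}) where
  ι : Type u
  U : ι → X.Opens
  cover : ∀ x : X, ∃ i, x ∈ U i
  g : ∀ i j, Γ(X, U i ⊓ U j)ˣ
  cocycle : ∀ i j k,
    res (V := U i ⊓ U j ⊓ U k) inf_le_left (g i j : Γ(X, U i ⊓ U j)) *
      res (le_inf (inf_le_left.trans inf_le_right) inf_le_right) (g j k : Γ(X, U j ⊓ U k)) =
      res (le_inf (inf_le_left.trans inf_le_left) inf_le_right) (g i k : Γ(X, U i ⊓ U k))

namespace LineBundle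

variable {X Y : Scheme.{u}}

/-- `L` and `M` are isomorphic: there are invertible functions `a i k` on `U i ∩ U' k`
(the isomorphism `M ≅ L` read in the two families of trivialisations) that are compatible with
the transition functions of `L` and of `M`. -/
def Isom (L M : LineBundle X) : Prop :=
  ∃ a : ∀ (i : L.ι) (k : M.ι), Γ(X, L.U i ⊓ M.U k)ˣ,
    (∀ i j k,
      res (V := L.U i ⊓ L.U j ⊓ M.U k) inf_le_left (L.g i j : Γ(X, L.U i ⊓ L.U j)) *
        res (le_inf (inf_le_left.trans inf_le_right) inf_le_right)
          (a j k : Γ(X, L.U j ⊓ M.U k)) =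
        res (le_inf (inf_le_left.trans inf_le_left) inf_le_right)
          (a i k : Γ(X, L.U i ⊓ M.U k))) ∧
    (∀ i k l,
      res (V := L.U i ⊓ M.U k ⊓ M.U l) inf_le_left (a i k : Γ(X, L.U i ⊓ M.U k)) *
        res (le_inf (inf_le_left.trans inf_le_right) inf_le_right)
          (M.g k l : Γ(X, M.U k ⊓ M.U l)) =
        res (le_inf (inf_le_left.trans inf_le_left) inf_le_right)
          (a i l : Γ(X, L.U i ⊓ M.U l)))

lemma res_res {U V W : X.Opens} (h : V ≤ U) (h' : W ≤ V) (x : Γ(X, U)) :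
    res h' (res h x) = res (h'.trans h) x := by
  simp only [res]
  rw [← CommRingCat.comp_apply, ← X.presheaf.map_comp]
  rfl

/-- Pullback of functions along `f : Y ⟶ X`, from `U` to an open set `V` that `f` maps to `U`. -/
def pb (f : Y ⟶ X) {U : X.Opens} {V : Y.Opens} (h : V ≤ f ⁻¹ᵁ U) : Γ(X, U) →+* Γ(Y, V) :=
  (f.appLE U V h).hom

lemma res_pb (f : Y ⟶ X) {U U' : X.Opens} {V V' : Y.Opens} (h : V ≤ f ⁻¹ᵁ U) (h' : V' ≤ V)
    (hU : U' ≤ U) (h'' : V' ≤ f ⁻¹ᵁ U') (x : Γ(X, U)) :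
    res h' (pb f h x) = pb f h'' (res hU x) := by
  simp only [res, pb]
  rw [← CommRingCat.comp_apply, ← CommRingCat.comp_apply, Scheme.Hom.appLE_map,
    Scheme.Hom.map_appLE]

lemma le_preimage_inf (f : Y ⟶ X) (U V : X.Opens) : f ⁻¹ᵁ U ⊓ f ⁻¹ᵁ V ≤ f ⁻¹ᵁ (U ⊓ V) := le_rfl

/-- The pullback `f^* L`: the cover `f⁻¹(U i)` with the transition functions `f^* (g i j)`. -/
@[reducible] def pullback (f : Y ⟶ X) (L : LineBundle X) : LineBundle Y where
  ι := L.ι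
  U i := f ⁻¹ᵁ L.U i
  cover y := L.cover (f y)
  g i j := Units.map (pb f (le_preimage_inf f (L.U i) (L.U j))).toMonoidHom (L.g i j)
  cocycle i j k := by
    have hle : f ⁻¹ᵁ L.U i ⊓ f ⁻¹ᵁ L.U j ⊓ f ⁻¹ᵁ L.U k ≤ f ⁻¹ᵁ (L.U i ⊓ L.U j ⊓ L.U k) :=
      le_rfl
    have h := congrArg (pb f hle) (L.cocycle i j k)
    rw [map_mul] at h
    simp only [Units.coe_map, RingHom.toMonoidHom_eq_coe, MonoidHom.coe_coe]
    rw [res_pb f _ _ _ hle, res_pb f _ _ _ hle, res_pb f _ _ _ hle]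
    exact h

/-- The tensor product `L ⊗ M`: the cover `U i ∩ U' k` with the products of the transition
functions. -/
@[reducible] def tensor (L M : LineBundle X) : LineBundle X where
  ι := L.ι × M.ι
  U p := L.U p.1 ⊓ M.U p.2
  cover x := by
    obtain ⟨i, hi⟩ := L.cover x
    obtain ⟨k, hk⟩ := M.cover x
    exact ⟨(i, k), hi, hk⟩
  g p q :=
    Units.map (res (U := L.U p.1 ⊓ L.U q.1) (V := L.U p.1 ⊓ M.U p.2 ⊓ (L.U q.1 ⊓ M.U q.2))
      (inf_le_inf inf_le_left inf_le_left)).toMonoidHom (L.g p.1 q.1) *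
    Units.map (res (U := M.U p.2 ⊓ M.U q.2) (V := L.U p.1 ⊓ M.U p.2 ⊓ (L.U q.1 ⊓ M.U q.2))
      (inf_le_inf inf_le_right inf_le_right)).toMonoidHom (M.g p.2 q.2)
  cocycle p q r := by
    have h₁ := congrArg (res (V := L.U p.1 ⊓ M.U p.2 ⊓ (L.U q.1 ⊓ M.U q.2) ⊓
      (L.U r.1 ⊓ M.U r.2)) (inf_le_inf (inf_le_inf inf_le_left inf_le_left) inf_le_left))
      (L.cocycle p.1 q.1 r.1)
    have h₂ := congrArg (res (V := L.U p.1 ⊓ M.U p.2 ⊓ (L.U q.1 ⊓ M.U q.2) ⊓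
      (L.U r.1 ⊓ M.U r.2)) (inf_le_inf (inf_le_inf inf_le_right inf_le_right) inf_le_right))
      (M.cocycle p.2 q.2 r.2)
    simp only [map_mul, res_res] at h₁ h₂
    simp only [Units.val_mul, Units.coe_map, RingHom.toMonoidHom_eq_coe, MonoidHom.coe_coe,
      map_mul, res_res]
    rw [← h₁, ← h₂]
    ring

/-- A global section of `L`, given by its local coordinates. -/
structure Sec (L : LineBundle X) where
  val : ∀ i, Γ(X, L.U i)
  compat : ∀ i j, res (V := L.U i ⊓ L.U j) inf_le_left (val i) =
    (L.g i j : Γ(X, L.U i ⊓ L.U j)) * res inf_le_right (val j)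

/-- The closed immersion `i : Z ⟶ X` is the zero scheme `s⁻¹(0)` of the section `s`: a morphism
`t : T ⟶ X` factors through `Z` if and only if the pulled back section `t^* s` vanishes. -/
def Sec.IsZeroScheme {L : LineBundle X} (s : L.Sec) {Z : Scheme.{u}} (i : Z ⟶ X) : Prop :=
  IsClosedImmersion i ∧ ∀ (T : Scheme.{u}) (t : T ⟶ X),
    (∃ t' : T ⟶ Z, t' ≫ i = t) ↔ ∀ k, t.app (L.U k) (s.val k) = 0

end LineBundle

/-! ### Smooth morphisms with a relative dimension -/

/-- `f` is smooth of some constant relative dimension, the degree shift `dim f` of its pullback.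
(A pullback along a smooth morphism with finitely many relative dimensions is determined by
additivity from these.) -/
def SmoothEquidim {X Y : Scheme.{u}} (f : X ⟶ Y) : Prop :=
  ∃ d : ℕ, SmoothOfRelativeDimension d f

lemma SmoothEquidim.comp {X Y Z : Scheme.{u}} {f : X ⟶ Y} {g : Y ⟶ Z} (hf : SmoothEquidim f)
    (hg : SmoothEquidim g) : SmoothEquidim (f ≫ g) := by
  obtain ⟨d, hd⟩ := hf
  obtain ⟨e, he⟩ := hg
  exact ⟨d + e, inferInstance⟩

lemma SmoothEquidim.of_isPullback {W X Y Z : Scheme.{u}} {g' : W ⟶ X} {f' : W ⟶ Y} {f : X ⟶ Z}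
    {g : Y ⟶ Z} (sq : IsPullback g' f' f g) (hg : SmoothEquidim g) : SmoothEquidim g' := by
  obtain ⟨d, hd⟩ := hg
  have := smoothOfRelativeDimension_isStableUnderBaseChange.{u} d
  exact ⟨d, MorphismProperty.of_isPullback (P := @SmoothOfRelativeDimension.{u} d) sq.flip hd⟩

lemma smoothEquidim_of_isIso {X Y : Scheme.{u}} (f : X ⟶ Y) [IsIso f] : SmoothEquidim f :=
  ⟨0, inferInstance⟩

/-- For `p : V ⟶ S` smooth of relative dimension `d` and the zero scheme `i : Z ⟶ V` of a section
of a line bundle: the section is transverse to the zero section on every fibre of `p`, that is,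
`Z ⟶ S` is smooth of relative dimension `d - 1` (the empty scheme has every relative dimension).
Since `V ⟶ S` is flat and of finite presentation locally, this holds if and only if on every fibre
the local equations of `Z` have nonzero differential at the points of `Z`. -/
def FibrewiseTransverse {V Z S : Scheme.{u}} (p : V ⟶ S) (i : Z ⟶ V) : Prop :=
  ∃ d : ℕ, SmoothOfRelativeDimension d p ∧
    (IsEmpty Z ∨ ∃ e : ℕ, e + 1 = d ∧ SmoothOfRelativeDimension e (i ≫ p))

/-! ### The Lazard ring -/

/-- The series `F(u, v) = u + v + ∑_{i, j ≥ 1} a_{ij} u^i v^j` with indeterminate coefficients;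
the indeterminate `X (i, j)` is the coefficient `a_{i+1, j+1}`. -/
def genericSeries : MvPowerSeries (Fin 2) (MvPolynomial (ℕ × ℕ) ℤ) := fun n =>
  match n 0, n 1 with
  | i + 1, j + 1 => MvPolynomial.X (i, j)
  | 1, 0 => 1
  | 0, 1 => 1
  | _, _ => 0

/-- The ideal generated by the coefficients of `F(u, v) - F(v, u)` and of
`F(F(u, v), w) - F(u, F(v, w))`. -/
def lazardIdeal : Ideal (MvPolynomial (ℕ × ℕ) ℤ) :=
  Ideal.span
    ({z | ∃ n : Fin 2 →₀ ℕ, z = MvPowerSeries.coeff n (genericSeries -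
        genericSeries.subst ![MvPowerSeries.X 1, MvPowerSeries.X 0])} ∪
     {z | ∃ n : Fin 3 →₀ ℕ, z = MvPowerSeries.coeff n
        ((genericSeries.subst ![genericSeries.subst
            ![(MvPowerSeries.X 0 : MvPowerSeries (Fin 3) (MvPolynomial (ℕ × ℕ) ℤ)),
              MvPowerSeries.X 1], MvPowerSeries.X 2]) -
          genericSeries.subst ![MvPowerSeries.X 0, genericSeries.subst
            ![(MvPowerSeries.X 1 : MvPowerSeries (Fin 3) (MvPolynomial (ℕ × ℕ) ℤ)),
              MvPowerSeries.X 2]])})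

/-- The Lazard ring `𝕃`. -/
abbrev Lazard : Type := MvPolynomial (ℕ × ℕ) ℤ ⧸ lazardIdeal

/-- The coefficient of `u^i v^j` in the universal formal group law over the Lazard ring. -/
def lazardCoeff (i j : ℕ) : Lazard :=
  Ideal.Quotient.mk lazardIdeal
    (MvPowerSeries.coeff (Finsupp.single 0 i + Finsupp.single 1 j) genericSeries)

/-- The homogeneous elements of degree `n` of the Lazard ring in its homological grading, in which
`a_{ij}` has degree `i + j - 1`. -/
def lazardGrade (n : ℕ) : Set Lazard :=
  Ideal.Quotient.mk lazardIdeal ''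
    {P | MvPolynomial.IsWeightedHomogeneous (fun p : ℕ × ℕ => p.1 + p.2 + 1) P n}

/-! ### Oriented Borel--Moore functors with products on `Sch/S` -/

variable {S : Scheme.{u}}

lemma isProper_of_iso {X Y : Over S} (e : X ≅ Y) : IsProper e.hom.left := by
  have : IsIso e.hom.left := inferInstanceAs (IsIso ((Over.forget S).map e.hom))
  infer_instance

/-- The product morphism `f ×_S g` of proper morphisms is proper. -/
lemma isProper_tensor {X₁ X₂ Y₁ Y₂ : Over S} {f : X₁ ⟶ X₂} {g : Y₁ ⟶ Y₂}
    (hf : IsProper f.left) (hg : IsProper g.left) : IsProper (f ⊗ₘ g).left := by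
  rw [Over.tensorHom_left]
  exact MorphismProperty.pullbackMap (P := @IsProper) hf hg (Over.w f).symm (Over.w g).symm

/-- The product of smooth `S`-schemes is smooth over `S`. -/
lemma smoothEquidim_tensorObj {X Y : Over S} (hX : SmoothEquidim X.hom)
    (hY : SmoothEquidim Y.hom) : SmoothEquidim (X ⊗ Y).hom :=
  (SmoothEquidim.of_isPullback (IsPullback.of_hasPullback X.hom Y.hom) hY).comp hX

lemma smoothEquidim_toUnit {X : Over S} (hX : SmoothEquidim X.hom) :
    SmoothEquidim (toUnit X).left := hX

/-- An oriented Borel--Moore functor with products on `Sch/S` with the given groups `A X`, where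
`Sch/S` is the category `Over S`, products `X ⊗ Y` in it are fibre products over `S`, and
`𝟙_ (Over S)` is the final object `S`. -/
structure BMFunctor (S : Scheme.{u}) (A : Over S → Type w) [∀ X, AddCommGroup (A X)] where
  /-- the homogeneous component `A^i(X)` -/
  grade : ∀ X : Over S, ℤ → AddSubgroup (A X)
  grade_internal : ∀ X, DirectSum.IsInternal (grade X)
  /-- the pushforward along a proper morphism -/
  push : ∀ {X Y : Over S} (f : X ⟶ Y), IsProper f.left → (A X →+ A Y)
  /-- the pullback along a smooth morphism -/
  pull : ∀ {X Y : Over S} (f : X ⟶ Y), SmoothEquidim f.left → (A Y →+ A X)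
  /-- the Chern operator of a line bundle -/
  chern : ∀ {X : Over S}, LineBundle X.left → (A X →+ A X)
  /-- the external product and its unit `1_S` -/
  prod : ∀ {X Y : Over S}, A X →+ A Y →+ A (X ⊗ Y)
  one : A (𝟙_ (Over S))
  -- degrees
  push_mem : ∀ {X Y : Over S} (f : X ⟶ Y) (hf : IsProper f.left) (i : ℤ) (x : A X),
    x ∈ grade X i → push f hf x ∈ grade Y i
  pull_mem : ∀ {X Y : Over S} (f : X ⟶ Y) (hf : SmoothEquidim f.left) (d : ℕ),
    SmoothOfRelativeDimension d f.left → ∀ (i : ℤ) (y : A Y),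
      y ∈ grade Y i → pull f hf y ∈ grade X (i - d)
  chern_mem : ∀ {X : Over S} (L : LineBundle X.left) (i : ℤ) (x : A X),
    x ∈ grade X i → chern L x ∈ grade X (i + 1)
  prod_mem : ∀ {X Y : Over S} (i j : ℤ) (x : A X) (y : A Y),
    x ∈ grade X i → y ∈ grade Y j → prod x y ∈ grade (X ⊗ Y) (i + j)
  one_mem : one ∈ grade (𝟙_ (Over S)) 0
  -- pushforward is functorial, and the functor is additive
  push_id : ∀ (X : Over S) (h : IsProper (𝟙 X : X ⟶ X).left) (x : A X), push (𝟙 X) h x = x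
  push_comp : ∀ {X Y Z : Over S} (f : X ⟶ Y) (g : Y ⟶ Z) (hf : IsProper f.left)
    (hg : IsProper g.left) (hfg : IsProper (f ≫ g).left) (x : A X),
    push (f ≫ g) hfg x = push g hg (push f hf x)
  additive_empty : ∀ X : Over S, IsEmpty X.left → Subsingleton (A X)
  additive : ∀ {X Y Z : Over S} (i : X ⟶ Z) (j : Y ⟶ Z) (hi : IsProper i.left)
    (hj : IsProper j.left), Nonempty (IsColimit (BinaryCofan.mk i j)) →
    Function.Bijective (fun p : A X × A Y => push i hi p.1 + push j hj p.2)
  -- the external product is commutative, associative and unital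
  prod_comm : ∀ {X Y : Over S} (x : A X) (y : A Y),
    push (β_ X Y).hom (isProper_of_iso _) (prod x y) = prod y x
  prod_assoc : ∀ {X Y Z : Over S} (x : A X) (y : A Y) (z : A Z),
    push (α_ X Y Z).hom (isProper_of_iso _) (prod (prod x y) z) = prod x (prod y z)
  one_prod : ∀ {X : Over S} (x : A X), push (λ_ X).hom (isProper_of_iso _) (prod one x) = x
  -- pullback is functorial
  pull_id : ∀ (X : Over S) (h : SmoothEquidim (𝟙 X : X ⟶ X).left) (x : A X), pull (𝟙 X) h x = x
  pull_comp : ∀ {X Y Z : Over S} (f : X ⟶ Y) (g : Y ⟶ Z) (hf : SmoothEquidim f.left)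
    (hg : SmoothEquidim g.left) (hfg : SmoothEquidim (f ≫ g).left) (z : A Z),
    pull (f ≫ g) hfg z = pull f hf (pull g hg z)
  -- base change in fibre squares
  base_change : ∀ {W X Y Z : Over S} (g' : W ⟶ X) (f' : W ⟶ Y) (f : X ⟶ Z) (g : Y ⟶ Z),
    IsPullback g' f' f g → ∀ (hf : IsProper f.left) (hg : SmoothEquidim g.left)
      (hf' : IsProper f'.left) (hg' : SmoothEquidim g'.left) (x : A X),
      pull g hg (push f hf x) = push f' hf' (pull g' hg' x)
  -- Chern operators and pushforward
  push_chern : ∀ {X Y : Over S} (f : X ⟶ Y) (hf : IsProper f.left) (M : LineBundle Y.left)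
    (x : A X), push f hf (chern (M.pullback f.left) x) = chern M (push f hf x)
  -- Chern operators and pullback
  pull_chern : ∀ {X Y : Over S} (f : X ⟶ Y) (hf : SmoothEquidim f.left) (M : LineBundle Y.left)
    (y : A Y), chern (M.pullback f.left) (pull f hf y) = pull f hf (chern M y)
  -- Chern operators commute and depend on the isomorphism class only
  chern_comm : ∀ {X : Over S} (L L' : LineBundle X.left) (x : A X),
    chern L (chern L' x) = chern L' (chern L x)
  chern_isom : ∀ {X : Over S} (L L' : LineBundle X.left), L.Isom L' → chern L = chern L'
  -- external product and pushforward
  push_prod : ∀ {X₁ X₂ Y₁ Y₂ : Over S} (f : X₁ ⟶ X₂) (g : Y₁ ⟶ Y₂) (hf : IsProper f.left)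
    (hg : IsProper g.left) (x : A X₁) (y : A Y₁),
    prod (push f hf x) (push g hg y) = push (f ⊗ₘ g) (isProper_tensor hf hg) (prod x y)
  -- external product and pullback
  pull_prod : ∀ {X₁ X₂ Y₁ Y₂ : Over S} (f : X₁ ⟶ X₂) (g : Y₁ ⟶ Y₂) (hf : SmoothEquidim f.left)
    (hg : SmoothEquidim g.left) (hfg : SmoothEquidim (f ⊗ₘ g).left) (x : A X₂) (y : A Y₂),
    prod (pull f hf x) (pull g hg y) = pull (f ⊗ₘ g) hfg (prod x y)
  -- external product and Chern operators
  chern_prod : ∀ {X Y : Over S} (L : LineBundle X.left) (x : A X) (y : A Y),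
    prod (chern L x) y = chern (L.pullback (fst X Y).left) (prod x y)

/-- The fundamental class `π_X^* 1_S` of a smooth `S`-scheme. -/
def BMFunctor.fund {A : Over S → Type w} [∀ X, AddCommGroup (A X)] (T : BMFunctor S A)
    (X : Over S) (hX : SmoothEquidim X.hom) : A X :=
  T.pull (toUnit X) (smoothEquidim_toUnit hX) T.one

/-- An oriented Borel--Moore `𝕃`-functor with products of geometric type on `Sch/S`. -/
structure GeometricFunctor (S : Scheme.{u}) (A : Over S → Type w) [∀ X, AddCommGroup (A X)]
    extends BMFunctor S A where
  /-- the graded ring homomorphism `Φ : 𝕃 → A(S)`; the product of `a, b ∈ A(S)` is `a ×_S b` in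
  `A(S ×_S S) ≅ A(S)` -/
  Phi : Lazard →+ A (𝟙_ (Over S))
  Phi_one : Phi 1 = one
  Phi_mul : ∀ a b : Lazard,
    Phi (a * b) = push (λ_ (𝟙_ (Over S))).hom (isProper_of_iso _) (prod (Phi a) (Phi b))
  Phi_mem : ∀ (n : ℕ), ∀ a ∈ lazardGrade n, Phi a ∈ grade (𝟙_ (Over S)) (-n)
  /-- the relative dimension axiom -/
  rel_dim : ∀ (X : Over S) (hX : SmoothEquidim X.hom) (d : ℕ),
    SmoothOfRelativeDimension d X.hom → ∀ Ls : List (LineBundle X.left), d < Ls.length →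
      Ls.foldr (fun L x => chern L x) (toBMFunctor.fund X hX) = 0
  /-- the relative section axiom -/
  rel_sect : ∀ (X Z : Over S) (hX : SmoothEquidim X.hom) (hZ : SmoothEquidim Z.hom) (i : Z ⟶ X)
    (hi : IsProper i.left) (L : LineBundle X.left) (s : L.Sec), s.IsZeroScheme i.left →
      FibrewiseTransverse X.hom i.left →
      chern L (toBMFunctor.fund X hX) = push i hi (toBMFunctor.fund Z hZ)
  /-- the relative formal group law axiom; the terms with `i > d` or `j > d` of
  `F_A(c̃₁(L), c̃₁(M))` vanish on the fundamental class by the dimension axiom -/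
  rel_fgl : ∀ (X : Over S) (hX : SmoothEquidim X.hom) (d : ℕ),
    SmoothOfRelativeDimension d X.hom → ∀ L M : LineBundle X.left,
      ∑ i ∈ Finset.range (d + 1), ∑ j ∈ Finset.range (d + 1),
        push (λ_ X).hom (isProper_of_iso _) (prod (Phi (lazardCoeff i j))
          ((chern L)^[i] ((chern M)^[j] (toBMFunctor.fund X hX)))) =
      chern (L.tensor M) (toBMFunctor.fund X hX)

/-- A natural transformation `τ : A → B` that preserves the grading, the pushforwards, the
pullbacks, the Chern operators, the external products and the `𝕃`-structure, and sends `1_S` to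
`1_S`. -/
structure IsTransformation {A : Over S → Type*} [∀ X, AddCommGroup (A X)]
    {B : Over S → Type*} [∀ X, AddCommGroup (B X)] (T : GeometricFunctor S A)
    (T' : GeometricFunctor S B) (τ : ∀ X : Over S, A X →+ B X) : Prop where
  grade : ∀ (X : Over S) (i : ℤ) (x : A X), x ∈ T.grade X i → τ X x ∈ T'.grade X i
  push : ∀ {X Y : Over S} (f : X ⟶ Y) (hf : IsProper f.left) (x : A X),
    τ Y (T.push f hf x) = T'.push f hf (τ X x)
  pull : ∀ {X Y : Over S} (f : X ⟶ Y) (hf : SmoothEquidim f.left) (y : A Y),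
    τ X (T.pull f hf y) = T'.pull f hf (τ Y y)
  chern : ∀ {X : Over S} (L : LineBundle X.left) (x : A X),
    τ X (T.chern L x) = T'.chern L (τ X x)
  prod : ∀ {X Y : Over S} (x : A X) (y : A Y),
    τ (X ⊗ Y) (T.prod x y) = T'.prod (τ X x) (τ Y y)
  Phi : ∀ a : Lazard, τ (𝟙_ (Over S)) (T.Phi a) = T'.Phi a
  one : τ (𝟙_ (Over S)) T.one = T'.one

/-! ### The groups `𝒵^*(X ⟶ S)` and `Ω^*(X ⟶ S)` -/

/-- A cobordism cycle `[V ⟶ X; L₁, …, L_r]` over the `S`-scheme `X`: a proper morphism `V ⟶ X` of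
`S`-schemes such that `V ⟶ S` is smooth, and line bundles on `V`. -/
structure Cycle (X : Over S) where
  V : Over S
  map : V ⟶ X
  proper : IsProper map.left
  smooth : SmoothEquidim V.hom
  bundles : List (LineBundle V.left)

namespace Cycle

variable {X Y : Over S}

/-- Isomorphism of cobordism cycles: an isomorphism `V ≅ V'` over `X` under which the line bundles
correspond, up to isomorphism and order. -/
def Isom (c c' : Cycle X) : Prop :=
  ∃ e : c.V ≅ c'.V, e.hom ≫ c'.map = c.map ∧ ∃ Ls : List (LineBundle c.V.left),
    Ls.Perm c.bundles ∧
      List.Forall₂ LineBundle.Isom Ls (c'.bundles.map (LineBundle.pullback e.hom.left))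

/-- `c'` is the restriction of `c` along `i`, with the pullbacks of the line bundles `Ls`. -/
def IsRestriction (c' c : Cycle X) (i : c'.V ⟶ c.V) (Ls : List (LineBundle c.V.left)) : Prop :=
  i ≫ c.map = c'.map ∧ c'.bundles = Ls.map (LineBundle.pullback i.left)

/-- The cycle `c` with further line bundles on its source appended. -/
def append (c : Cycle X) (Ls : List (LineBundle c.V.left)) : Cycle X where
  V := c.V
  map := c.map
  proper := c.proper
  smooth := c.smooth
  bundles := c.bundles ++ Ls

/-- `f_* [h : V ⟶ X; L₁, …] = [f ∘ h : V ⟶ Y; L₁, …]` -/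
def push (f : X ⟶ Y) (hf : IsProper f.left) (c : Cycle X) : Cycle Y where
  V := c.V
  map := c.map ≫ f
  proper := by
    have := c.proper
    rw [Over.comp_left]
    infer_instance
  smooth := c.smooth
  bundles := c.bundles

/-- `f^* [k : W ⟶ Y; L₁, …] = [k' : W' ⟶ X; f'^* L₁, …]` for the fibre square with sides `f', k'`
and `k, f`. -/
def pull (f : X ⟶ Y) (hf : SmoothEquidim f.left) (c : Cycle Y) {W' : Over S} (f' : W' ⟶ c.V)
    (k' : W' ⟶ X) (sq : IsPullback f' k' c.map f) : Cycle X where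
  V := W'
  map := k'
  proper := MorphismProperty.of_isPullback (P := @IsProper) (sq.map (Over.forget S)) c.proper
  smooth := by
    rw [← Over.w f']
    exact (SmoothEquidim.of_isPullback (sq.map (Over.forget S)) hf).comp c.smooth
  bundles := c.bundles.map (LineBundle.pullback f'.left)

/-- `c̃₁(L) [h : V ⟶ X; L₁, …, L_r] = [h : V ⟶ X; L₁, …, L_r, h^* L]` -/
def chern (L : LineBundle X.left) (c : Cycle X) : Cycle X :=
  c.append [L.pullback c.map.left]

/-- The external product
`[V ⟶ X; L₁, …] ×_S [W ⟶ Y; M₁, …] = [V ×_S W ⟶ X ×_S Y; p₁^* L₁, …, p₂^* M₁, …]` -/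
def prod (c : Cycle X) (c' : Cycle Y) : Cycle (X ⊗ Y) where
  V := c.V ⊗ c'.V
  map := c.map ⊗ₘ c'.map
  proper := isProper_tensor c.proper c'.proper
  smooth := smoothEquidim_tensorObj c.smooth c'.smooth
  bundles := c.bundles.map (LineBundle.pullback (fst c.V c'.V).left) ++
    c'.bundles.map (LineBundle.pullback (snd c.V c'.V).left)

variable (S) in
/-- `[id : S ⟶ S]` -/
def one : Cycle (𝟙_ (Over S)) where
  V := 𝟙_ (Over S)
  map := 𝟙 _
  proper := isProper_of_iso (Iso.refl _)
  smooth := smoothEquidim_of_isIso (𝟙 S)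
  bundles := []

end Cycle

/-- The relations that identify isomorphic cobordism cycles, and a cobordism cycle on a disjoint
union `V₁ ⊔ V₂` with the sum of its restrictions to `V₁` and `V₂`. -/
def cycleRelations (X : Over S) : AddSubgroup (FreeAbelianGroup (Cycle X)) :=
  AddSubgroup.closure
    ({z | ∃ c c' : Cycle X, c.Isom c' ∧ z = FreeAbelianGroup.of c - FreeAbelianGroup.of c'} ∪
     {z | ∃ (c c₁ c₂ : Cycle X) (i₁ : c₁.V ⟶ c.V) (i₂ : c₂.V ⟶ c.V),
        Nonempty (IsColimit (BinaryCofan.mk i₁ i₂)) ∧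
        c₁.IsRestriction c i₁ c.bundles ∧ c₂.IsRestriction c i₂ c.bundles ∧
        z = FreeAbelianGroup.of c - (FreeAbelianGroup.of c₁ + FreeAbelianGroup.of c₂)})

/-- `𝒵^*(X ⟶ S)`, generated by the isomorphism classes of cobordism cycles. Where sources have
finitely many connected components, this is the free abelian group on the isomorphism classes of
cobordism cycles with connected source. -/
abbrev PreCobordism (X : Over S) : Type (u + 1) :=
  FreeAbelianGroup (Cycle X) ⧸ cycleRelations X

/-- The class of a cobordism cycle in `𝒵^*(X ⟶ S)`. -/
def PreCobordism.of {X : Over S} (c : Cycle X) : PreCobordism X :=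
  QuotientAddGroup.mk (FreeAbelianGroup.of c)

/-- `⟨ℛ^Dim⟩(X ⟶ S)`, generated by the `[V ⟶ X; π^*L₁, …, π^*L_r, M₁, …, M_s]` with smooth
morphisms `π : V ⟶ S'` and `S' ⟶ S`, where `r` is greater than the relative dimension of
`S' ⟶ S`. -/
def dimRelations (X : Over S) : AddSubgroup (PreCobordism X) :=
  AddSubgroup.closure
    {z | ∃ (c : Cycle X) (S' : Over S) (π : c.V ⟶ S') (n : ℕ) (Ls : List (LineBundle S'.left))
      (Ms : List (LineBundle c.V.left)),
      SmoothEquidim π.left ∧ SmoothOfRelativeDimension n S'.hom ∧ n < Ls.length ∧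
      c.bundles = Ls.map (LineBundle.pullback π.left) ++ Ms ∧ z = PreCobordism.of c}

/-- `𝒵^* / ⟨ℛ^Dim⟩` -/
abbrev DimQuotient (X : Over S) : Type (u + 1) := PreCobordism X ⧸ dimRelations X

/-- The class of a cobordism cycle in `𝒵^* / ⟨ℛ^Dim⟩`. -/
def DimQuotient.of {X : Over S} (c : Cycle X) : DimQuotient X :=
  QuotientAddGroup.mk (PreCobordism.of c)

/-- `⟨ℛ^Sect⟩(X ⟶ S)`, generated by the
`[V ⟶ X; L₁, …, L_r] - [Z ⟶ X; i^*L₁, …, i^*L_{r-1}]`, where `i : Z ⟶ V` is the zero scheme of a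
section of `L_r` that is transverse to the zero section on the fibres of `V ⟶ S`. -/
def sectRelations (X : Over S) : AddSubgroup (DimQuotient X) :=
  AddSubgroup.closure
    {z | ∃ (c cZ : Cycle X) (i : cZ.V ⟶ c.V) (Ls : List (LineBundle c.V.left))
      (L : LineBundle c.V.left) (s : L.Sec),
      c.bundles = Ls ++ [L] ∧ s.IsZeroScheme i.left ∧ FibrewiseTransverse c.V.hom i.left ∧
      cZ.IsRestriction c i Ls ∧ z = DimQuotient.of c - DimQuotient.of cZ}

/-- The quotient of `𝒵^* / ⟨ℛ^Dim⟩` by `⟨ℛ^Sect⟩`. -/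
abbrev SectQuotient (X : Over S) : Type (u + 1) := DimQuotient X ⧸ sectRelations X

/-- The class of a cobordism cycle in the quotient by `⟨ℛ^Dim⟩` and `⟨ℛ^Sect⟩`. -/
def SectQuotient.of {X : Over S} (c : Cycle X) : SectQuotient X :=
  QuotientAddGroup.mk (DimQuotient.of c)

/-- The `𝕃`-submodule generated by the
`[V ⟶ X; L₁, …, L_r, F_𝕃(L, M)] - [V ⟶ X; L₁, …, L_r, L ⊗ M]`, where
`[V ⟶ X; L₁, …, L_r, F_𝕃(L, M)] = ∑ a_{ij} [V ⟶ X; L₁, …, L_r, L, …, L, M, …, M]` with `i` copies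
of `L` and `j` copies of `M`; the terms in which `i` or `j` exceeds the relative dimension `d` of
`V ⟶ S` vanish. -/
def fglRelations (X : Over S) : Submodule Lazard (Lazard ⊗[ℤ] SectQuotient X) :=
  Submodule.span Lazard
    {z | ∃ (c : Cycle X) (d : ℕ) (L M : LineBundle c.V.left),
      SmoothOfRelativeDimension d c.V.hom ∧
      z = ∑ i ∈ Finset.range (d + 1), ∑ j ∈ Finset.range (d + 1),
          lazardCoeff i j ⊗ₜ[ℤ]
            SectQuotient.of (c.append (List.replicate i L ++ List.replicate j M)) -
        1 ⊗ₜ[ℤ] SectQuotient.of (c.append [L.tensor M])}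

/-- The algebraic cobordism `Ω^*(X ⟶ S)` of an `S`-scheme `X`. -/
abbrev Omega (X : Over S) : Type (u + 1) := (Lazard ⊗[ℤ] SectQuotient X) ⧸ fglRelations X

instance (X : Over S) : AddCommGroup (Omega X) :=
  Submodule.Quotient.addCommGroup (fglRelations X)

/-- The class of `a ⊗ [V ⟶ X; L₁, …, L_r]` in `Ω^*(X ⟶ S)`. -/
def Omega.of {X : Over S} (a : Lazard) (c : Cycle X) : Omega X :=
  Submodule.Quotient.mk (a ⊗ₜ[ℤ] SectQuotient.of c)

/-- The degree `k` part of `Ω^*(X ⟶ S)`: it is generated by the `a ⊗ [V ⟶ X; L₁, …, L_r]` with `a`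
homogeneous of degree `m` in the homological grading of `𝕃`, where `V ⟶ S` has relative dimension
`d` and `k = r - d - m`. -/
def Omega.grade (X : Over S) (k : ℤ) : AddSubgroup (Omega X) :=
  AddSubgroup.closure
    {z | ∃ (m d : ℕ) (a : Lazard) (c : Cycle X), a ∈ lazardGrade m ∧
      SmoothOfRelativeDimension d c.V.hom ∧ k = (c.bundles.length : ℤ) - d - m ∧
      z = Omega.of a c}

/-- `O` is the standard structure on `Ω^*(- ⟶ S)`: the additive operations are the ones given on
generators by the operations on cobordism cycles. These formulas determine `O`. -/
structure IsCobordismStructure (O : GeometricFunctor S (fun X : Over S => Omega X)) : Prop where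
  grade : ∀ (X : Over S) (k : ℤ), O.grade X k = Omega.grade X k
  push : ∀ {X Y : Over S} (f : X ⟶ Y) (hf : IsProper f.left) (a : Lazard) (c : Cycle X),
    O.push f hf (Omega.of a c) = Omega.of a (c.push f hf)
  pull : ∀ {X Y : Over S} (f : X ⟶ Y) (hf : SmoothEquidim f.left) (a : Lazard) (c : Cycle Y)
    (W' : Over S) (f' : W' ⟶ c.V) (k' : W' ⟶ X) (sq : IsPullback f' k' c.map f),
    O.pull f hf (Omega.of a c) = Omega.of a (c.pull f hf f' k' sq)
  chern : ∀ {X : Over S} (L : LineBundle X.left) (a : Lazard) (c : Cycle X),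
    O.chern L (Omega.of a c) = Omega.of a (c.chern L)
  prod : ∀ {X Y : Over S} (a b : Lazard) (c : Cycle X) (c' : Cycle Y),
    O.prod (Omega.of a c) (Omega.of b c') = Omega.of (a * b) (c.prod c')
  one : O.one = Omega.of 1 (Cycle.one S)
  Phi : ∀ a : Lazard, O.Phi a = Omega.of a (Cycle.one S)

end RelCobordism

end

/-! `Ω^*(X ⟶ S)` is given by generators and relations, so there are three things to show: the
operations on cycles respect the relations, the axioms hold on generators, and the generators are
expressible through the operations.

A function on cycles that respects isomorphism, disjoint unions and the dimension, section and
formal group law relations extends to `Ω^*`: this is `Omega.Compatible` with `Omega.lift`. For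
pushforward and Chern operators the check is direct. For smooth pullback, disjoint unions, zero
schemes and transversality must be stable under base change. The formal group law sum must also be
truncated at a larger relative dimension, where the dimension relation kills the extra terms
(`Omega.of_fgl_pullback`). The external product needs no separate check: for a fixed cycle `[k : W ⟶
Y; M_•]` it is `x ↦ (id × k)_* c̃₁(M_•) pr^* x`, which is additive in `x`, and commutativity
transfers this to the other variable. Each axiom becomes an isomorphism of cycles by
`Omega.hom_ext`. Pullback of line bundles is strictly functorial, so apart from permutations the
lists of bundles usually agree on the nose.

The grading is the delicate point, because the homogeneous pieces must be shown independent. A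
homomorphism from `Ω^*` to Laurent polynomials over `Ω^*` records the degree of each generator in
the exponent of `T`. It is well defined because the relations are homogeneous and a nonempty smooth
scheme has only one relative dimension; empty cycles vanish. It also requires a grading of the
Lazard ring. That comes from the fact that `u F(u⁻¹X, u⁻¹Y)` is again a commutative formal group
law, applied with `u = T`.

For universality, `[h : V ⟶ X; L₁, …, L_r] = h_* c̃₁(L₁) ⋯ c̃₁(L_r) π_V^* 1_S` holds in `Ω^*`, so a
transformation has no choice on generators. Conversely the same expression in `A`
(`GeometricFunctor.cycleClass`) respects the relations. The geometric axioms are assumed for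
fundamental classes only, but pulling back, applying Chern operators and pushing forward spreads
them to all cycles. -/

noncomputable section

/-! ### Strict functoriality of pullback for line bundles and their sections. -/

namespace RelCobordism
namespace LineBundle

variable {X Y Z : Scheme.{u}}

lemma pb_id {U V : X.Opens} (h : V ≤ U) : pb (𝟙 X) (U := U) (V := V) h = res h := by
  simp only [pb, res, Scheme.Hom.appLE, Scheme.Hom.id_app]
  exact congrArg CommRingCat.Hom.hom (Category.id_comp _)

lemma pb_pb (f : Y ⟶ X) (g : Z ⟶ Y) {U : X.Opens} {V : Y.Opens} {W : Z.Opens}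
    (h : V ≤ f ⁻¹ᵁ U) (h' : W ≤ g ⁻¹ᵁ V) (h'' : W ≤ (g ≫ f) ⁻¹ᵁ U) (x : Γ(X, U)) :
    pb g h' (pb f h x) = pb (g ≫ f) h'' x := by
  simp only [pb]
  rw [← CommRingCat.comp_apply, Scheme.Hom.appLE_comp_appLE]

lemma res_self {U : X.Opens} (h : U ≤ U) (x : Γ(X, U)) : res h x = x := by
  simp [res]

lemma pullback_id (L : LineBundle X) : L.pullback (𝟙 X) = L := by
  cases L with | mk ι U cover g cocycle =>
  unfold pullback
  congr 1
  ext i j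
  simp only [RingHom.toMonoidHom_eq_coe, Units.coe_map, MonoidHom.coe_coe]
  exact (congrArg (fun r : _ →+* _ => r (g i j).1) (pb_id _)).trans (res_self _ _)

/-- Preimages of open sets compose definitionally, so cocycles pull back functorially with equality
and not only up to isomorphism. Lists of bundles can therefore be rewritten along equations between
morphisms. -/
lemma pullback_comp (f : Y ⟶ X) (g : Z ⟶ Y) (L : LineBundle X) :
    L.pullback (g ≫ f) = (L.pullback f).pullback g := by
  unfold pullback
  congr 1
  ext i j
  simp only [RingHom.toMonoidHom_eq_coe, Units.coe_map, MonoidHom.coe_coe]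
  rw [pb_pb]
  rfl

lemma pullback_tensor (f : Y ⟶ X) (L M : LineBundle X) :
    (L.tensor M).pullback f = (L.pullback f).tensor (M.pullback f) := by
  unfold pullback tensor
  congr 1
  ext p q
  simp only [RingHom.toMonoidHom_eq_coe, Units.coe_map, MonoidHom.coe_coe, map_mul, Units.val_mul]
  exact congrArg₂ (· * ·) (res_pb f _ _ _ _ _).symm (res_pb f _ _ _ _ _).symm

lemma Isom.refl (L : LineBundle X) : L.Isom L :=
  ⟨L.g, L.cocycle, L.cocycle⟩

lemma Isom.pullback (f : Y ⟶ X) {L M : LineBundle X} (h : L.Isom M) :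
    (L.pullback f).Isom (M.pullback f) := by
  obtain ⟨a, h₁, h₂⟩ := h
  refine ⟨fun i k => Units.map (pb f (le_preimage_inf f (L.U i) (M.U k))).toMonoidHom (a i k),
    fun i j k => ?_, fun i k l => ?_⟩
  · have hle : f ⁻¹ᵁ L.U i ⊓ f ⁻¹ᵁ L.U j ⊓ f ⁻¹ᵁ M.U k ≤ f ⁻¹ᵁ (L.U i ⊓ L.U j ⊓ M.U k) := le_rfl
    have h := congrArg (pb f hle) (h₁ i j k)
    rw [map_mul] at h
    simp only [Units.coe_map, RingHom.toMonoidHom_eq_coe, MonoidHom.coe_coe]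
    rw [res_pb f _ _ _ hle, res_pb f _ _ _ hle, res_pb f _ _ _ hle]
    exact h
  · have hle : f ⁻¹ᵁ L.U i ⊓ f ⁻¹ᵁ M.U k ⊓ f ⁻¹ᵁ M.U l ≤ f ⁻¹ᵁ (L.U i ⊓ M.U k ⊓ M.U l) := le_rfl
    have h := congrArg (pb f hle) (h₂ i k l)
    rw [map_mul] at h
    simp only [Units.coe_map, RingHom.toMonoidHom_eq_coe, MonoidHom.coe_coe]
    rw [res_pb f _ _ _ hle, res_pb f _ _ _ hle, res_pb f _ _ _ hle]
    exact h

/-- The pullback of a section. -/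
def Sec.pullback (f : Y ⟶ X) {L : LineBundle X} (s : L.Sec) : (L.pullback f).Sec where
  val i := pb f le_rfl (s.val i)
  compat i j := by
    have h := congrArg (pb f (le_preimage_inf f (L.U i) (L.U j))) (s.compat i j)
    rw [map_mul] at h
    simp only [Units.coe_map, RingHom.toMonoidHom_eq_coe, MonoidHom.coe_coe]
    rw [res_pb f _ _ inf_le_left (le_preimage_inf f _ _),
      res_pb f _ _ inf_le_right (le_preimage_inf f _ _)]
    exact h

/-- The zero scheme is defined by its functor of points, and `t` factors through the base change of
`Z` exactly when `t ≫ f` factors through `Z`. -/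
lemma Sec.IsZeroScheme.pullback {L : LineBundle X} {s : L.Sec} {Z Z' : Scheme.{u}} {i : Z ⟶ X}
    (h : s.IsZeroScheme i) {f : Y ⟶ X} {f' : Z' ⟶ Z} {i' : Z' ⟶ Y} (sq : IsPullback f' i' i f) :
    (s.pullback f).IsZeroScheme i' := by
  refine ⟨MorphismProperty.of_isPullback sq h.1, fun T t => ?_⟩
  have : (∃ t' : T ⟶ Z', t' ≫ i' = t) ↔ ∃ t' : T ⟶ Z, t' ≫ i = t ≫ f :=
    ⟨fun ⟨t', ht⟩ => ⟨t' ≫ f', by rw [Category.assoc, sq.w, reassoc_of% ht]⟩,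
      fun ⟨t', ht⟩ => ⟨sq.lift t' t ht, sq.lift_snd _ _ _⟩⟩
  rw [this, h.2]
  refine forall_congr' fun k => ?_
  have : (t ≫ f).app (L.U k) (s.val k) = t.app (f ⁻¹ᵁ L.U k) ((s.pullback f).val k) := by
    have h₁ : (s.pullback f).val k = f.app (L.U k) (s.val k) :=
      congrArg (fun r : Γ(X, L.U k) ⟶ _ => r (s.val k)) (Scheme.Hom.appLE_eq_app (f := f))
    have h₂ := congrArg (fun r : Γ(X, L.U k) ⟶ _ => r (s.val k)) (Scheme.Hom.comp_app t f (L.U k))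
    rw [h₁]
    exact h₂
  rw [this]
  rfl

end LineBundle
end RelCobordism

/-! ### Uniqueness of the relative dimension, and disjoint unions of schemes. -/

namespace RelCobordism

/-- A nonempty scheme has at most one relative dimension over a base. -/
lemma relativeDimension_unique {X Y : Scheme.{u}} [Nonempty X] (f : X ⟶ Y) {d e : ℕ}
    (hd : SmoothOfRelativeDimension d f) (he : SmoothOfRelativeDimension e f) : d = e := by
  obtain ⟨x⟩ := ‹Nonempty X›
  obtain ⟨U, hU, V, hV, hx, hle, hs⟩ := hd.exists_isStandardSmoothOfRelativeDimension x
  -- The chart is standard smooth of dimension `d`, but dimension `e` is known only on the members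
  -- `D(t)` of a cover of it. Some `t` lies outside a maximal ideal, so `D(t)` is nonempty, and
  -- there the rank of the Kähler differentials is both `d` and `e`.
  obtain ⟨s, hspan, hloc⟩ := HasRingHomProperty.appLE _ f he ⟨U, hU⟩ ⟨V, hV⟩ hle
  have : Nonempty V := ⟨⟨x, hx⟩⟩
  obtain ⟨q, hq⟩ := Ideal.exists_maximal Γ(X, V)
  obtain ⟨t, hts, htq⟩ : ∃ t ∈ s, t ∉ q := by
    by_contra! h
    exact hq.ne_top (top_le_iff.mp (hspan ▸ Ideal.span_le.mpr h))
  have : Nontrivial (Localization.Away t) := by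
    rw [← not_subsingleton_iff_nontrivial]
    intro hsub
    obtain ⟨n, hn⟩ := (IsLocalization.subsingleton_iff (S := Localization.Away t)
      (M := Submonoid.powers t)).mp hsub
    exact htq (hq.isPrime.mem_of_pow_mem n ((congrArg (· ∈ q) hn).mpr q.zero_mem))
  have h₁ := (RingHom.isStandardSmoothOfRelativeDimension_stableUnderCompositionWithLocalizationAway
    d).right (Localization.Away t) t
    (f.appLE U V hle).hom hs
  have h₂ := hloc t hts
  algebraize [(algebraMap Γ(X, V) (Localization.Away t)).comp (f.appLE U V hle).hom]
  have h₁' : Algebra.IsStandardSmoothOfRelativeDimension d Γ(Y, U) (Localization.Away t) := h₁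
  have h₂' : Algebra.IsStandardSmoothOfRelativeDimension e Γ(Y, U) (Localization.Away t) := h₂
  exact Nat.cast_injective
    ((Algebra.IsStandardSmoothOfRelativeDimension.rank_kaehlerDifferential (R := Γ(Y, U))
      (S := Localization.Away t) d).symm.trans
    (Algebra.IsStandardSmoothOfRelativeDimension.rank_kaehlerDifferential (R := Γ(Y, U))
      (S := Localization.Away t) e))

lemma SmoothOfRelativeDimension.of_isPullback {W X Y Z : Scheme.{u}} {g' : W ⟶ X} {f' : W ⟶ Y}
    {f : X ⟶ Z} {g : Y ⟶ Z} (sq : IsPullback g' f' f g) {d : ℕ}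
    (hg : SmoothOfRelativeDimension d g) : SmoothOfRelativeDimension d g' := by
  have := smoothOfRelativeDimension_isStableUnderBaseChange.{u} d
  exact MorphismProperty.of_isPullback (P := @SmoothOfRelativeDimension.{u} d) sq.flip hg

variable {S : Scheme.{u}}

/-- `X` and `Y`, with the morphisms `i` and `j`, form a disjoint union decomposition of `Z`. -/
def IsDisjointUnion {X Y Z : Over S} (i : X ⟶ Z) (j : Y ⟶ Z) : Prop :=
  Nonempty (IsColimit (BinaryCofan.mk i j))

/-- The forgetful functor from `S`-schemes preserves and reflects coproducts; this gives access to
the extensivity of the category of schemes. -/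
lemma isDisjointUnion_iff {X Y Z : Over S} {i : X ⟶ Z} {j : Y ⟶ Z} :
    IsDisjointUnion i j ↔ Nonempty (IsColimit (BinaryCofan.mk i.left j.left)) :=
  ⟨fun ⟨h⟩ => ⟨mapIsColimitOfPreservesOfIsColimit (Over.forget S) i j h⟩,
    fun ⟨h⟩ => ⟨isColimitOfReflectsOfMapIsColimit (Over.forget S) i j h⟩⟩

namespace IsDisjointUnion

variable {X Y Z X' Y' Z' : Over S} {i : X ⟶ Z} {j : Y ⟶ Z}

lemma isOpenImmersion_left (h : IsDisjointUnion i j) : IsOpenImmersion i.left := by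
  obtain ⟨h⟩ := isDisjointUnion_iff.mp h
  let e : X.left ⨿ Y.left ≅ Z.left := (coprodIsCoprod _ _).coconePointUniqueUpToIso h
  have : i.left = coprod.inl ≫ e.hom :=
    ((coprodIsCoprod _ _).comp_coconePointUniqueUpToIso_hom h ⟨WalkingPair.left⟩).symm
  rw [this]
  infer_instance

lemma symm (h : IsDisjointUnion i j) : IsDisjointUnion j i :=
  h.map BinaryCofan.isColimitFlip

lemma isOpenImmersion_right (h : IsDisjointUnion i j) : IsOpenImmersion j.left :=
  h.symm.isOpenImmersion_left

/-- Disjoint unions are stable under base change. -/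
lemma of_isPullback (h : IsDisjointUnion i j) {i' : X' ⟶ Z'} {j' : Y' ⟶ Z'} {a : X' ⟶ X}
    {b : Y' ⟶ Y} {f : Z' ⟶ Z} (hi : IsPullback i' a f i) (hj : IsPullback j' b f j) :
    IsDisjointUnion i' j' := by
  rw [isDisjointUnion_iff] at h ⊢
  obtain ⟨h⟩ := h
  exact ((BinaryCofan.isVanKampen_iff _).mp (FinitaryExtensive.vanKampen _ h)
    (BinaryCofan.mk i'.left j'.left) a.left b.left f.left
    (hi.map (Over.forget S)).w.symm (hj.map (Over.forget S)).w.symm).mpr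
    ⟨hi.map (Over.forget S), hj.map (Over.forget S)⟩

/-- The two parts of a disjoint union have empty intersection. -/
lemma isEmpty_of_comp_eq (h : IsDisjointUnion i j) {W : Over S} (a : W ⟶ X) (b : W ⟶ Y)
    (hab : a ≫ i = b ≫ j) : IsEmpty W.left := by
  obtain ⟨h⟩ := isDisjointUnion_iff.mp h
  have hv := FinitaryExtensive.vanKampen _ h
  -- In a van Kampen coproduct the two summands meet in the initial object, so a point of `W` would
  -- give a point of the empty scheme.
  have sq := BinaryCofan.isPullback_initial_to_of_isVanKampen hv
  have hw : b.left ≫ j.left = a.left ≫ i.left := by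
    rw [← Over.comp_left, ← Over.comp_left, hab]
  by_contra hW
  rw [not_isEmpty_iff] at hW
  obtain ⟨x⟩ := hW
  first
  | exact (inferInstance : IsEmpty (⊥_ Scheme.{u})).false (sq.lift b.left a.left hw x)
  | exact (inferInstance : IsEmpty (⊥_ Scheme.{u})).false (sq.lift a.left b.left hw.symm x)

/-- A scheme is the disjoint union of itself and an empty scheme. -/
lemma id_of_isEmpty {W : Over S} (hW : IsEmpty W.left) (f : W ⟶ X) :
    IsDisjointUnion (𝟙 X) f := by
  rw [isDisjointUnion_iff]
  have : IsOpenImmersion (𝟙 X : X ⟶ X).left := inferInstanceAs (IsOpenImmersion (𝟙 X.left))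
  refine nonempty_isColimit_binaryCofanMk_of_isCompl _ _ ?_
  have h₁ : (𝟙 X : X ⟶ X).left.opensRange = ⊤ := Scheme.Hom.opensRange_of_isIso (𝟙 X.left)
  have h₂ : f.left.opensRange = ⊥ := by
    ext x
    simp
  rw [h₁, h₂]
  exact isCompl_top_bot

end IsDisjointUnion

end RelCobordism

/-! ### Rescaled formal group laws and the twisted homomorphisms from the Lazard ring. -/

namespace RelCobordism

section FormalGroupLaws

open MvPowerSeries

variable {R : Type*} [CommRing R]

/-- The formal group law `u F(u⁻¹ X, u⁻¹ Y)` for a unit `u`. -/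
def rescaleSeries (F : MvPowerSeries (Fin 2) R) (u : Rˣ) : MvPowerSeries (Fin 2) R :=
  (u : R) • rescale (fun _ => (↑u⁻¹ : R)) F

lemma coeff_rescaleSeries (F : MvPowerSeries (Fin 2) R) (u : Rˣ) (n : Fin 2 →₀ ℕ) :
    coeff n (rescaleSeries F u) = u * (↑u⁻¹ ^ (n 0 + n 1) * coeff n F) := by
  rw [rescaleSeries, coeff_smul, coeff_rescale, Finsupp.prod_fintype _ _ (by simp)]
  simp [Fin.prod_univ_two, pow_add]

lemma rescaleSeries_subst {σ : Type*} (F : MvPowerSeries (Fin 2) R) (u : Rˣ)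
    {a b : MvPowerSeries σ R} (h : HasSubst ![a, b]) :
    (rescaleSeries F u).subst ![a, b] =
      (u : R) • F.subst ![(↑u⁻¹ : R) • a, (↑u⁻¹ : R) • b] := by
  rw [rescaleSeries, subst_smul h, rescale_eq_subst, subst_comp_subst_apply (HasSubst.smul_X _) h]
  congr 2
  funext s
  simp only [Pi.smul_apply']
  rw [subst_smul h, subst_X h]
  fin_cases s <;> rfl

lemma hasSubst_pair {σ : Type*} {a b : MvPowerSeries σ R} (ha : PowerSeries.HasSubst a)
    (hb : PowerSeries.HasSubst b) : HasSubst ![a, b] :=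
  hasSubst_of_constantCoeff_nilpotent fun s => by
    fin_cases s
    exacts [ha, hb]

lemma hasSubst_smul {σ : Type*} (r : R) {a : MvPowerSeries σ R} (ha : PowerSeries.HasSubst a) :
    PowerSeries.HasSubst (r • a) := by
  change IsNilpotent _
  rw [smul_eq_C_mul, map_mul]
  exact (Commute.all _ _).isNilpotent_mul_left ha

/-- The formal group law `u F(u⁻¹ X, u⁻¹ Y)` for a unit `u`. -/
def rescaleFormalGroup (F : FormalGroup R) (u : Rˣ) : FormalGroup R where
  toPowerSeries := rescaleSeries F.toPowerSeries u
  zero_constantCoeff := by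
    rw [← coeff_zero_eq_constantCoeff_apply, coeff_rescaleSeries, coeff_zero_eq_constantCoeff_apply,
      F.zero_constantCoeff]
    simp
  lin_coeff_X := by
    rw [coeff_rescaleSeries, F.lin_coeff_X]
    simp
  lin_coeff_Y := by
    rw [coeff_rescaleSeries, F.lin_coeff_Y]
    simp
  assoc := by
    have hX (i : Fin 3) : PowerSeries.HasSubst (X i : MvPowerSeries (Fin 3) R) := by
      change IsNilpotent _
      simp
    have hF (i j : Fin 3) : PowerSeries.HasSubst ((rescaleSeries F.toPowerSeries u).subst
        ![(X i : MvPowerSeries (Fin 3) R), X j]) := by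
      rw [rescaleSeries_subst _ _ (hasSubst_pair (hX i) (hX j))]
      refine hasSubst_smul _ (IsNilpotent_subst ?_ ?_)
      · exact hasSubst_pair (hasSubst_smul _ (hX i)) (hasSubst_smul _ (hX j))
      · rw [F.zero_constantCoeff]
        exact IsNilpotent.zero
    rw [rescaleSeries_subst _ _ (hasSubst_pair (hF 0 1) (hX 2)),
      rescaleSeries_subst _ _ (hasSubst_pair (hX 0) (hF 1 2)),
      rescaleSeries_subst _ _ (hasSubst_pair (hX 0) (hX 1)),
      rescaleSeries_subst _ _ (hasSubst_pair (hX 1) (hX 2))]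
    -- The factor `u` of the inner series cancels against the `u⁻¹` of the outer one. What is left
    -- is associativity of `F` at the rescaled variables `u⁻¹ X i`.
    simp only [smul_smul, Units.inv_mul, one_smul]
    rw [F.assoc' (hasSubst_smul _ (hX 0)) (hasSubst_smul _ (hX 1)) (hasSubst_smul _ (hX 2))]

lemma rescaleFormalGroup_isComm (F : FormalGroup R) [F.IsComm] (u : Rˣ) :
    (rescaleFormalGroup F u).IsComm where
  comm := by
    have hX (i : Fin 2) : PowerSeries.HasSubst (X i : MvPowerSeries (Fin 2) R) := by
      change IsNilpotent _
      simp
    have h : rescaleSeries F.toPowerSeries u =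
        (rescaleSeries F.toPowerSeries u).subst ![X 0, X 1] := by
      conv_lhs => rw [← id_eq (rescaleSeries F.toPowerSeries u), ← subst_self]
      congr 1
      funext s
      fin_cases s <;> rfl
    change rescaleSeries F.toPowerSeries u = (rescaleSeries F.toPowerSeries u).subst _
    rw [rescaleSeries_subst _ _ (hasSubst_pair (hX 1) (hX 0)),
      F.comm' (hasSubst_smul _ (hX 1)) (hasSubst_smul _ (hX 0)),
      ← rescaleSeries_subst _ _ (hasSubst_pair (hX 0) (hX 1)), ← h]

lemma coeff_genericSeries (n : Fin 2 →₀ ℕ) : coeff n genericSeries = genericSeries n := rfl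

lemma constantCoeff_genericSeries : constantCoeff genericSeries = 0 := by
  rw [← coeff_zero_eq_constantCoeff_apply, coeff_genericSeries]
  simp [genericSeries]

lemma map_subst_pair {σ : Type*} {A : Type*} [CommRing A] (φ : A →+* R)
    (F : MvPowerSeries (Fin 2) A) {a b : MvPowerSeries σ A} (h : HasSubst ![a, b]) :
    map φ (F.subst ![a, b]) = (map φ F).subst ![map φ a, map φ b] := by
  rw [map_subst h]
  congr 1
  funext s
  fin_cases s <;> rfl

/-- The image of the generic series under a homomorphism that kills the Lazard ideal is a formal
group law. -/
def formalGroupOfHom (φ : MvPolynomial (ℕ × ℕ) ℤ →+* R) (h : lazardIdeal ≤ RingHom.ker φ) :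
    FormalGroup R where
  toPowerSeries := map φ genericSeries
  zero_constantCoeff := by
    rw [← coeff_zero_eq_constantCoeff_apply, coeff_map, coeff_zero_eq_constantCoeff_apply,
      constantCoeff_genericSeries, map_zero]
  lin_coeff_X := by
    rw [coeff_map, coeff_genericSeries]
    simp [genericSeries]
  lin_coeff_Y := by
    rw [coeff_map, coeff_genericSeries]
    simp [genericSeries]
  assoc := by
    have key : map φ (genericSeries.subst ![genericSeries.subst ![X 0, X 1], X 2]) =
        map φ (genericSeries.subst ![X 0, genericSeries.subst
          ![(X 1 : MvPowerSeries (Fin 3) (MvPolynomial (ℕ × ℕ) ℤ)), X 2]]) := by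
      ext n
      have := h (Ideal.subset_span (Or.inr ⟨n, rfl⟩))
      rw [RingHom.mem_ker, map_sub, map_sub, sub_eq_zero] at this
      rwa [coeff_map, coeff_map]
    rw [map_subst_pair _ _ (HasSubst.cons_subst_zero_left 0 1 2 constantCoeff_genericSeries),
      map_subst_pair _ _ (HasSubst.cons_subst_zero_right 0 1 2 constantCoeff_genericSeries),
      map_subst_pair _ _ HasSubst.X_X, map_subst_pair _ _ HasSubst.X_X] at key
    simpa only [map_X] using key

lemma formalGroupOfHom_isComm (φ : MvPolynomial (ℕ × ℕ) ℤ →+* R)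
    (h : lazardIdeal ≤ RingHom.ker φ) : (formalGroupOfHom φ h).IsComm where
  comm := by
    have key : map φ genericSeries = map φ (genericSeries.subst ![X 1, X 0]) := by
      ext n
      have := h (Ideal.subset_span (Or.inl ⟨n, rfl⟩))
      rw [RingHom.mem_ker, map_sub, map_sub, sub_eq_zero] at this
      rwa [coeff_map, coeff_map]
    rw [map_subst_pair _ _ HasSubst.X_X, map_X, map_X] at key
    exact key

/-- A homomorphism that sends the generic series to a commutative formal group law kills the
Lazard ideal. -/
lemma lazardIdeal_le_ker (φ : MvPolynomial (ℕ × ℕ) ℤ →+* R) (F : FormalGroup R) [hF : F.IsComm]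
    (h : map φ genericSeries = F.toPowerSeries) : lazardIdeal ≤ RingHom.ker φ := by
  refine Ideal.span_le.mpr ?_
  rintro z (⟨n, rfl⟩ | ⟨n, rfl⟩)
  · rw [SetLike.mem_coe, RingHom.mem_ker, ← coeff_map, map_sub, map_subst_pair _ _ HasSubst.X_X, h]
    simp only [map_X]
    rw [← hF.comm, sub_self, map_zero]
  · rw [SetLike.mem_coe, RingHom.mem_ker, ← coeff_map, map_sub,
      map_subst_pair _ _ (HasSubst.cons_subst_zero_left 0 1 2 constantCoeff_genericSeries),
      map_subst_pair _ _ (HasSubst.cons_subst_zero_right 0 1 2 constantCoeff_genericSeries),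
      map_subst_pair _ _ HasSubst.X_X, map_subst_pair _ _ HasSubst.X_X, h]
    simp only [map_X]
    rw [F.assoc, sub_self, map_zero]

/-- `X (i, j) ↦ a_{i+1, j+1} u^{-(i+j+1)}`, where `a_{i+1, j+1}` is the image of `X (i, j)` under
`q`. -/
def scaleHom (q : MvPolynomial (ℕ × ℕ) ℤ →+* R) (u : Rˣ) : MvPolynomial (ℕ × ℕ) ℤ →+* R :=
  MvPolynomial.eval₂Hom (Int.castRingHom R) fun p : ℕ × ℕ =>
    q (MvPolynomial.X p) * (↑u⁻¹ : R) ^ (p.1 + p.2 + 1)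

/-- The factor `u^{1 - (n 0 + n 1)}` is the one that rescaling puts on the coefficient of index `n`,
so the generic series goes to the rescaling of its image under `q`. The exponent is zero on the
linear terms, whose coefficients stay equal to `1`. -/
lemma scaleHom_genericSeries (q : MvPolynomial (ℕ × ℕ) ℤ →+* R) (u : Rˣ) (n : Fin 2 →₀ ℕ) :
    scaleHom q u (genericSeries n) = u * ((↑u⁻¹ : R) ^ (n 0 + n 1) * q (genericSeries n)) := by
  unfold genericSeries
  split
  · rename_i i j h₀ h₁
    rw [scaleHom, MvPolynomial.eval₂Hom_X', h₀, h₁, show i + 1 + (j + 1) = i + j + 1 + 1 by ring,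
      pow_succ (↑u⁻¹ : R) (i + j + 1)]
    linear_combination (-q (MvPolynomial.X (i, j)) * (↑u⁻¹ : R) ^ (i + j + 1)) * u.mul_inv
  · rename_i h₀ h₁
    simp [h₀, h₁]
  · rename_i h₀ h₁
    simp [h₀, h₁]
  · simp

lemma scaleHom_monomial (q : MvPolynomial (ℕ × ℕ) ℤ →+* R) (u : Rˣ) (d : ℕ × ℕ →₀ ℕ) (r : ℤ) :
    scaleHom q u (MvPolynomial.monomial d r) = q (MvPolynomial.monomial d r) *
      (↑u⁻¹ : R) ^ (Finsupp.weight (fun p : ℕ × ℕ => p.1 + p.2 + 1) d) := by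
  have hq : q (MvPolynomial.C r) = (r : R) := by
    rw [← MvPolynomial.algebraMap_eq, eq_intCast, map_intCast]
  rw [scaleHom, MvPolynomial.eval₂Hom_monomial, MvPolynomial.monomial_eq, map_mul, hq,
    Finsupp.weight_apply, Finsupp.sum, ← Finset.prod_pow_eq_pow_sum, Finsupp.prod, Finsupp.prod,
    map_prod, eq_intCast, mul_assoc, ← Finset.prod_mul_distrib]
  congr 1
  refine Finset.prod_congr rfl fun p _ => ?_
  rw [mul_pow, map_pow, ← pow_mul, smul_eq_mul, mul_comm (d p)]

/-- The generic series goes to a rescaled law, which is again a commutative formal group law, so the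
defining relations hold for it. This takes the place of a direct proof that the Lazard ideal is
homogeneous. -/
lemma lazardIdeal_le_ker_scaleHom (q : MvPolynomial (ℕ × ℕ) ℤ →+* R)
    (hq : lazardIdeal ≤ RingHom.ker q) (u : Rˣ) : lazardIdeal ≤ RingHom.ker (scaleHom q u) := by
  have := formalGroupOfHom_isComm q hq
  have := rescaleFormalGroup_isComm (formalGroupOfHom q hq) u
  refine lazardIdeal_le_ker _ (rescaleFormalGroup (formalGroupOfHom q hq) u) ?_
  ext1 n
  change _ = MvPowerSeries.coeff n (rescaleSeries (MvPowerSeries.map q genericSeries) u)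
  rw [MvPowerSeries.coeff_map, coeff_rescaleSeries, MvPowerSeries.coeff_map, coeff_genericSeries,
    scaleHom_genericSeries]

/-- For a homomorphism `q` from the Lazard ring and a unit `u`, the homomorphism that sends an
element `a` of degree `m` to `q(a) u^{-m}`. -/
def twist (q : Lazard →+* R) (u : Rˣ) : Lazard →+* R :=
  Ideal.Quotient.lift lazardIdeal (scaleHom (q.comp (Ideal.Quotient.mk lazardIdeal)) u) fun _ h =>
    RingHom.mem_ker.mp (lazardIdeal_le_ker_scaleHom _ (fun x hx => by
      rw [RingHom.mem_ker, RingHom.comp_apply, Ideal.Quotient.eq_zero_iff_mem.mpr hx, map_zero])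
      u h)

lemma twist_mk (q : Lazard →+* R) (u : Rˣ) (P : MvPolynomial (ℕ × ℕ) ℤ) :
    twist q u (Ideal.Quotient.mk lazardIdeal P) =
      scaleHom (q.comp (Ideal.Quotient.mk lazardIdeal)) u P :=
  Ideal.Quotient.lift_mk _ _ _

lemma twist_lazardCoeff (q : Lazard →+* R) (u : Rˣ) (i j : ℕ) :
    twist q u (lazardCoeff i j) = u * ((↑u⁻¹ : R) ^ (i + j) * q (lazardCoeff i j)) := by
  unfold lazardCoeff
  rw [twist_mk, coeff_genericSeries, scaleHom_genericSeries]
  simp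

lemma twist_of_mem (q : Lazard →+* R) (u : Rˣ) {n : ℕ} {a : Lazard} (ha : a ∈ lazardGrade n) :
    twist q u a = q a * (↑u⁻¹ : R) ^ n := by
  obtain ⟨P, hP, rfl⟩ := ha
  rw [twist_mk, ← RingHom.comp_apply q, P.as_sum, map_sum, map_sum, Finset.sum_mul]
  refine Finset.sum_congr rfl fun d hd => ?_
  rw [scaleHom_monomial, hP (MvPolynomial.mem_support_iff.mp hd)]

end FormalGroupLaws

/-! ### The grading of the Lazard ring, read off from Laurent polynomials. -/

section LazardGrading

open LaurentPolynomial

/-- The unit `T` of the ring of Laurent polynomials. -/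
def laurentT (R : Type*) [CommRing R] : (R[T;T⁻¹])ˣ where
  val := T 1
  inv := T (-1)
  val_inv := by rw [← T_add]; simp
  inv_val := by rw [← T_add]; simp

/-- The grading of the Lazard ring as a homomorphism to Laurent polynomials: an element `a` of
degree `m` goes to `q(a) T^{-m}`. -/
def gradingHom {R : Type*} [CommRing R] (q : Lazard →+* R) : Lazard →+* R[T;T⁻¹] :=
  twist (C.comp q) (laurentT R)

lemma gradingHom_lazardCoeff {R : Type*} [CommRing R] (q : Lazard →+* R) (i j : ℕ) :
    gradingHom q (lazardCoeff i j) = C (q (lazardCoeff i j)) * T (1 - ((i + j : ℕ) : ℤ)) := by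
  rw [gradingHom, twist_lazardCoeff]
  change T 1 * (T (-1) ^ _ * C (q _)) = _
  rw [T_pow, ← mul_assoc, ← T_add, mul_comm]
  congr 2
  ring

lemma gradingHom_of_mem {R : Type*} [CommRing R] (q : Lazard →+* R) {n : ℕ} {a : Lazard}
    (ha : a ∈ lazardGrade n) : gradingHom q a = C (q a) * T (-(n : ℤ)) := by
  rw [gradingHom, twist_of_mem _ _ ha]
  change C (q a) * T (-1) ^ n = _
  rw [T_pow]
  congr 2
  ring

lemma mk_monomial_mem_lazardGrade (d : ℕ × ℕ →₀ ℕ) (r : ℤ) :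
    Ideal.Quotient.mk lazardIdeal (MvPolynomial.monomial d r) ∈
      lazardGrade (Finsupp.weight (fun p : ℕ × ℕ => p.1 + p.2 + 1) d) :=
  ⟨_, MvPolynomial.isWeightedHomogeneous_monomial _ _ _ rfl, rfl⟩

/-- The homogeneous elements generate the Lazard ring as an additive group. -/
lemma closure_lazardGrade : AddSubgroup.closure (⋃ n, lazardGrade n) = ⊤ := by
  refine top_le_iff.mp fun a _ => ?_
  obtain ⟨P, rfl⟩ := Ideal.Quotient.mk_surjective a
  rw [P.as_sum, map_sum]
  exact sum_mem fun d _ => AddSubgroup.subset_closure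
    (Set.mem_iUnion.mpr ⟨_, mk_monomial_mem_lazardGrade d _⟩)

lemma one_mem_lazardGrade : (1 : Lazard) ∈ lazardGrade 0 :=
  ⟨1, MvPolynomial.isWeightedHomogeneous_one _ _, map_one _⟩

lemma mul_mem_lazardGrade {m n : ℕ} {a b : Lazard} (ha : a ∈ lazardGrade m)
    (hb : b ∈ lazardGrade n) : a * b ∈ lazardGrade (m + n) := by
  obtain ⟨P, hP, rfl⟩ := ha
  obtain ⟨Q, hQ, rfl⟩ := hb
  exact ⟨P * Q, hP.mul hQ, map_mul _ _ _⟩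

end LazardGrading

end RelCobordism

/-! ### Relations in `Ω^*` and homomorphisms out of it. -/

namespace RelCobordism

variable {S : Scheme.{u}}

namespace Cycle

variable {X : Over S}

lemma isom_of_perm {c c' : Cycle X} (e : c.V ≅ c'.V) (he : e.hom ≫ c'.map = c.map)
    (h : (c'.bundles.map (LineBundle.pullback e.hom.left)).Perm c.bundles) : c.Isom c' :=
  ⟨e, he, _, h, List.forall₂_same.mpr fun _ _ => LineBundle.Isom.refl _⟩

/-- The cycle with the same morphism and other line bundles on the source. -/
def withBundles (c : Cycle X) (Ls : List (LineBundle c.V.left)) : Cycle X where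
  V := c.V
  map := c.map
  proper := c.proper
  smooth := c.smooth
  bundles := Ls

/-- The dimension and section relations expect certain bundles at the start or the end of the list.
Since isomorphisms of cycles may permute bundles, the relations then hold for any order. -/
lemma isom_withBundles (c : Cycle X) {Ls : List (LineBundle c.V.left)} (h : Ls.Perm c.bundles) :
    c.Isom (c.withBundles Ls) :=
  isom_of_perm (c' := c.withBundles Ls) (Iso.refl c.V) (Category.id_comp _) (by
    refine (List.Perm.of_eq ?_).trans h
    exact (List.map_congr_left fun L _ => LineBundle.pullback_id L).trans (List.map_id _))

end Cycle

namespace Omega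

variable {X : Over S}

lemma of_add (a b : Lazard) (c : Cycle X) : of (a + b) c = of a c + of b c := by
  simp only [of, TensorProduct.add_tmul, Submodule.Quotient.mk_add]

lemma smul_of (a b : Lazard) (c : Cycle X) : a • of b c = of (a * b) c := by
  simp only [of, ← Submodule.Quotient.mk_smul, TensorProduct.smul_tmul', smul_eq_mul]

/-- The homomorphism `x ↦ [a ⊗ x]`. -/
def ofHom (a : Lazard) : SectQuotient X →+ Omega X where
  toFun x := Submodule.Quotient.mk (a ⊗ₜ[ℤ] x)
  map_zero' := by rw [TensorProduct.tmul_zero, Submodule.Quotient.mk_zero]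
  map_add' x y := by rw [TensorProduct.tmul_add, Submodule.Quotient.mk_add]

lemma ofHom_of (a : Lazard) (c : Cycle X) : ofHom a (SectQuotient.of c) = of a c := rfl

lemma induction {p : Omega X → Prop} (h₀ : p 0) (h : ∀ a c, p (of a c))
    (hneg : ∀ x, p x → p (-x)) (hadd : ∀ x y, p x → p y → p (x + y)) (x : Omega X) : p x := by
  obtain ⟨t, rfl⟩ := Submodule.Quotient.mk_surjective _ x
  induction t with
  | zero => exact h₀
  | add s t hs ht =>
    rw [Submodule.Quotient.mk_add]
    exact hadd _ _ hs ht
  | tmul a y =>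
    obtain ⟨y, rfl⟩ := QuotientAddGroup.mk_surjective y
    obtain ⟨y, rfl⟩ := QuotientAddGroup.mk_surjective y
    obtain ⟨y, rfl⟩ := QuotientAddGroup.mk_surjective y
    change p (ofHom a _)
    induction y using FreeAbelianGroup.induction_on with
    | zero =>
      rw [QuotientAddGroup.mk_zero, QuotientAddGroup.mk_zero, QuotientAddGroup.mk_zero, map_zero]
      exact h₀
    | of c => exact h a c
    | neg c hc =>
      rw [QuotientAddGroup.mk_neg, QuotientAddGroup.mk_neg, QuotientAddGroup.mk_neg, map_neg]
      exact hneg _ hc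
    | add x y hx hy =>
      rw [QuotientAddGroup.mk_add, QuotientAddGroup.mk_add, QuotientAddGroup.mk_add, map_add]
      exact hadd _ _ hx hy

/-- The classes `of a c` generate `Ω^*` additively, with `a` running through the whole Lazard ring,
so no linearity over it is needed. Every identity of operations is checked in this way. -/
lemma hom_ext {B : Type*} [AddCommGroup B] {f g : Omega X →+ B}
    (h : ∀ a c, f (of a c) = g (of a c)) : f = g := by
  ext x
  induction x using induction with
  | h₀ => rw [map_zero, map_zero]
  | h a c => exact h a c
  | hneg x hx => rw [map_neg, map_neg, hx]
  | hadd x y hx hy => rw [map_add, map_add, hx, hy]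

lemma of_isom (a : Lazard) {c c' : Cycle X} (h : c.Isom c') : of a c = of a c' := by
  have : PreCobordism.of c = PreCobordism.of c' := by
    rw [← sub_eq_zero]
    exact (QuotientAddGroup.eq_zero_iff _).mpr (AddSubgroup.subset_closure (Or.inl ⟨c, c', h, rfl⟩))
  change ofHom a (QuotientAddGroup.mk (QuotientAddGroup.mk (PreCobordism.of c))) = _
  rw [this]
  rfl

lemma of_disjointUnion (a : Lazard) {c c₁ c₂ : Cycle X} {i₁ : c₁.V ⟶ c.V} {i₂ : c₂.V ⟶ c.V}
    (h : IsDisjointUnion i₁ i₂) (h₁ : c₁.IsRestriction c i₁ c.bundles)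
    (h₂ : c₂.IsRestriction c i₂ c.bundles) : of a c = of a c₁ + of a c₂ := by
  have : PreCobordism.of c = PreCobordism.of c₁ + PreCobordism.of c₂ := by
    rw [← sub_eq_zero]
    exact (QuotientAddGroup.eq_zero_iff _).mpr
      (AddSubgroup.subset_closure (Or.inr ⟨c, c₁, c₂, i₁, i₂, h, h₁, h₂, rfl⟩))
  change ofHom a (QuotientAddGroup.mk (QuotientAddGroup.mk (PreCobordism.of c))) = _
  rw [this, QuotientAddGroup.mk_add, QuotientAddGroup.mk_add, map_add]
  rfl

lemma of_eq_zero_of_dim (a : Lazard) {c : Cycle X} {S' : Over S} (π : c.V ⟶ S') {n : ℕ}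
    {Ls : List (LineBundle S'.left)} {Ms : List (LineBundle c.V.left)}
    (hπ : SmoothEquidim π.left) (hn : SmoothOfRelativeDimension n S'.hom) (hlt : n < Ls.length)
    (hb : c.bundles.Perm (Ls.map (LineBundle.pullback π.left) ++ Ms)) : of a c = 0 := by
  rw [of_isom a (c.isom_withBundles hb.symm)]
  have : DimQuotient.of (c.withBundles (Ls.map (LineBundle.pullback π.left) ++ Ms)) = 0 :=
    (QuotientAddGroup.eq_zero_iff _).mpr
      (AddSubgroup.subset_closure ⟨c.withBundles (Ls.map (LineBundle.pullback π.left) ++ Ms), S', π,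
        n, Ls, Ms, hπ, hn, hlt, rfl, rfl⟩)
  change ofHom a (QuotientAddGroup.mk (DimQuotient.of _)) = _
  rw [this, QuotientAddGroup.mk_zero, map_zero]

lemma of_sect (a : Lazard) {c cZ : Cycle X} (i : cZ.V ⟶ c.V) {Ls : List (LineBundle c.V.left)}
    {L : LineBundle c.V.left} (s : L.Sec) (hb : c.bundles.Perm (Ls ++ [L]))
    (hs : s.IsZeroScheme i.left) (ht : FibrewiseTransverse c.V.hom i.left)
    (hZ : cZ.IsRestriction c i Ls) : of a c = of a cZ := by
  rw [of_isom a (c.isom_withBundles hb.symm)]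
  have : SectQuotient.of (c.withBundles (Ls ++ [L])) = SectQuotient.of cZ := by
    rw [← sub_eq_zero]
    exact (QuotientAddGroup.eq_zero_iff _).mpr
      (AddSubgroup.subset_closure ⟨c.withBundles (Ls ++ [L]), cZ, i, Ls, L, s, rfl, hs, ht, hZ, rfl⟩)
  rw [← ofHom_of, this, ofHom_of]

lemma of_fgl (c : Cycle X) {d : ℕ} (L M : LineBundle c.V.left)
    (hd : SmoothOfRelativeDimension d c.V.hom) :
    ∑ i ∈ Finset.range (d + 1), ∑ j ∈ Finset.range (d + 1),
      of (lazardCoeff i j) (c.append (List.replicate i L ++ List.replicate j M)) =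
    of 1 (c.append [L.tensor M]) := by
  have := (Submodule.Quotient.mk_eq_zero (fglRelations X)).mpr
    (Submodule.subset_span ⟨c, d, L, M, hd, rfl⟩)
  rw [Submodule.Quotient.mk_sub, sub_eq_zero] at this
  rw [of, ← this, ← Submodule.mkQ_apply, map_sum]
  refine Finset.sum_congr rfl fun i _ => ?_
  rw [map_sum]
  rfl

/-- The conditions under which a function on cobordism cycles induces a homomorphism on `Ω^*`,
for an action `ψ` of the Lazard ring on the target. -/
structure Compatible {B : Type*} [AddCommGroup B] (ψ : Lazard →+* AddMonoid.End B)
    (φ : Cycle X → B) : Prop where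
  isom : ∀ c c', c.Isom c' → φ c = φ c'
  disjointUnion : ∀ (c c₁ c₂ : Cycle X) (i₁ : c₁.V ⟶ c.V) (i₂ : c₂.V ⟶ c.V),
    IsDisjointUnion i₁ i₂ → c₁.IsRestriction c i₁ c.bundles → c₂.IsRestriction c i₂ c.bundles →
    φ c = φ c₁ + φ c₂
  dim : ∀ (c : Cycle X) (S' : Over S) (π : c.V ⟶ S') (n : ℕ) (Ls : List (LineBundle S'.left))
    (Ms : List (LineBundle c.V.left)), SmoothEquidim π.left → SmoothOfRelativeDimension n S'.hom →
    n < Ls.length → c.bundles = Ls.map (LineBundle.pullback π.left) ++ Ms → φ c = 0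
  sect : ∀ (c cZ : Cycle X) (i : cZ.V ⟶ c.V) (Ls : List (LineBundle c.V.left))
    (L : LineBundle c.V.left) (s : L.Sec), c.bundles = Ls ++ [L] → s.IsZeroScheme i.left →
    FibrewiseTransverse c.V.hom i.left → cZ.IsRestriction c i Ls → φ c = φ cZ
  fgl : ∀ (c : Cycle X) (d : ℕ) (L M : LineBundle c.V.left),
    SmoothOfRelativeDimension d c.V.hom →
    ∑ i ∈ Finset.range (d + 1), ∑ j ∈ Finset.range (d + 1),
      ψ (lazardCoeff i j) (φ (c.append (List.replicate i L ++ List.replicate j M))) =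
    φ (c.append [L.tensor M])

section Lift

variable {B : Type*} [AddCommGroup B] {ψ : Lazard →+* AddMonoid.End B} {φ : Cycle X → B}

/-- The homomorphism on the quotient by `⟨ℛ^Dim⟩` and `⟨ℛ^Sect⟩` induced by a function on
cobordism cycles. -/
def liftSect (h : Compatible ψ φ) : SectQuotient X →+ B :=
  QuotientAddGroup.lift (sectRelations X)
    (QuotientAddGroup.lift (dimRelations X)
      (QuotientAddGroup.lift (cycleRelations X) (FreeAbelianGroup.lift φ) (by
        refine (AddSubgroup.closure_le (AddMonoidHom.ker _)).mpr ?_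
        rintro z (⟨c, c', hc, rfl⟩ | ⟨c, c₁, c₂, i₁, i₂, hu, h₁, h₂, rfl⟩)
        · rw [SetLike.mem_coe, AddMonoidHom.mem_ker, map_sub, FreeAbelianGroup.lift_apply_of,
            FreeAbelianGroup.lift_apply_of, h.isom c c' hc, sub_self]
        · rw [SetLike.mem_coe, AddMonoidHom.mem_ker, map_sub, map_add,
            FreeAbelianGroup.lift_apply_of, FreeAbelianGroup.lift_apply_of,
            FreeAbelianGroup.lift_apply_of, h.disjointUnion c c₁ c₂ i₁ i₂ hu h₁ h₂, sub_self]))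
      (by
        refine (AddSubgroup.closure_le (AddMonoidHom.ker _)).mpr ?_
        rintro z ⟨c, S', π, n, Ls, Ms, hπ, hn, hlt, hb, rfl⟩
        exact (FreeAbelianGroup.lift_apply_of _ _).trans (h.dim c S' π n Ls Ms hπ hn hlt hb)))
    (by
      refine (AddSubgroup.closure_le (AddMonoidHom.ker _)).mpr ?_
      rintro z ⟨c, cZ, i, Ls, L, s, hb, hs, ht, hZ, rfl⟩
      rw [SetLike.mem_coe, AddMonoidHom.mem_ker, map_sub, sub_eq_zero]
      exact (FreeAbelianGroup.lift_apply_of _ _).trans ((h.sect c cZ i Ls L s hb hs ht hZ).trans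
        (FreeAbelianGroup.lift_apply_of _ _).symm))

lemma liftSect_of (h : Compatible ψ φ) (c : Cycle X) : liftSect h (SectQuotient.of c) = φ c :=
  FreeAbelianGroup.lift_apply_of _ _

/-- The homomorphism on `Ω^*` induced by a function on cobordism cycles. -/
def lift (h : Compatible ψ φ) : Omega X →+ B :=
  -- The action `ψ` is made a module structure locally, since extending a homomorphism to the tensor
  -- product with the Lazard ring needs a linear target.
  letI : Module Lazard B := Module.compHom B ψ
  (Submodule.liftQ (fglRelations X) ((liftSect h).toIntLinearMap.liftBaseChange Lazard) (by
    refine Submodule.span_le.mpr ?_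
    rintro z ⟨c, d, L, M, hd, rfl⟩
    rw [SetLike.mem_coe, LinearMap.mem_ker, map_sub, sub_eq_zero, map_sum]
    simp only [map_sum, LinearMap.liftBaseChange_tmul, AddMonoidHom.coe_toIntLinearMap,
      liftSect_of, one_smul]
    exact h.fgl c d L M hd)).toAddMonoidHom

lemma lift_of (h : Compatible ψ φ) (a : Lazard) (c : Cycle X) :
    lift h (of a c) = ψ a (φ c) := by
  let _ : Module Lazard B := Module.compHom B ψ
  let g : SectQuotient X →ₗ[ℤ] B := (liftSect h).toIntLinearMap
  refine (LinearMap.liftBaseChange_tmul Lazard g a _).trans ?_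
  exact congrArg (ψ a) (liftSect_of h c)

end Lift

end Omega

end RelCobordism

/-! ### Operations on cycles, up to isomorphism and restriction. -/

namespace RelCobordism

variable {S : Scheme.{u}}

lemma LineBundle.pullback_left_comp {X Y Z : Over S} (g : Z ⟶ Y) (f : Y ⟶ X)
    (L : LineBundle X.left) : L.pullback (g ≫ f).left = (L.pullback f.left).pullback g.left :=
  LineBundle.pullback_comp _ _ _

lemma LineBundle.pullback_pullback_of_eq {W X Y Z : Over S} {g : W ⟶ Y} {f : Y ⟶ X} {g' : W ⟶ Z}
    {f' : Z ⟶ X} (h : g ≫ f = g' ≫ f') (L : LineBundle X.left) :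
    (L.pullback f.left).pullback g.left = (L.pullback f'.left).pullback g'.left := by
  rw [← pullback_left_comp, h, pullback_left_comp]

lemma LineBundle.map_pullback_pullback {X Y Z : Over S} (g : Z ⟶ Y) (f : Y ⟶ X)
    (Ls : List (LineBundle X.left)) :
    (Ls.map (LineBundle.pullback f.left)).map (LineBundle.pullback g.left) =
      Ls.map (LineBundle.pullback (g ≫ f).left) := by
  rw [List.map_map]
  exact List.map_congr_left fun L _ => (pullback_left_comp g f L).symm

lemma LineBundle.map_pullback_id {X : Over S} (Ls : List (LineBundle X.left)) :
    Ls.map (LineBundle.pullback (𝟙 X : X ⟶ X).left) = Ls :=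
  (List.map_congr_left fun L _ => pullback_id L).trans (List.map_id _)

namespace Cycle

variable {X Y : Over S}

lemma isom_mk {V V' : Over S} {h : V ⟶ X} {h' : V' ⟶ X} {p : IsProper h.left}
    {p' : IsProper h'.left} {q : SmoothEquidim V.hom} {q' : SmoothEquidim V'.hom}
    {Ls : List (LineBundle V.left)} {Ls' : List (LineBundle V'.left)} (e : V ≅ V')
    (he : e.hom ≫ h' = h) (hL : (Ls'.map (LineBundle.pullback e.hom.left)).Perm Ls) :
    (⟨V, h, p, q, Ls⟩ : Cycle X).Isom ⟨V', h', p', q', Ls'⟩ :=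
  isom_of_perm (c := ⟨V, h, p, q, Ls⟩) (c' := ⟨V', h', p', q', Ls'⟩) e he hL

lemma isom_mk_self {V : Over S} {h h' : V ⟶ X} {p : IsProper h.left} {p' : IsProper h'.left}
    {q q' : SmoothEquidim V.hom} {Ls Ls' : List (LineBundle V.left)} (he : h' = h)
    (hL : Ls'.Perm Ls) : (⟨V, h, p, q, Ls⟩ : Cycle X).Isom ⟨V, h', p', q', Ls'⟩ :=
  isom_mk (Iso.refl V) ((Category.id_comp _).trans he)
    ((List.Perm.of_eq (LineBundle.map_pullback_id Ls')).trans hL)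

lemma Isom.push {c c' : Cycle X} (h : c.Isom c') (f : X ⟶ Y) (hf : IsProper f.left) :
    (c.push f hf).Isom (c'.push f hf) := by
  obtain ⟨e, he, hL⟩ := h
  exact ⟨e, by change e.hom ≫ c'.map ≫ f = c.map ≫ f; rw [reassoc_of% he], hL⟩

/-- The list `Ls` stays free in these lemmas because a disjoint union relation restricts all
bundles, while a section relation restricts all but the last. -/
lemma IsRestriction.push {c' c : Cycle X} {i : c'.V ⟶ c.V} {Ls : List (LineBundle c.V.left)}
    (h : c'.IsRestriction c i Ls) (f : X ⟶ Y) (hf : IsProper f.left) :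
    (c'.push f hf).IsRestriction (c.push f hf) i Ls :=
  ⟨by change i ≫ c.map ≫ f = c'.map ≫ f; rw [reassoc_of% h.1], h.2⟩

lemma Isom.chern {c c' : Cycle X} (h : c.Isom c') (L : LineBundle X.left) :
    (c.chern L).Isom (c'.chern L) := by
  obtain ⟨e, he, Ls, hp, hr⟩ := h
  have hL : (L.pullback c'.map.left).pullback e.hom.left = L.pullback c.map.left := by
    rw [← LineBundle.pullback_left_comp, he]
  have hr' : List.Forall₂ LineBundle.Isom (Ls ++ [L.pullback c.map.left])
      ((c'.bundles ++ [L.pullback c'.map.left]).map (LineBundle.pullback e.hom.left)) := by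
    rw [List.map_append, List.map_singleton, hL]
    exact List.rel_append hr (List.Forall₂.cons (LineBundle.Isom.refl _) List.Forall₂.nil)
  exact ⟨e, he, Ls ++ [L.pullback c.map.left], hp.append_right _, hr'⟩

lemma IsRestriction.chern {c' c : Cycle X} {i : c'.V ⟶ c.V} {Ls : List (LineBundle c.V.left)}
    (h : c'.IsRestriction c i Ls) (L : LineBundle X.left) :
    (c'.chern L).IsRestriction (c.chern L) i (Ls ++ [L.pullback c.map.left]) := by
  have hb : c'.bundles ++ [L.pullback c'.map.left] =
      (Ls ++ [L.pullback c.map.left]).map (LineBundle.pullback i.left) := by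
    rw [List.map_append, ← h.2, List.map_singleton, ← LineBundle.pullback_left_comp, h.1]
  exact ⟨h.1, hb⟩

lemma append_chern_isom (c : Cycle X) (Ls : List (LineBundle c.V.left)) (L : LineBundle X.left) :
    ((c.append Ls).chern L).Isom ((c.chern L).append Ls) := by
  refine isom_mk_self rfl ?_
  change (c.bundles ++ [_] ++ Ls).Perm (c.bundles ++ Ls ++ [_])
  rw [List.append_assoc, List.append_assoc]
  exact (List.perm_append_comm).append_left _

section Pull

variable (f : X ⟶ Y) (hf : SmoothEquidim f.left)

lemma Isom.pull {c c' : Cycle Y} (h : c.Isom c') {W W' : Over S} {g : W ⟶ c.V} {k : W ⟶ X}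
    (sq : IsPullback g k c.map f) {g' : W' ⟶ c'.V} {k' : W' ⟶ X} (sq' : IsPullback g' k' c'.map f) :
    (c.pull f hf g k sq).Isom (c'.pull f hf g' k' sq') := by
  obtain ⟨e, he, Ls, hp, hr⟩ := h
  have sq₁ : IsPullback (g ≫ e.hom) k c'.map f :=
    sq.of_iso (Iso.refl _) e (Iso.refl _) (Iso.refl _) (by simp) (by simp) (by simp [he]) (by simp)
  let e' := sq₁.isoIsPullback _ _ sq'
  have h₁ : e'.hom ≫ g' = g ≫ e.hom := sq₁.isoIsPullback_hom_fst _ _ sq'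
  have h₂ : e'.hom ≫ k' = k := sq₁.isoIsPullback_hom_snd _ _ sq'
  have hr' : List.Forall₂ LineBundle.Isom (Ls.map (LineBundle.pullback g.left))
      ((c'.bundles.map (LineBundle.pullback g'.left)).map (LineBundle.pullback e'.hom.left)) := by
    rw [LineBundle.map_pullback_pullback, h₁, ← LineBundle.map_pullback_pullback,
      List.forall₂_map_left_iff, List.forall₂_map_right_iff]
    exact hr.imp fun _ _ h => h.pullback _
  exact ⟨e', h₂, Ls.map (LineBundle.pullback g.left), hp.map _, hr'⟩

/-- By cancellation of cartesian squares, the morphism between the two base changes is itself a base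
change of `i`. This square is what makes disjoint unions, zero schemes and transversality pass to
the pullback. -/
lemma IsRestriction.exists_pull {c' c : Cycle Y} {i : c'.V ⟶ c.V} {Ls : List (LineBundle c.V.left)}
    (h : c'.IsRestriction c i Ls) {W W' : Over S} {g : W ⟶ c.V} {k : W ⟶ X}
    (sq : IsPullback g k c.map f) {g' : W' ⟶ c'.V} {k' : W' ⟶ X} (sq' : IsPullback g' k' c'.map f) :
    ∃ j : W' ⟶ W, IsPullback j g' g i ∧ (c'.pull f hf g' k' sq').IsRestriction
      (c.pull f hf g k sq) j (Ls.map (LineBundle.pullback g.left)) := by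
  let j := sq.lift (g' ≫ i) k' (by rw [Category.assoc, h.1, sq'.w])
  have h₁ : j ≫ g = g' ≫ i := sq.lift_fst _ _ _
  have h₂ : j ≫ k = k' := sq.lift_snd _ _ _
  have hb : c'.bundles.map (LineBundle.pullback g'.left) =
      (Ls.map (LineBundle.pullback g.left)).map (LineBundle.pullback j.left) := by
    rw [h.2, LineBundle.map_pullback_pullback, LineBundle.map_pullback_pullback, h₁]
  refine ⟨j, IsPullback.of_right ?_ h₁ sq.flip, h₂, hb⟩
  rw [h₂, h.1]
  exact sq'.flip

end Pull

end Cycle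

end RelCobordism

/-! ### Pushforward, Chern operators and pullback on `Ω^*`. -/

namespace RelCobordism

variable {S : Scheme.{u}}

lemma LineBundle.pullback_left_tensor {X Y : Over S} (f : Y ⟶ X) (L M : LineBundle X.left) :
    (L.tensor M).pullback f.left = (L.pullback f.left).tensor (M.pullback f.left) :=
  LineBundle.pullback_tensor _ _ _

lemma SmoothOfRelativeDimension.hom_of_isPullback {W V X Y : Over S} {g : W ⟶ V} {k : W ⟶ X}
    {h : V ⟶ Y} {f : X ⟶ Y} (sq : IsPullback g k h f) {d e : ℕ}
    (hf : SmoothOfRelativeDimension e f.left) (hV : SmoothOfRelativeDimension d V.hom) :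
    SmoothOfRelativeDimension (e + d) W.hom := by
  have := SmoothOfRelativeDimension.of_isPullback (sq.map (Over.forget S)) hf
  have : SmoothOfRelativeDimension e g.left := this
  rw [← Over.w g]
  infer_instance

/-- Base change along `f` raises the relative dimensions of `V` and of `Z` by the same amount, so
their difference remains one; an empty `Z` stays empty. -/
lemma FibrewiseTransverse.of_isPullback {V Z W W' X Y : Over S} {i : Z ⟶ V} {j : W' ⟶ W}
    {g : W ⟶ V} {g' : W' ⟶ Z} {k : W ⟶ X} {h : V ⟶ Y} {f : X ⟶ Y} (sq : IsPullback g k h f)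
    (sq' : IsPullback j g' g i) (hf : SmoothEquidim f.left)
    (ht : FibrewiseTransverse V.hom i.left) : FibrewiseTransverse W.hom j.left := by
  obtain ⟨e, he⟩ := hf
  obtain ⟨d, hd, hZ⟩ := ht
  refine ⟨e + d, SmoothOfRelativeDimension.hom_of_isPullback sq he hd, ?_⟩
  rcases hZ with hZ | ⟨d', rfl, hd'⟩
  · left
    exact Function.isEmpty g'.left
  · right
    refine ⟨e + d', by ring, ?_⟩
    rw [Over.w] at hd' ⊢
    have hg := SmoothOfRelativeDimension.of_isPullback (sq.map (Over.forget S)) he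
    exact SmoothOfRelativeDimension.hom_of_isPullback sq'.flip hg hd'

lemma sum_range_sum_range_of_le {B : Type*} [AddCommMonoid B] (F : ℕ → ℕ → B) {d N : ℕ}
    (h : d ≤ N) (h₁ : ∀ i j, d < i → F i j = 0) (h₂ : ∀ i j, d < j → F i j = 0) :
    ∑ i ∈ Finset.range (d + 1), ∑ j ∈ Finset.range (d + 1), F i j =
      ∑ i ∈ Finset.range (N + 1), ∑ j ∈ Finset.range (N + 1), F i j := by
  have hsub : Finset.range (d + 1) ⊆ Finset.range (N + 1) :=
    Finset.range_subset_range.mpr (by omega)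
  rw [← Finset.sum_subset hsub fun i _ hi => Finset.sum_eq_zero fun j _ =>
    h₁ i j (by simpa [Nat.lt_succ_iff] using hi)]
  refine Finset.sum_congr rfl fun i _ => Finset.sum_subset hsub fun j _ hj =>
    h₂ i j (by simpa [Nat.lt_succ_iff] using hj)

namespace Omega

/-- The action of the Lazard ring on `Ω^*(X ⟶ S)`. -/
def action (X : Over S) : Lazard →+* AddMonoid.End (Omega X) :=
  Module.toAddMonoidEnd Lazard (Omega X)

variable {X Y : Over S}

lemma action_of (a b : Lazard) (c : Cycle X) : action X a (of b c) = of (a * b) c :=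
  smul_of a b c

lemma action_of_one (a : Lazard) (c : Cycle X) : action X a (of 1 c) = of a c := by
  rw [action_of, mul_one]

/-- Whichever block of bundles is too long is moved to the front, where it forms a dimension
relation over `S'`. -/
lemma of_append_eq_zero (a : Lazard) (c : Cycle X) {S' : Over S} (π : c.V ⟶ S')
    (hπ : SmoothEquidim π.left) {d : ℕ} (hd : SmoothOfRelativeDimension d S'.hom)
    (L M : LineBundle S'.left) {i j : ℕ} (h : d < i ∨ d < j) :
    of a (c.append (List.replicate i (L.pullback π.left) ++
      List.replicate j (M.pullback π.left))) = 0 := by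
  rcases h with h | h
  · have hp : (c.bundles ++ (List.replicate i (L.pullback π.left) ++
        List.replicate j (M.pullback π.left))).Perm
        ((List.replicate i L).map (LineBundle.pullback π.left) ++
          (c.bundles ++ List.replicate j (M.pullback π.left))) := by
      rw [List.map_replicate, ← List.append_assoc, ← List.append_assoc]
      exact List.perm_append_comm.append_right _
    exact of_eq_zero_of_dim a (c := c.append _) π hπ hd (by simpa using h) hp
  · have hp : (c.bundles ++ (List.replicate i (L.pullback π.left) ++
        List.replicate j (M.pullback π.left))).Perm
        ((List.replicate j M).map (LineBundle.pullback π.left) ++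
          (c.bundles ++ List.replicate i (L.pullback π.left))) := by
      rw [List.map_replicate, ← List.append_assoc]
      exact List.perm_append_comm
    exact of_eq_zero_of_dim a (c := c.append _) π hπ hd (by simpa using h) hp

/-- The relation in `Ω^*` is truncated at the relative dimension `n` of the source of `c`, but
pulling back a relation on `S'` produces the truncation at `d`. The terms in between vanish because
`L` and `M` come from `S'`. -/
lemma of_fgl_pullback (c : Cycle X) {S' : Over S} (π : c.V ⟶ S') (hπ : SmoothEquidim π.left)
    {d n : ℕ} (hd : SmoothOfRelativeDimension d S'.hom)
    (hn : SmoothOfRelativeDimension n c.V.hom) (hdn : d ≤ n) (L M : LineBundle S'.left) :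
    ∑ i ∈ Finset.range (d + 1), ∑ j ∈ Finset.range (d + 1),
      of (lazardCoeff i j) (c.append (List.replicate i (L.pullback π.left) ++
        List.replicate j (M.pullback π.left))) =
    of 1 (c.append [(L.tensor M).pullback π.left]) := by
  rw [sum_range_sum_range_of_le _ hdn
    (fun i j hi => of_append_eq_zero _ c π hπ hd L M (Or.inl hi))
    (fun i j hj => of_append_eq_zero _ c π hπ hd L M (Or.inr hj)),
    LineBundle.pullback_left_tensor]
  exact of_fgl c _ _ hn

lemma compatible_push (f : X ⟶ Y) (hf : IsProper f.left) :
    Compatible (action Y) (fun c : Cycle X => of 1 (c.push f hf)) where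
  isom c c' h := of_isom 1 (h.push f hf)
  disjointUnion c c₁ c₂ i₁ i₂ h h₁ h₂ := of_disjointUnion 1 (c := c.push f hf)
    (c₁ := c₁.push f hf) (c₂ := c₂.push f hf) h (h₁.push f hf) (h₂.push f hf)
  dim c S' π n Ls Ms hπ hn hlt hb := of_eq_zero_of_dim 1 (c := c.push f hf) π (Ms := Ms) hπ hn hlt
    (List.Perm.of_eq hb)
  sect c cZ i Ls L s hb hs ht hZ := of_sect 1 (c := c.push f hf) (cZ := cZ.push f hf) i s
    (List.Perm.of_eq hb) hs ht (hZ.push f hf)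
  fgl c d L M hd := by
    simp only [action_of_one]
    exact of_fgl (c.push f hf) L M hd

/-- The pushforward `f_* [h : V ⟶ X; L₁, …] = [f ∘ h : V ⟶ Y; L₁, …]`. -/
def push (f : X ⟶ Y) (hf : IsProper f.left) : Omega X →+ Omega Y := lift (compatible_push f hf)

lemma push_of (f : X ⟶ Y) (hf : IsProper f.left) (a : Lazard) (c : Cycle X) :
    push f hf (of a c) = of a (c.push f hf) :=
  (lift_of _ _ _).trans (action_of_one _ _)

lemma compatible_chern (L : LineBundle X.left) :
    Compatible (action X) (fun c : Cycle X => of 1 (c.chern L)) where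
  isom c c' h := of_isom 1 (h.chern L)
  disjointUnion c c₁ c₂ i₁ i₂ h h₁ h₂ := of_disjointUnion 1 (c := c.chern L)
    (c₁ := c₁.chern L) (c₂ := c₂.chern L) h (h₁.chern L) (h₂.chern L)
  dim c S' π n Ls Ms hπ hn hlt hb := by
    have hb' : c.bundles ++ [L.pullback c.map.left] =
        Ls.map (LineBundle.pullback π.left) ++ (Ms ++ [L.pullback c.map.left]) := by
      rw [hb, List.append_assoc]
    exact of_eq_zero_of_dim 1 (c := c.chern L) π (Ms := Ms ++ [L.pullback c.map.left]) hπ hn hlt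
      (List.Perm.of_eq hb')
  sect c cZ i Ls M s hb hs ht hZ := by
    -- The new bundle is moved in front of `M`, since a section relation removes the last bundle.
    have hb' : (c.bundles ++ [L.pullback c.map.left]).Perm
        (Ls ++ [L.pullback c.map.left] ++ [M]) := by
      rw [hb, List.append_assoc, List.append_assoc]
      exact List.perm_append_comm.append_left _
    exact of_sect 1 (c := c.chern L) (cZ := cZ.chern L) i s (L := M) hb' hs ht (hZ.chern L)
  fgl c d M N hd := by
    simp only [action_of_one]
    exact (Finset.sum_congr rfl fun i _ => Finset.sum_congr rfl fun j _ =>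
      of_isom _ (c.append_chern_isom _ L)).trans ((of_fgl (c.chern L) M N hd).trans
        (of_isom 1 (c.append_chern_isom [M.tensor N] L)).symm)

/-- The Chern operator `c̃₁(L) [h : V ⟶ X; L₁, …] = [h : V ⟶ X; L₁, …, h^* L]`. -/
def chern (L : LineBundle X.left) : Omega X →+ Omega X := lift (compatible_chern L)

lemma chern_of (L : LineBundle X.left) (a : Lazard) (c : Cycle X) :
    chern L (of a c) = of a (c.chern L) :=
  (lift_of _ _ _).trans (action_of_one _ _)

/-- The pullback of a cycle along the chosen fibre product. -/
def _root_.RelCobordism.Cycle.pullback (f : X ⟶ Y) (hf : SmoothEquidim f.left) (c : Cycle Y) :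
    Cycle X :=
  c.pull f hf _ _ (IsPullback.of_hasPullback c.map f)

/-- Fibre products are unique up to isomorphism, so any cartesian square computes the pullback. The
axioms are verified with pasted squares and products of squares in place of the chosen one. -/
lemma of_pull (f : X ⟶ Y) (hf : SmoothEquidim f.left) (a : Lazard) (c : Cycle Y) {W : Over S}
    {g : W ⟶ c.V} {k : W ⟶ X} (sq : IsPullback g k c.map f) :
    of a (c.pullback f hf) = of a (c.pull f hf g k sq) :=
  of_isom a (Cycle.Isom.pull f hf ⟨Iso.refl _, Category.id_comp _, _, List.Perm.refl _, by
    rw [Iso.refl_hom, LineBundle.map_pullback_id]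
    exact List.forall₂_same.mpr fun _ _ => LineBundle.Isom.refl _⟩ _ sq)

lemma compatible_pull (f : X ⟶ Y) (hf : SmoothEquidim f.left) :
    Compatible (action X) (fun c : Cycle Y => of 1 (c.pullback f hf)) where
  isom c c' h := of_isom 1 (h.pull f hf _ _)
  disjointUnion c c₁ c₂ i₁ i₂ h h₁ h₂ := by
    obtain ⟨j₁, sq₁, hr₁⟩ := h₁.exists_pull f hf (IsPullback.of_hasPullback _ _)
      (IsPullback.of_hasPullback _ _)
    obtain ⟨j₂, sq₂, hr₂⟩ := h₂.exists_pull f hf (IsPullback.of_hasPullback _ _)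
      (IsPullback.of_hasPullback _ _)
    exact of_disjointUnion 1 (h.of_isPullback sq₁ sq₂) hr₁ hr₂
  dim c S' π n Ls Ms hπ hn hlt hb := by
    have sq := IsPullback.of_hasPullback c.map f
    refine of_eq_zero_of_dim 1 (c := c.pullback f hf) (pullback.fst c.map f ≫ π)
      (Ms := Ms.map (LineBundle.pullback (pullback.fst c.map f).left))
      ((SmoothEquidim.of_isPullback (sq.map (Over.forget S)) hf).comp hπ) hn hlt
      (List.Perm.of_eq ?_)
    change c.bundles.map _ = _
    rw [hb, List.map_append, LineBundle.map_pullback_pullback]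
    rfl
  sect c cZ i Ls L s hb hs ht hZ := by
    have sq := IsPullback.of_hasPullback c.map f
    obtain ⟨j, sq', hr⟩ := hZ.exists_pull f hf (IsPullback.of_hasPullback _ _)
      (IsPullback.of_hasPullback _ _)
    refine of_sect 1 (c := c.pullback f hf) j (s.pullback (pullback.fst c.map f).left)
      (List.Perm.of_eq ?_) (hs.pullback (sq'.flip.map (Over.forget S)))
      (ht.of_isPullback sq sq' hf) hr
    change c.bundles.map _ = _
    rw [hb, List.map_append]
    rfl
  fgl c d L M hd := by
    have sq := IsPullback.of_hasPullback c.map f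
    obtain ⟨e, he⟩ := hf
    have hW := SmoothOfRelativeDimension.hom_of_isPullback sq he hd
    have happ (Ls : List (LineBundle c.V.left)) : (c.append Ls).pullback f ⟨e, he⟩ =
        (c.pullback f ⟨e, he⟩).append
          (Ls.map (LineBundle.pullback (pullback.fst c.map f).left)) := by
      have : (c.bundles ++ Ls).map (LineBundle.pullback (pullback.fst c.map f).left) =
        c.bundles.map (LineBundle.pullback (pullback.fst c.map f).left) ++
          Ls.map (LineBundle.pullback (pullback.fst c.map f).left) := List.map_append
      exact congrArg (fun l => Cycle.mk (pullback c.map f) (pullback.snd c.map f) _ _ l) this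
    have key := of_fgl_pullback (c.pullback f ⟨e, he⟩) (pullback.fst c.map f)
      (SmoothEquidim.of_isPullback (sq.map (Over.forget S)) ⟨e, he⟩) hd hW (Nat.le_add_left d e) L M
    simp only [action_of_one]
    refine (Finset.sum_congr rfl fun i _ => Finset.sum_congr rfl fun j _ => ?_).trans
      (key.trans (congrArg (of 1) (happ [L.tensor M]).symm))
    rw [happ, List.map_append, List.map_replicate, List.map_replicate]

/-- The pullback `f^* [k : W ⟶ Y; L₁, …] = [k' : W ×_Y X ⟶ X; f'^* L₁, …]`. -/
def pull (f : X ⟶ Y) (hf : SmoothEquidim f.left) : Omega Y →+ Omega X :=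
  lift (compatible_pull f hf)

lemma pull_of (f : X ⟶ Y) (hf : SmoothEquidim f.left) (a : Lazard) (c : Cycle Y) {W : Over S}
    {g : W ⟶ c.V} {k : W ⟶ X} (sq : IsPullback g k c.map f) :
    pull f hf (of a c) = of a (c.pull f hf g k sq) :=
  (lift_of _ _ _).trans ((action_of_one _ _).trans (of_pull f hf a c sq))

end Omega

end RelCobordism

/-! ### The external product. -/

namespace RelCobordism

section Cartesian

variable {C : Type*} [Category* C] [CartesianMonoidalCategory C]

lemma isPullback_tensorHom {P V X Y P' V' X' Y' : C} {g : P ⟶ V} {k : P ⟶ X} {h : V ⟶ Y} {f : X ⟶ Y}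
    {g' : P' ⟶ V'} {k' : P' ⟶ X'} {h' : V' ⟶ Y'} {f' : X' ⟶ Y'} (sq : IsPullback g k h f)
    (sq' : IsPullback g' k' h' f') :
    IsPullback (g ⊗ₘ g') (k ⊗ₘ k') (h ⊗ₘ h') (f ⊗ₘ f') := by
  have w : (g ⊗ₘ g') ≫ (h ⊗ₘ h') = (k ⊗ₘ k') ≫ (f ⊗ₘ f') := by
    rw [tensorHom_comp_tensorHom, tensorHom_comp_tensorHom, sq.w, sq'.w]
  refine ⟨⟨w⟩, ⟨PullbackCone.IsLimit.mk w
    (fun s => lift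
      (sq.lift (s.fst ≫ fst _ _) (s.snd ≫ fst _ _) (by
        simpa using s.condition =≫ fst _ _))
      (sq'.lift (s.fst ≫ snd _ _) (s.snd ≫ snd _ _) (by
        simpa using s.condition =≫ snd _ _)))
    (fun s => by ext <;> simp) (fun s => by ext <;> simp) (fun s m hm hm' => ?_)⟩⟩
  ext
  · refine sq.hom_ext ?_ ?_
    · simp [← hm]
    · simp [← hm']
  · refine sq'.hom_ext ?_ ?_
    · simp [← hm]
    · simp [← hm']

/-- With this square, pulling a cycle on `X` back along the projection from `X ⊗ W` gives a cycle
whose source is exactly `V ⊗ W`. -/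
lemma isPullback_fst {V X : C} (h : V ⟶ X) (W : C) :
    IsPullback (fst V W) (h ⊗ₘ 𝟙 W) h (fst X W) := by
  have w : fst V W ≫ h = (h ⊗ₘ 𝟙 W) ≫ fst X W := by simp
  refine ⟨⟨w⟩, ⟨PullbackCone.IsLimit.mk w (fun s => lift s.fst (s.snd ≫ snd _ _))
    (fun s => by simp) (fun s => ?_) (fun s m hm hm' => ?_)⟩⟩
  · ext
    · simpa using s.condition
    · simp
  · ext
    · simpa using hm
    · simp [← hm']

end Cartesian

variable {S : Scheme.{u}}

lemma smoothEquidim_fst (X : Over S) {W : Over S} (hW : SmoothEquidim W.hom) :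
    SmoothEquidim (fst X W).left :=
  SmoothEquidim.of_isPullback (IsPullback.of_hasPullback X.hom W.hom) hW

lemma isProper_id (X : Over S) : IsProper (𝟙 X : X ⟶ X).left := isProper_of_iso (Iso.refl X)

namespace Omega

variable {X Y : Over S}

/-- The composite of the Chern operators of the line bundles in a list. -/
def cherns : List (LineBundle X.left) → (Omega X →+ Omega X)
  | [] => AddMonoidHom.id _
  | L :: Ls => (chern L).comp (cherns Ls)

lemma cherns_of (Ls : List (LineBundle X.left)) (a : Lazard) (c : Cycle X) :
    cherns Ls (of a c) = of a (c.append (Ls.map (LineBundle.pullback c.map.left))) := by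
  induction Ls with
  | nil =>
    exact of_isom a (Cycle.isom_mk_self (Ls' := c.bundles ++ []) rfl
      (List.Perm.of_eq (List.append_nil _)))
  | cons L Ls ih =>
    rw [cherns, AddMonoidHom.comp_apply, ih, chern_of]
    refine of_isom a (Cycle.isom_mk_self rfl ?_)
    rw [List.map_cons]
    change (c.bundles ++ (_ :: _)).Perm (c.bundles ++ Ls.map _ ++ [_])
    rw [List.append_assoc]
    exact (List.perm_append_singleton _ _).symm.append_left _

/-- The external product with a fixed cobordism cycle on the right. -/
def prodRight (X : Over S) (c' : Cycle Y) : Omega X →+ Omega (X ⊗ Y) :=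
  -- Composing operations that already exist on `Ω^*` makes the product with `c'` well defined in
  -- the left variable without a new check of relations.
  (push (𝟙 X ⊗ₘ c'.map) (isProper_tensor (isProper_id X) c'.proper)).comp
    ((cherns (c'.bundles.map (LineBundle.pullback (snd X c'.V).left))).comp
      (pull (fst X c'.V) (smoothEquidim_fst X c'.smooth)))

lemma prodRight_of (c' : Cycle Y) (a : Lazard) (c : Cycle X) :
    prodRight X c' (of a c) = of a (c.prod c') := by
  rw [prodRight, AddMonoidHom.comp_apply, AddMonoidHom.comp_apply,
    pull_of _ _ _ _ (isPullback_fst c.map c'.V), cherns_of, push_of]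
  refine of_isom a (Cycle.isom_mk_self ?_ ?_)
  · change c.map ⊗ₘ c'.map = (c.map ⊗ₘ 𝟙 _) ≫ (𝟙 X ⊗ₘ c'.map)
    rw [tensorHom_comp_tensorHom, Category.comp_id, Category.id_comp]
  · refine List.Perm.of_eq (congrArg (c.bundles.map (LineBundle.pullback (fst c.V c'.V).left) ++ ·) ?_)
    refine Eq.symm ((LineBundle.map_pullback_pullback _ _ _).trans ?_)
    change c'.bundles.map (LineBundle.pullback ((c.map ⊗ₘ 𝟙 c'.V) ≫ snd X c'.V).left) = _
    rw [tensorHom_snd, Category.comp_id]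

lemma prod_braiding_isom (c : Cycle X) (c' : Cycle Y) :
    (c.prod c').Isom ((c'.prod c).push (β_ Y X).hom (isProper_of_iso _)) := by
  refine Cycle.isom_mk (β_ c.V c'.V) ?_ ?_
  · change (β_ c.V c'.V).hom ≫ (c'.map ⊗ₘ c.map) ≫ (β_ Y X).hom = c.map ⊗ₘ c'.map
    ext <;> simp
  · have h₁ : (c'.bundles.map (LineBundle.pullback (fst c'.V c.V).left)).map
        (LineBundle.pullback (β_ c.V c'.V).hom.left) =
        c'.bundles.map (LineBundle.pullback (snd c.V c'.V).left) := by
      rw [LineBundle.map_pullback_pullback, braiding_hom_fst]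
    have h₂ : (c.bundles.map (LineBundle.pullback (snd c'.V c.V).left)).map
        (LineBundle.pullback (β_ c.V c'.V).hom.left) =
        c.bundles.map (LineBundle.pullback (fst c.V c'.V).left) := by
      rw [LineBundle.map_pullback_pullback, braiding_hom_snd]
    refine (List.Perm.of_eq (List.map_append.trans (congrArg₂ (· ++ ·) h₁ h₂))).trans ?_
    exact List.perm_append_comm

/-- The external product with a fixed element `a [V ⟶ X; L₁, …]` on the left. -/
def prodLeft (Y : Over S) (a : Lazard) (c : Cycle X) : Omega Y →+ Omega (X ⊗ Y) :=
  (push (β_ Y X).hom (isProper_of_iso _)).comp ((prodRight Y c).comp (action Y a))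

/-- On the right `c'` is only a parameter; on the left its class is the argument of a homomorphism.
Relations between the classes of the `c'` therefore carry over to the homomorphisms `prodRight X
c'`. -/
lemma prodLeft_of_one (a : Lazard) (c : Cycle X) (c' : Cycle Y) :
    prodLeft Y a c (of 1 c') = prodRight X c' (of a c) := by
  rw [prodRight_of, prodLeft]
  change push _ _ (prodRight Y c (action Y a (of 1 c'))) = _
  rw [action_of_one, prodRight_of, push_of]
  exact (of_isom a (prod_braiding_isom c c')).symm

/-- The action of the Lazard ring on homomorphisms to `Ω^*(Y ⟶ S)`. -/
def homAction (X Y : Over S) : Lazard →+* AddMonoid.End (Omega X →+ Omega Y) :=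
  Module.toAddMonoidEnd Lazard (Omega X →+ Omega Y)

lemma homAction_apply (a : Lazard) (f : Omega X →+ Omega Y) (x : Omega X) :
    homAction X Y a f x = action Y a (f x) := rfl

lemma prodLeft_of (a b : Lazard) (c : Cycle X) (c' : Cycle Y) :
    prodLeft Y a c (of b c') = action _ b (prodRight X c' (of a c)) := by
  rw [prodRight_of, prodLeft]
  change push _ _ (prodRight Y c (action Y a (of b c'))) = _
  rw [action_of, prodRight_of, push_of, action_of, mul_comm a b]
  exact (of_isom _ (prod_braiding_isom c c')).symm

lemma compatible_prodRight (X Y : Over S) :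
    Compatible (homAction X (X ⊗ Y)) (fun c' : Cycle Y => prodRight X c') where
  isom c c' h := hom_ext fun a d => by
    rw [← prodLeft_of_one, ← prodLeft_of_one, of_isom 1 h]
  disjointUnion c c₁ c₂ i₁ i₂ h h₁ h₂ := hom_ext fun a d => by
    rw [AddMonoidHom.add_apply, ← prodLeft_of_one, ← prodLeft_of_one, ← prodLeft_of_one,
      of_disjointUnion 1 h h₁ h₂, map_add]
  dim c S' π n Ls Ms hπ hn hlt hb := hom_ext fun a d => by
    rw [← prodLeft_of_one, of_eq_zero_of_dim 1 π hπ hn hlt (List.Perm.of_eq hb), map_zero]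
    rfl
  sect c cZ i Ls L s hb hs ht hZ := hom_ext fun a d => by
    rw [← prodLeft_of_one, ← prodLeft_of_one, of_sect 1 i s (List.Perm.of_eq hb) hs ht hZ]
  fgl c d L M hd := hom_ext fun a d => by
    rw [← prodLeft_of_one, ← of_fgl c L M hd, map_sum, AddMonoidHom.finsetSum_apply]
    refine Finset.sum_congr rfl fun i _ => ?_
    rw [map_sum, AddMonoidHom.finsetSum_apply]
    refine Finset.sum_congr rfl fun j _ => ?_
    rw [homAction_apply, prodLeft_of]

/-- The external product. -/
def prod : Omega X →+ Omega Y →+ Omega (X ⊗ Y) :=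
  AddMonoidHom.flip (lift (compatible_prodRight X Y))

lemma prod_of (a b : Lazard) (c : Cycle X) (c' : Cycle Y) :
    prod (of a c) (of b c') = of (a * b) (c.prod c') := by
  rw [prod, AddMonoidHom.flip_apply, lift_of, homAction_apply, prodRight_of, action_of, mul_comm]

end Omega

end RelCobordism

/-! ### The grading of `Ω^*`. -/

namespace RelCobordism

section Grading

open LaurentPolynomial

/-- A sum of homogeneous elements determines its summands, since `p l` picks out the one in degree
`l`. -/
lemma isInternal_of_projections {M : Type*} [AddCommGroup M] (G : ℤ → AddSubgroup M)
    (p : ℤ → M →+ M) (h : ∀ k l, ∀ x ∈ G k, p l x = if k = l then x else 0) (htop : ⨆ k, G k = ⊤) :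
    DirectSum.IsInternal G := by
  have hp (l : ℤ) : (p l).comp (DirectSum.coeAddMonoidHom G) =
      (G l).subtype.comp (DFinsupp.evalAddMonoidHom l) := by
    refine DirectSum.addHom_ext fun k y => ?_
    rw [AddMonoidHom.comp_apply, DirectSum.coeAddMonoidHom_of, h k l y y.2]
    change _ = ((DirectSum.of (fun k => G k) k y l : G l) : M)
    split_ifs with hkl
    · subst hkl
      rw [DirectSum.of_eq_same]
    · rw [DirectSum.of_eq_of_ne _ _ _ (Ne.symm hkl)]
      rfl
  constructor
  · rw [injective_iff_map_eq_zero]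
    intro x hx
    refine DFinsupp.ext fun l => Subtype.ext ?_
    have := DFunLike.congr_fun (hp l) x
    rw [AddMonoidHom.comp_apply, hx, map_zero] at this
    exact this.symm
  · rw [← AddMonoidHom.range_eq_top, ← top_le_iff, ← htop]
    exact iSup_le fun k x hx => ⟨DirectSum.of (fun k => G k) k ⟨x, hx⟩,
      DirectSum.coeAddMonoidHom_of _ _ _⟩

section Laurent

variable {R : Type*} [CommRing R] (M : Type*) [AddCommGroup M] [Module R M]

variable (R) in
/-- Laurent polynomials with coefficients in the `R`-module `M`. -/
def LaurentModule : Type _ := R[T;T⁻¹] ⊗[R] M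

instance : AddCommGroup (LaurentModule R M) := inferInstanceAs (AddCommGroup (R[T;T⁻¹] ⊗[R] M))

namespace LaurentModule

/-- The coefficient of `T ^ l`. -/
def coeff (l : ℤ) : LaurentModule R M →+ M :=
  (TensorProduct.lift ((LinearMap.lsmul R M).comp ((Finsupp.lapply l).comp
    (AddMonoidAlgebra.coeffLinearEquiv R).toLinearMap)) : R[T;T⁻¹] ⊗[R] M →ₗ[R] M).toAddMonoidHom

variable {M}

variable (R) in
/-- The monomial `m * T ^ k`. -/
def monomial (k : ℤ) : M →+ LaurentModule R M :=
  (TensorProduct.mk R R[T;T⁻¹] M (T k)).toAddMonoidHom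

lemma coeff_monomial (k l : ℤ) (m : M) : coeff M l (monomial R k m) = if k = l then m else 0 := by
  change (T k : R[T;T⁻¹]).coeff l • m = _
  rw [T_apply]
  split_ifs <;> simp

variable (M) in
/-- The action of `R` through a homomorphism to Laurent polynomials. -/
def action (g : R →+* R[T;T⁻¹]) : R →+* AddMonoid.End (LaurentModule R M) :=
  (Module.toAddMonoidEnd R[T;T⁻¹] (R[T;T⁻¹] ⊗[R] M)).comp g

lemma action_monomial (g : R →+* R[T;T⁻¹]) {a : R} {l : ℤ} (h : g a = C a * T l) (k : ℤ) (m : M) :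
    action M g a (monomial R k m) = monomial R (k + l) (a • m) := by
  change g a • ((T k : R[T;T⁻¹]) ⊗ₜ[R] m) = (T (k + l) : R[T;T⁻¹]) ⊗ₜ[R] (a • m)
  rw [h, TensorProduct.smul_tmul', smul_eq_mul, TensorProduct.tmul_smul, TensorProduct.smul_tmul',
    mul_assoc, ← T_add, add_comm, ← smul_eq_C_mul]

end LaurentModule

end Laurent

/-- The homomorphism that records the degrees in the Lazard ring. -/
def lazardGradingHom : Lazard →+* Lazard[T;T⁻¹] := gradingHom (RingHom.id Lazard)

lemma lazardGradingHom_of_mem {a : Lazard} {n : ℕ} (ha : a ∈ lazardGrade n) :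
    lazardGradingHom a = C a * T (-(n : ℤ)) := by
  rw [lazardGradingHom, gradingHom_of_mem _ ha, RingHom.id_apply]

lemma lazardGradingHom_lazardCoeff (i j : ℕ) :
    lazardGradingHom (lazardCoeff i j) = C (lazardCoeff i j) * T (1 - ((i + j : ℕ) : ℤ)) := by
  rw [lazardGradingHom, gradingHom_lazardCoeff, RingHom.id_apply]

end Grading

variable {S : Scheme.{u}} {X : Over S}

namespace Omega

/-- The empty scheme is the disjoint union of two copies of itself, so the class equals its own
double. -/
lemma of_eq_zero_of_isEmpty (a : Lazard) (c : Cycle X) (h : IsEmpty c.V.left) : of a c = 0 := by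
  have hr : c.IsRestriction c (𝟙 c.V) c.bundles :=
    ⟨Category.id_comp _, (LineBundle.map_pullback_id _).symm⟩
  have := of_disjointUnion a (IsDisjointUnion.id_of_isEmpty h (𝟙 c.V)) hr hr
  exact left_eq_add.mp this

/-- The cycle `c` in the degree given by the number of its line bundles and the relative dimension
of its source. -/
def gradedOf (c : Cycle X) : LaurentModule Lazard (Omega X) :=
  LaurentModule.monomial Lazard ((c.bundles.length : ℤ) - (c.smooth.choose : ℤ)) (of 1 c)

/-- The chosen dimension is the only possible one if the source is nonempty. An empty source has
every relative dimension, but its class is zero. -/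
lemma gradedOf_eq (c : Cycle X) {d : ℕ} (hd : SmoothOfRelativeDimension d c.V.hom) {l : ℤ}
    (hl : (c.bundles.length : ℤ) - d = l) : gradedOf c = LaurentModule.monomial Lazard l (of 1 c) := by
  by_cases h : IsEmpty c.V.left
  · rw [gradedOf, of_eq_zero_of_isEmpty 1 c h, map_zero, map_zero]
  · rw [not_isEmpty_iff] at h
    rw [gradedOf, relativeDimension_unique c.V.hom c.smooth.choose_spec hd, hl]

lemma gradedOf_eq_zero (c : Cycle X) (h : of 1 c = 0) : gradedOf c = 0 := by
  rw [gradedOf, h, map_zero]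

end Omega

lemma SmoothOfRelativeDimension.hom_of_left {V V' : Over S} (i : V' ⟶ V) [IsOpenImmersion i.left]
    {d : ℕ} (hd : SmoothOfRelativeDimension d V.hom) : SmoothOfRelativeDimension d V'.hom := by
  rw [← Over.w i]
  have : SmoothOfRelativeDimension (0 + d) (i.left ≫ V.hom) := inferInstance
  rwa [zero_add] at this

lemma Cycle.Isom.length_eq {c c' : Cycle X} (h : c.Isom c') :
    c.bundles.length = c'.bundles.length := by
  obtain ⟨e, -, Ls, hp, hr⟩ := h
  rw [← hp.length_eq, hr.length_eq, List.length_map]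

lemma Cycle.IsRestriction.length_eq {c c' : Cycle X} {i : c'.V ⟶ c.V}
    {Ls : List (LineBundle c.V.left)} (h : c'.IsRestriction c i Ls) :
    c'.bundles.length = Ls.length := by
  rw [h.2, List.length_map]

namespace Omega

/-- All relations are homogeneous. In a section relation one bundle and one dimension are lost
together. In the formal group law relation the coefficient `a_{ij}` shifts by `1 - (i + j)`, which
turns the `i + j` new bundles into a net shift of `1`, the shift caused by `L ⊗ M`. -/
lemma compatible_gradedOf (X : Over S) :
    Compatible (LaurentModule.action (Omega X) lazardGradingHom)
      (fun c : Cycle X => gradedOf c) where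
  isom c c' h := by
    obtain ⟨d, hd⟩ := c.smooth
    have hd' : SmoothOfRelativeDimension d c'.V.hom := by
      obtain ⟨e, -⟩ := h
      have : IsIso e.inv.left := inferInstanceAs (IsIso ((Over.forget S).map e.inv))
      exact SmoothOfRelativeDimension.hom_of_left e.inv hd
    rw [gradedOf_eq c hd rfl, gradedOf_eq c' hd' (by rw [← h.length_eq]), of_isom 1 h]
  disjointUnion c c₁ c₂ i₁ i₂ h h₁ h₂ := by
    obtain ⟨d, hd⟩ := c.smooth
    have := h.isOpenImmersion_left
    have := h.isOpenImmersion_right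
    rw [gradedOf_eq c hd rfl,
      gradedOf_eq c₁ (SmoothOfRelativeDimension.hom_of_left i₁ hd) (by rw [h₁.length_eq]),
      gradedOf_eq c₂ (SmoothOfRelativeDimension.hom_of_left i₂ hd) (by rw [h₂.length_eq]),
      of_disjointUnion 1 h h₁ h₂, map_add]
  dim c S' π n Ls Ms hπ hn hlt hb :=
    gradedOf_eq_zero c (of_eq_zero_of_dim 1 π hπ hn hlt (List.Perm.of_eq hb))
  sect c cZ i Ls L s hb hs ht hZ := by
    have heq := of_sect 1 i s (List.Perm.of_eq hb) hs ht hZ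
    obtain ⟨d, hd, he | ⟨e, rfl, he⟩⟩ := ht
    -- For an empty zero scheme the relation says that `c` vanishes, so there are no degrees to
    -- compare.
    · have h0 := of_eq_zero_of_isEmpty 1 cZ he
      rw [gradedOf_eq_zero c (heq.trans h0), gradedOf_eq_zero cZ h0]
    · rw [Over.w] at he
      rw [gradedOf_eq c hd rfl, heq]
      refine (gradedOf_eq cZ he ?_).symm
      rw [hZ.length_eq, hb, List.length_append, List.length_singleton]
      push_cast
      ring
  fgl c d L M hd := by
    have h₁ : gradedOf (c.append [L.tensor M]) =
        LaurentModule.monomial Lazard (c.bundles.length - d + 1) (of 1 (c.append [L.tensor M])) := by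
      refine gradedOf_eq (c.append _) hd ?_
      change (((c.bundles ++ [L.tensor M]).length : ℕ) : ℤ) - d = _
      rw [List.length_append, List.length_singleton]
      push_cast
      ring
    refine Eq.trans ?_ h₁.symm
    rw [← of_fgl c L M hd, map_sum]
    refine Finset.sum_congr rfl fun i _ => ?_
    rw [map_sum]
    refine Finset.sum_congr rfl fun j _ => ?_
    have h₂ : gradedOf (c.append (List.replicate i L ++ List.replicate j M)) =
        LaurentModule.monomial Lazard (c.bundles.length + (i + j : ℕ) - d)
          (of 1 (c.append (List.replicate i L ++ List.replicate j M))) := by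
      refine gradedOf_eq (c.append _) hd ?_
      change (((c.bundles ++ (List.replicate i L ++ List.replicate j M)).length : ℕ) : ℤ) - d = _
      rw [List.length_append, List.length_append, List.length_replicate, List.length_replicate]
      push_cast
      ring
    refine (congrArg (LaurentModule.action _ _ _) h₂).trans ?_
    refine (LaurentModule.action_monomial _ (lazardGradingHom_lazardCoeff i j) _ _).trans ?_
    refine congrArg₂ (fun k x => LaurentModule.monomial Lazard k x) ?_ ?_
    · ring
    · exact (smul_of _ _ _).trans (congrArg (fun a => of a _) (mul_one _))

/-- The homomorphism that records the degrees of the homogeneous components. -/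
def gradedHom (X : Over S) : Omega X →+ LaurentModule Lazard (Omega X) :=
  lift (compatible_gradedOf X)

lemma gradedHom_of_mem {k : ℤ} {x : Omega X} (hx : x ∈ grade X k) :
    gradedHom X x = LaurentModule.monomial Lazard k x := by
  induction hx using AddSubgroup.closure_induction with
  | zero => rw [map_zero, map_zero]
  | add x y _ _ hx hy => rw [map_add, map_add, hx, hy]
  | neg x _ hx => rw [map_neg, map_neg, hx]
  | mem x h =>
    obtain ⟨m, d, a, c, ha, hd, rfl, rfl⟩ := h
    rw [gradedHom, lift_of, gradedOf_eq c hd rfl,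
      LaurentModule.action_monomial _ (lazardGradingHom_of_mem ha), smul_of, mul_one]
    rfl

lemma iSup_grade (X : Over S) : ⨆ k, grade X k = ⊤ := by
  rw [eq_top_iff]
  rintro x -
  induction x using induction with
  | h₀ => exact zero_mem _
  | hneg x hx => exact neg_mem hx
  | hadd x y hx hy => exact add_mem hx hy
  | h a c =>
    have ha : a ∈ AddSubgroup.closure (⋃ n, lazardGrade n) := by
      rw [closure_lazardGrade]
      trivial
    obtain ⟨d, hd⟩ := c.smooth
    let f : Lazard →+ Omega X := AddMonoidHom.mk' (fun a => of a c) fun a b => of_add a b c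
    change f a ∈ _
    induction ha using AddSubgroup.closure_induction with
    | zero => rw [map_zero]; exact zero_mem _
    | add x y _ _ hx hy => rw [map_add]; exact add_mem hx hy
    | neg x _ hx => rw [map_neg]; exact neg_mem hx
    | mem a ha =>
      obtain ⟨m, hm⟩ := Set.mem_iUnion.mp ha
      exact AddSubgroup.mem_iSup_of_mem ((c.bundles.length : ℤ) - d - m)
        (AddSubgroup.subset_closure ⟨m, d, a, c, hm, hd, rfl, rfl⟩)

lemma grade_isInternal (X : Over S) : DirectSum.IsInternal (grade X) :=
  isInternal_of_projections (grade X)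
    (fun l => (LaurentModule.coeff (R := Lazard) (Omega X) l).comp (gradedHom X))
    (fun k l x hx => by
      rw [AddMonoidHom.comp_apply, gradedHom_of_mem hx]
      exact LaurentModule.coeff_monomial k l x) (iSup_grade X)

end Omega

end RelCobordism

/-! ### The axioms of a functor with products, verified on cycles. -/

namespace RelCobordism

variable {S : Scheme.{u}}

namespace Omega

variable {X Y Z : Over S}

/-- Taking plain functions lets both sides of an identity be stated as they are written; the default
arguments supply the biadditivity. -/
lemma ext₂ {B : Type*} [AddCommGroup B] (F G : Omega X → Omega Y → B)
    (h : ∀ a c b c', F (of a c) (of b c') = G (of a c) (of b c'))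
    (hF₁ : ∀ x x' y, F (x + x') y = F x y + F x' y := by
      intros; simp only [map_add, AddMonoidHom.add_apply])
    (hF₂ : ∀ x y y', F x (y + y') = F x y + F x y' := by
      intros; simp only [map_add, AddMonoidHom.add_apply])
    (hG₁ : ∀ x x' y, G (x + x') y = G x y + G x' y := by
      intros; simp only [map_add, AddMonoidHom.add_apply])
    (hG₂ : ∀ x y y', G x (y + y') = G x y + G x y' := by
      intros; simp only [map_add, AddMonoidHom.add_apply]) (x : Omega X) (y : Omega Y) :
    F x y = G x y := by
  refine DFunLike.congr_fun (f := AddMonoidHom.mk' (F x) (hF₂ x)) (g := AddMonoidHom.mk' (G x) (hG₂ x))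
    (hom_ext fun b c' => ?_) y
  exact DFunLike.congr_fun (f := AddMonoidHom.mk' (fun x => F x (of b c')) fun x x' => hF₁ x x' _)
    (g := AddMonoidHom.mk' (fun x => G x (of b c')) fun x x' => hG₁ x x' _)
    (hom_ext fun a c => h a c b c') x

lemma push_id (h : IsProper (𝟙 X : X ⟶ X).left) (x : Omega X) : push (𝟙 X) h x = x := by
  refine DFunLike.congr_fun (f := push (𝟙 X) h) (g := AddMonoidHom.id _) (hom_ext fun a c => ?_) x
  rw [push_of]
  exact of_isom a (Cycle.isom_mk_self (Category.comp_id _).symm (List.Perm.refl _))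

lemma push_comp (f : X ⟶ Y) (g : Y ⟶ Z) (hf : IsProper f.left)
    (hg : IsProper g.left) (hfg : IsProper (f ≫ g).left) (x : Omega X) :
    push (f ≫ g) hfg x = push g hg (push f hf x) := by
  refine DFunLike.congr_fun (g := (push g hg).comp (push f hf)) (hom_ext fun a c => ?_) x
  rw [AddMonoidHom.comp_apply, push_of, push_of, push_of]
  exact of_isom a (Cycle.isom_mk_self (Category.assoc _ _ _) (List.Perm.refl _))

lemma pull_id (h : SmoothEquidim (𝟙 X : X ⟶ X).left) (x : Omega X) : pull (𝟙 X) h x = x := by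
  refine DFunLike.congr_fun (f := pull (𝟙 X) h) (g := AddMonoidHom.id _) (hom_ext fun a c => ?_) x
  rw [pull_of _ _ _ _ (IsPullback.of_horiz_isIso (fst := 𝟙 c.V) (snd := c.map) ⟨by simp⟩)]
  exact of_isom a (Cycle.isom_mk_self rfl
    (List.Perm.of_eq (LineBundle.map_pullback_id c.bundles).symm))

lemma pull_comp (f : X ⟶ Y) (g : Y ⟶ Z) (hf : SmoothEquidim f.left)
    (hg : SmoothEquidim g.left) (hfg : SmoothEquidim (f ≫ g).left) (z : Omega Z) :
    pull (f ≫ g) hfg z = pull f hf (pull g hg z) := by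
  refine DFunLike.congr_fun (g := (pull f hf).comp (pull g hg)) (hom_ext fun a c => ?_) z
  have sq := IsPullback.of_hasPullback c.map g
  have sq' := IsPullback.of_hasPullback (pullback.snd c.map g) f
  rw [AddMonoidHom.comp_apply, pull_of g _ _ _ sq, pull_of f _ _ (c.pull _ _ _ _ sq) sq',
    pull_of _ _ _ _ (sq'.paste_horiz sq)]
  exact of_isom a (Cycle.isom_mk_self rfl
    (List.Perm.of_eq (LineBundle.map_pullback_pullback _ _ _)))

/-- Pasting a fibre product of `c.map` and `g'` onto the given square yields a fibre product of
`c.map ≫ f` and `g`; computed there, both sides are the same cycle. -/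
lemma base_change {W X Y Z : Over S} (g' : W ⟶ X) (f' : W ⟶ Y) (f : X ⟶ Z) (g : Y ⟶ Z)
    (sq : IsPullback g' f' f g) (hf : IsProper f.left) (hg : SmoothEquidim g.left)
    (hf' : IsProper f'.left) (hg' : SmoothEquidim g'.left) (x : Omega X) :
    pull g hg (push f hf x) = push f' hf' (pull g' hg' x) := by
  refine DFunLike.congr_fun (f := (pull g hg).comp (push f hf))
    (g := (push f' hf').comp (pull g' hg')) (hom_ext fun a c => ?_) x
  have sq' := IsPullback.of_hasPullback c.map g'
  rw [AddMonoidHom.comp_apply, AddMonoidHom.comp_apply, pull_of g' _ _ _ sq', push_of, push_of,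
    pull_of g _ _ (c.push f hf) (sq'.paste_vert sq)]
  rfl

lemma push_chern (f : X ⟶ Y) (hf : IsProper f.left) (M : LineBundle Y.left)
    (x : Omega X) : push f hf (chern (M.pullback f.left) x) = chern M (push f hf x) := by
  refine DFunLike.congr_fun (f := (push f hf).comp (chern (M.pullback f.left)))
    (g := (chern M).comp (push f hf)) (hom_ext fun a c => ?_) x
  rw [AddMonoidHom.comp_apply, AddMonoidHom.comp_apply, push_of, chern_of, push_of, chern_of]
  have hb : c.bundles ++ [M.pullback (c.map ≫ f).left] =
      c.bundles ++ [(M.pullback f.left).pullback c.map.left] := by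
    rw [LineBundle.pullback_left_comp]
  exact of_isom a (Cycle.isom_mk_self rfl (List.Perm.of_eq hb))

lemma pull_chern (f : X ⟶ Y) (hf : SmoothEquidim f.left) (M : LineBundle Y.left)
    (y : Omega Y) : chern (M.pullback f.left) (pull f hf y) = pull f hf (chern M y) := by
  refine DFunLike.congr_fun (f := (chern (M.pullback f.left)).comp (pull f hf))
    (g := (pull f hf).comp (chern M)) (hom_ext fun a c => ?_) y
  have sq := IsPullback.of_hasPullback c.map f
  rw [AddMonoidHom.comp_apply, AddMonoidHom.comp_apply, pull_of f _ _ _ sq, chern_of, chern_of,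
    pull_of f _ _ (c.chern M) sq]
  have hb : (c.bundles ++ [M.pullback c.map.left]).map
      (LineBundle.pullback (pullback.fst c.map f).left) =
      c.bundles.map (LineBundle.pullback (pullback.fst c.map f).left) ++
        [(M.pullback f.left).pullback (pullback.snd c.map f).left] := by
    rw [List.map_append, List.map_singleton, LineBundle.pullback_pullback_of_eq sq.w]
  exact of_isom a (Cycle.isom_mk_self rfl (List.Perm.of_eq hb))

lemma chern_comm (L L' : LineBundle X.left) (x : Omega X) :
    chern L (chern L' x) = chern L' (chern L x) := by
  refine DFunLike.congr_fun (f := (chern L).comp (chern L'))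
    (g := (chern L').comp (chern L)) (hom_ext fun a c => ?_) x
  rw [AddMonoidHom.comp_apply, AddMonoidHom.comp_apply, chern_of, chern_of, chern_of, chern_of]
  refine of_isom a (Cycle.isom_mk_self rfl ?_)
  change (c.bundles ++ [_] ++ [_]).Perm (c.bundles ++ [_] ++ [_])
  rw [List.append_assoc, List.append_assoc]
  exact (List.perm_append_comm).append_left _

lemma chern_isom (L L' : LineBundle X.left) (h : L.Isom L') : chern L = chern L' := by
  refine hom_ext fun a c => ?_
  rw [chern_of, chern_of]
  have hb : List.Forall₂ LineBundle.Isom (c.bundles ++ [L.pullback c.map.left])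
      ((c.bundles ++ [L'.pullback c.map.left]).map
        (LineBundle.pullback (𝟙 c.V : c.V ⟶ c.V).left)) := by
    rw [LineBundle.map_pullback_id]
    exact List.rel_append (List.forall₂_same.mpr fun _ _ => LineBundle.Isom.refl _)
      (List.Forall₂.cons (h.pullback _) List.Forall₂.nil)
  exact of_isom a ⟨Iso.refl _, Category.id_comp _, _, List.Perm.refl _, hb⟩

lemma push_prod {X₁ X₂ Y₁ Y₂ : Over S} (f : X₁ ⟶ X₂) (g : Y₁ ⟶ Y₂) (hf : IsProper f.left)
    (hg : IsProper g.left) (x : Omega X₁) (y : Omega Y₁) :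
    prod (push f hf x) (push g hg y) = push (f ⊗ₘ g) (isProper_tensor hf hg) (prod x y) := by
  refine ext₂ (fun x y => prod (push f hf x) (push g hg y))
    (fun x y => push (f ⊗ₘ g) (isProper_tensor hf hg) (prod x y)) (fun a c b c' => ?_)
    (x := x) (y := y)
  rw [push_of, push_of, prod_of, prod_of, push_of]
  refine of_isom _ (Cycle.isom_mk_self ?_ (List.Perm.refl _))
  exact tensorHom_comp_tensorHom _ _ _ _

lemma pull_prod {X₁ X₂ Y₁ Y₂ : Over S} (f : X₁ ⟶ X₂) (g : Y₁ ⟶ Y₂) (hf : SmoothEquidim f.left)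
    (hg : SmoothEquidim g.left) (hfg : SmoothEquidim (f ⊗ₘ g).left) (x : Omega X₂)
    (y : Omega Y₂) : prod (pull f hf x) (pull g hg y) = pull (f ⊗ₘ g) hfg (prod x y) := by
  refine ext₂ (fun x y => prod (pull f hf x) (pull g hg y))
    (fun x y => pull (f ⊗ₘ g) hfg (prod x y)) (fun a c b c' => ?_) (x := x) (y := y)
  have sq := IsPullback.of_hasPullback c.map f
  have sq' := IsPullback.of_hasPullback c'.map g
  rw [pull_of f _ _ _ sq, pull_of g _ _ _ sq', prod_of, prod_of,
    pull_of _ _ _ (c.prod c') (isPullback_tensorHom sq sq')]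
  refine of_isom _ (Cycle.isom_mk_self rfl (List.Perm.of_eq ?_))
  have h₁ (Ls : List (LineBundle c.V.left)) := LineBundle.map_pullback_pullback
    (fst (pullback c.map f) (pullback c'.map g)) (pullback.fst c.map f) Ls
  have h₂ (Ls : List (LineBundle c'.V.left)) := LineBundle.map_pullback_pullback
    (snd (pullback c.map f) (pullback c'.map g)) (pullback.fst c'.map g) Ls
  have hb : (c.bundles.map (LineBundle.pullback (fst c.V c'.V).left) ++
        c'.bundles.map (LineBundle.pullback (snd c.V c'.V).left)).map
        (LineBundle.pullback (pullback.fst c.map f ⊗ₘ pullback.fst c'.map g).left) =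
      (c.bundles.map (LineBundle.pullback (pullback.fst c.map f).left)).map
        (LineBundle.pullback (fst (pullback c.map f) (pullback c'.map g)).left) ++
      (c'.bundles.map (LineBundle.pullback (pullback.fst c'.map g).left)).map
        (LineBundle.pullback (snd (pullback c.map f) (pullback c'.map g)).left) := by
    rw [List.map_append, LineBundle.map_pullback_pullback, LineBundle.map_pullback_pullback, h₁, h₂,
      tensorHom_fst, tensorHom_snd]
  exact hb

lemma chern_prod (L : LineBundle X.left) (x : Omega X) (y : Omega Y) :
    prod (chern L x) y = chern (L.pullback (fst X Y).left) (prod x y) := by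
  refine ext₂ (fun x y => prod (chern L x) y)
    (fun x y => chern (L.pullback (fst X Y).left) (prod x y)) (fun a c b c' => ?_) (x := x) (y := y)
  rw [chern_of, prod_of, prod_of, chern_of]
  refine of_isom _ (Cycle.isom_mk_self rfl ?_)
  have hb : ((c.bundles.map (LineBundle.pullback (fst c.V c'.V).left) ++
        c'.bundles.map (LineBundle.pullback (snd c.V c'.V).left)) ++
          [(L.pullback (fst X Y).left).pullback (c.map ⊗ₘ c'.map).left]).Perm
      ((c.bundles ++ [L.pullback c.map.left]).map (LineBundle.pullback (fst c.V c'.V).left) ++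
        c'.bundles.map (LineBundle.pullback (snd c.V c'.V).left)) := by
    rw [List.map_append, List.map_singleton, List.append_assoc, List.append_assoc,
      LineBundle.pullback_pullback_of_eq (tensorHom_fst c.map c'.map)]
    exact List.perm_append_comm.append_left _
  exact hb

lemma prod_comm (x : Omega X) (y : Omega Y) :
    push (β_ X Y).hom (isProper_of_iso _) (prod x y) = prod y x := by
  refine ext₂ (fun x y => push (β_ X Y).hom (isProper_of_iso _) (prod x y))
    (fun x y => prod y x) (fun a c b c' => ?_) (x := x) (y := y)
  rw [prod_of, prod_of, push_of, mul_comm]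
  exact (of_isom _ (prod_braiding_isom c' c)).symm

lemma prod_assoc (x : Omega X) (y : Omega Y) (z : Omega Z) :
    push (α_ X Y Z).hom (isProper_of_iso _) (prod (prod x y) z) = prod x (prod y z) := by
  refine DFunLike.congr_fun
    (f := (push (α_ X Y Z).hom (isProper_of_iso _)).comp (prod (prod x y)))
    (g := (prod x).comp (prod y)) (hom_ext fun a'' c'' => ?_) z
  refine ext₂ (fun x y => push (α_ X Y Z).hom (isProper_of_iso _) (prod (prod x y) (of a'' c'')))
    (fun x y => prod x (prod y (of a'' c''))) (fun a c b c' => ?_) (x := x) (y := y)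
  rw [prod_of, prod_of, prod_of, prod_of, push_of, mul_assoc]
  refine of_isom _ (Cycle.isom_mk (α_ c.V c'.V c''.V) ?_ (List.Perm.of_eq ?_))
  · exact (associator_naturality c.map c'.map c''.map).symm
  · have hb : (c.bundles.map (LineBundle.pullback (fst c.V (c'.V ⊗ c''.V)).left) ++
          (c'.bundles.map (LineBundle.pullback (fst c'.V c''.V).left) ++
            c''.bundles.map (LineBundle.pullback (snd c'.V c''.V).left)).map
            (LineBundle.pullback (snd c.V (c'.V ⊗ c''.V)).left)).map
          (LineBundle.pullback (α_ c.V c'.V c''.V).hom.left) =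
        (c.bundles.map (LineBundle.pullback (fst c.V c'.V).left) ++
          c'.bundles.map (LineBundle.pullback (snd c.V c'.V).left)).map
          (LineBundle.pullback (fst (c.V ⊗ c'.V) c''.V).left) ++
        c''.bundles.map (LineBundle.pullback (snd (c.V ⊗ c'.V) c''.V).left) := by
      simp only [List.map_append, LineBundle.map_pullback_pullback, List.append_assoc,
        associator_hom_fst, associator_hom_snd_fst, associator_hom_snd_snd]
    exact hb

/-- The module structure that comes from `Φ` and the external product is scalar multiplication in
the tensor product. The unit axiom, the multiplicativity of `Φ` and the formal group law axiom all
rest on this. -/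
lemma push_leftUnitor_prod_of_one (a : Lazard) (x : Omega X) :
    push (λ_ X).hom (isProper_of_iso _) (prod (of a (Cycle.one S)) x) = action X a x := by
  refine DFunLike.congr_fun (f := (push (λ_ X).hom (isProper_of_iso _)).comp
    (prod (of a (Cycle.one S)))) (hom_ext fun b c => ?_) x
  rw [AddMonoidHom.comp_apply, prod_of, push_of]
  refine (of_isom _ (Cycle.isom_mk (λ_ c.V) ?_ (List.Perm.of_eq ?_))).trans (action_of a b c).symm
  · exact (leftUnitor_naturality c.map).symm
  · have hb : c.bundles.map (LineBundle.pullback (λ_ c.V).hom.left) =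
        ([] : List (LineBundle (𝟙_ (Over S)).left)).map
          (LineBundle.pullback (fst (𝟙_ (Over S)) c.V).left) ++
        c.bundles.map (LineBundle.pullback (snd (𝟙_ (Over S)) c.V).left) := by
      rw [leftUnitor_hom]
      rfl
    exact hb

lemma one_prod (x : Omega X) :
    push (λ_ X).hom (isProper_of_iso _) (prod (of 1 (Cycle.one S)) x) = x := by
  rw [push_leftUnitor_prod_of_one, map_one]
  rfl

end Omega

end RelCobordism

/-! ### Additivity, degrees and the geometric axioms for `Ω^*`. -/

namespace RelCobordism

variable {S : Scheme.{u}}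

lemma smoothEquidim_of_isOpenImmersion {X Y : Scheme.{u}} (f : X ⟶ Y) [IsOpenImmersion f] :
    SmoothEquidim f :=
  ⟨0, inferInstance⟩

/-- The cobordism cycle `[id : X ⟶ X]`. -/
def Cycle.fund (X : Over S) (hX : SmoothEquidim X.hom) : Cycle X where
  V := X
  map := 𝟙 X
  proper := isProper_id X
  smooth := hX
  bundles := []

namespace Omega

variable {X Y Z : Over S}

/-- The base change of the monomorphism `i` along itself is the identity, while cycles coming from
`Y` restrict to empty cycles on `X`. -/
lemma pull_push_of_isDisjointUnion {i : X ⟶ Z} {j : Y ⟶ Z} (h : IsDisjointUnion i j)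
    (hi : IsProper i.left) (hi' : SmoothEquidim i.left) (hj : IsProper j.left)
    (p : Omega X × Omega Y) : pull i hi' (push i hi p.1 + push j hj p.2) = p.1 := by
  have := h.isOpenImmersion_left
  have hmono : Mono i := (Over.forget S).mono_of_mono_map (inferInstanceAs (Mono i.left))
  have h₁ (x : Omega X) : pull i hi' (push i hi x) = x := by
    rw [base_change (𝟙 X) (𝟙 X) i i (IsKernelPair.id_of_mono i) hi hi' (isProper_id X)
      (smoothEquidim_of_isIso (𝟙 X.left)), push_id, pull_id]
  have h₂ (y : Omega Y) : pull i hi' (push j hj y) = 0 := by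
    refine DFunLike.congr_fun (f := (pull i hi').comp (push j hj)) (g := 0)
      (hom_ext fun a c => ?_) y
    have sq := IsPullback.of_hasPullback (c.map ≫ j) i
    have hw : pullback.snd (c.map ≫ j) i ≫ i = (pullback.fst (c.map ≫ j) i ≫ c.map) ≫ j := by
      rw [Category.assoc, ← sq.w]
    rw [AddMonoidHom.comp_apply, push_of, pull_of _ _ _ (c.push j hj) sq]
    exact of_eq_zero_of_isEmpty a _ (h.isEmpty_of_comp_eq _ _ hw)
  rw [map_add, h₁, h₂, add_zero]

/-- The source of a cycle over `Z` is the disjoint union of its parts over `X` and `Y`, so this is a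
disjoint union relation. -/
lemma push_pull_of_isDisjointUnion {i : X ⟶ Z} {j : Y ⟶ Z} (h : IsDisjointUnion i j)
    (hi : IsProper i.left) (hi' : SmoothEquidim i.left) (hj : IsProper j.left)
    (hj' : SmoothEquidim j.left) (z : Omega Z) :
    push i hi (pull i hi' z) + push j hj (pull j hj' z) = z := by
  refine DFunLike.congr_fun (f := (push i hi).comp (pull i hi') + (push j hj).comp (pull j hj'))
    (g := AddMonoidHom.id _) (hom_ext fun a c => ?_) z
  have sq := IsPullback.of_hasPullback c.map i
  have sq' := IsPullback.of_hasPullback c.map j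
  rw [AddMonoidHom.add_apply, AddMonoidHom.comp_apply, AddMonoidHom.comp_apply,
    pull_of _ _ _ _ sq, pull_of _ _ _ _ sq', push_of, push_of]
  exact (of_disjointUnion a (c₁ := (c.pull i hi' _ _ sq).push i hi)
    (c₂ := (c.pull j hj' _ _ sq').push j hj) (h.of_isPullback sq sq')
    ⟨sq.w, rfl⟩ ⟨sq'.w, rfl⟩).symm

lemma additive {i : X ⟶ Z} {j : Y ⟶ Z} (hi : IsProper i.left) (hj : IsProper j.left)
    (h : IsDisjointUnion i j) :
    Function.Bijective (fun p : Omega X × Omega Y => push i hi p.1 + push j hj p.2) := by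
  have := h.isOpenImmersion_left
  have := h.isOpenImmersion_right
  have hi' := smoothEquidim_of_isOpenImmersion i.left
  have hj' := smoothEquidim_of_isOpenImmersion j.left
  refine Function.bijective_iff_has_inverse.mpr ⟨fun z => (pull i hi' z, pull j hj' z),
    fun p => Prod.ext ?_ ?_, fun z => push_pull_of_isDisjointUnion h hi hi' hj hj' z⟩
  · exact pull_push_of_isDisjointUnion h hi hi' hj p
  · refine (congrArg (pull j hj') (add_comm _ _)).trans ?_
    exact pull_push_of_isDisjointUnion h.symm hj hj' hi p.swap

lemma subsingleton_of_isEmpty (h : IsEmpty X.left) : Subsingleton (Omega X) := by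
  have h0 : AddMonoidHom.id (Omega X) = 0 := hom_ext fun a c =>
    of_eq_zero_of_isEmpty a c (Function.isEmpty c.map.left)
  exact subsingleton_of_forall_eq 0 fun x => DFunLike.congr_fun h0 x

lemma of_mem_grade {a : Lazard} {c : Cycle X} {m d : ℕ} {k : ℤ} (ha : a ∈ lazardGrade m)
    (hd : SmoothOfRelativeDimension d c.V.hom) (hk : k = (c.bundles.length : ℤ) - d - m) :
    of a c ∈ grade X k :=
  AddSubgroup.subset_closure ⟨m, d, a, c, ha, hd, hk, rfl⟩

lemma map_mem_of_mem_grade {B : Type*} [AddCommGroup B] (f : Omega X →+ B) {G : AddSubgroup B}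
    {k : ℤ} (h : ∀ (m d : ℕ) (a : Lazard) (c : Cycle X), a ∈ lazardGrade m →
      SmoothOfRelativeDimension d c.V.hom → k = (c.bundles.length : ℤ) - d - m → f (of a c) ∈ G)
    {x : Omega X} (hx : x ∈ grade X k) : f x ∈ G := by
  refine ((AddSubgroup.closure_le (G.comap f)).mpr ?_) hx
  rintro x ⟨m, d, a, c, ha, hd, hk, rfl⟩
  exact h m d a c ha hd hk

lemma push_mem (f : X ⟶ Y) (hf : IsProper f.left) (i : ℤ) (x : Omega X) (hx : x ∈ grade X i) :
    push f hf x ∈ grade Y i :=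
  map_mem_of_mem_grade _ (fun m d a c ha hd hk => by
    rw [push_of]
    exact of_mem_grade (c := c.push f hf) ha hd hk) hx

lemma pull_mem (f : X ⟶ Y) (hf : SmoothEquidim f.left) (e : ℕ)
    (he : SmoothOfRelativeDimension e f.left) (i : ℤ) (y : Omega Y) (hy : y ∈ grade Y i) :
    pull f hf y ∈ grade X (i - e) :=
  map_mem_of_mem_grade _ (fun m d a c ha hd hk => by
    have sq := IsPullback.of_hasPullback c.map f
    rw [pull_of _ _ _ _ sq]
    refine of_mem_grade (c := c.pull f hf _ _ sq) ha
      (SmoothOfRelativeDimension.hom_of_isPullback sq he hd) ?_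
    have hb : (c.bundles.map (LineBundle.pullback (pullback.fst c.map f).left)).length =
      c.bundles.length := List.length_map _
    refine Eq.trans ?_ (congrArg (fun n : ℕ => (n : ℤ) - (e + d : ℕ) - m) hb.symm)
    rw [hk]
    push_cast
    ring) hy

lemma chern_mem (L : LineBundle X.left) (i : ℤ) (x : Omega X) (hx : x ∈ grade X i) :
    chern L x ∈ grade X (i + 1) :=
  map_mem_of_mem_grade _ (fun m d a c ha hd hk => by
    rw [chern_of]
    refine of_mem_grade (c := c.chern L) ha hd ?_
    have hb : (c.bundles ++ [L.pullback c.map.left]).length = c.bundles.length + 1 :=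
      List.length_append
    refine Eq.trans ?_ (congrArg (fun n : ℕ => (n : ℤ) - d - m) hb.symm)
    rw [hk]
    push_cast
    ring) hx

lemma prod_mem (i j : ℤ) (x : Omega X) (y : Omega Y) (hx : x ∈ grade X i) (hy : y ∈ grade Y j) :
    prod x y ∈ grade (X ⊗ Y) (i + j) :=
  map_mem_of_mem_grade (prod.flip y) (fun m d a c ha hd hk =>
    map_mem_of_mem_grade (prod (of a c)) (fun n e b c' hb he hl => by
      rw [prod_of]
      refine of_mem_grade (c := c.prod c') (d := e + d) (mul_mem_lazardGrade ha hb) ?_ ?_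
      · have sq : IsPullback (fst c.V c'.V).left (snd c.V c'.V).left c.V.hom c'.V.hom :=
          IsPullback.of_hasPullback c.V.hom c'.V.hom
        have : SmoothOfRelativeDimension e (fst c.V c'.V).left :=
          SmoothOfRelativeDimension.of_isPullback sq he
        have : SmoothOfRelativeDimension (e + d) ((fst c.V c'.V).left ≫ c.V.hom) := inferInstance
        rwa [Over.w] at this
      · have hb : (c.bundles.map (LineBundle.pullback (fst c.V c'.V).left) ++
            c'.bundles.map (LineBundle.pullback (snd c.V c'.V).left)).length =
            c.bundles.length + c'.bundles.length := by
          rw [List.length_append, List.length_map, List.length_map]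
        refine Eq.trans ?_ (congrArg (fun p : ℕ => (p : ℤ) - (e + d : ℕ) - (m + n : ℕ)) hb.symm)
        rw [hk, hl]
        push_cast
        ring) hy) hx

lemma of_one_mem {a : Lazard} {n : ℕ} (ha : a ∈ lazardGrade n) :
    of a (Cycle.one S) ∈ grade (𝟙_ (Over S)) (-n) :=
  of_mem_grade (c := Cycle.one S) (d := 0) ha
    (inferInstanceAs (SmoothOfRelativeDimension 0 (𝟙 S))) (by
      change _ = (0 : ℤ) - (0 : ℕ) - n
      simp)

lemma one_mem : of 1 (Cycle.one S) ∈ grade (𝟙_ (Over S)) 0 := by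
  have h := of_one_mem (S := S) one_mem_lazardGrade
  rwa [Nat.cast_zero, neg_zero] at h

variable (S) in
/-- `Ω^*(- ⟶ S)` as an oriented Borel--Moore functor with products. -/
def bmFunctor : BMFunctor S (fun X : Over S => Omega X) where
  grade := grade
  grade_internal := grade_isInternal
  push := push
  pull := pull
  chern := chern
  prod := prod
  one := of 1 (Cycle.one S)
  push_mem := push_mem
  pull_mem := pull_mem
  chern_mem := chern_mem
  prod_mem := prod_mem
  one_mem := one_mem
  push_id _ := push_id
  push_comp := push_comp
  additive_empty _ := subsingleton_of_isEmpty
  additive _ _ := additive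
  prod_comm := prod_comm
  prod_assoc := prod_assoc
  one_prod := one_prod
  pull_id _ := pull_id
  pull_comp := pull_comp
  base_change := base_change
  push_chern := push_chern
  pull_chern := pull_chern
  chern_comm := chern_comm
  chern_isom := chern_isom
  push_prod := push_prod
  pull_prod := pull_prod
  chern_prod := chern_prod

lemma fund_bmFunctor (hX : SmoothEquidim X.hom) :
    (bmFunctor S).fund X hX = of 1 (Cycle.fund X hX) := by
  have sq : IsPullback (toUnit X) (𝟙 X) (𝟙 (𝟙_ (Over S))) (toUnit X) :=
    IsPullback.of_vert_isIso ⟨(Category.comp_id _).trans (Category.id_comp _).symm⟩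
  exact pull_of _ _ _ (Cycle.one S) sq

lemma foldr_chern (Ls : List (LineBundle X.left)) (x : Omega X) :
    Ls.foldr (fun L x => chern L x) x = cherns Ls x := by
  induction Ls with
  | nil => rfl
  | cons L Ls ih => rw [List.foldr_cons, ih]; rfl

lemma cherns_fund (hX : SmoothEquidim X.hom) (Ls : List (LineBundle X.left)) :
    cherns Ls (of 1 (Cycle.fund X hX)) = of 1 ((Cycle.fund X hX).append Ls) := by
  rw [cherns_of]
  exact congrArg (fun Ls => of 1 ((Cycle.fund X hX).append Ls)) (LineBundle.map_pullback_id Ls)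

lemma iterate_chern (L : LineBundle X.left) (n : ℕ) (x : Omega X) :
    (chern L)^[n] x = cherns (List.replicate n L) x := by
  induction n with
  | zero => rfl
  | succ n ih => rw [Function.iterate_succ_apply', ih]; rfl

lemma cherns_append (Ls Ms : List (LineBundle X.left)) (x : Omega X) :
    cherns (Ls ++ Ms) x = cherns Ls (cherns Ms x) := by
  induction Ls with
  | nil => rfl
  | cons L Ls ih => exact congrArg (chern L) ih

variable (S) in
/-- `Ω^*(- ⟶ S)` as a functor of geometric type. -/
def geometricFunctor : GeometricFunctor S (fun X : Over S => Omega X) where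
  toBMFunctor := bmFunctor S
  Phi := AddMonoidHom.mk' (fun a => of a (Cycle.one S)) fun a b => of_add a b _
  Phi_one := rfl
  Phi_mul a b := ((push_leftUnitor_prod_of_one a (of b (Cycle.one S))).trans (action_of a b _)).symm
  Phi_mem _ _ ha := of_one_mem ha
  -- On the fundamental class `[id_X]` the three geometric axioms are instances of the defining
  -- relations: the dimension relation with `π` the identity, the section relation with no other
  -- bundles, and the formal group law relation for the cycle `[id_X]`.
  rel_dim X hX d hd Ls hLs := by
    rw [fund_bmFunctor]
    refine (foldr_chern Ls _).trans ?_
    rw [cherns_fund]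
    refine of_eq_zero_of_dim 1 (c := (Cycle.fund X hX).append Ls) (𝟙 X) (Ms := [])
      (smoothEquidim_of_isIso (𝟙 X.left)) hd hLs (List.Perm.of_eq ?_)
    exact ((List.append_nil _).trans (LineBundle.map_pullback_id Ls)).symm
  rel_sect X Z hX hZ i hi L s hs ht := by
    rw [fund_bmFunctor, fund_bmFunctor]
    change cherns [L] _ = push i hi _
    rw [cherns_fund, push_of]
    exact of_sect 1 (c := (Cycle.fund X hX).append [L]) (cZ := (Cycle.fund Z hZ).push i hi) i s
      (Ls := []) (List.Perm.refl _) hs ht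
      ⟨(Category.comp_id i).trans (Category.id_comp i).symm, rfl⟩
  rel_fgl X hX d hd L M := by
    rw [fund_bmFunctor]
    refine Eq.trans ?_ ((of_fgl (Cycle.fund X hX) L M hd).trans (cherns_fund hX [L.tensor M]).symm)
    refine Finset.sum_congr rfl fun i _ => Finset.sum_congr rfl fun j _ => ?_
    refine (push_leftUnitor_prod_of_one (lazardCoeff i j) _).trans ?_
    have h : (chern L)^[i] ((chern M)^[j] (of 1 (Cycle.fund X hX))) =
        of 1 ((Cycle.fund X hX).append (List.replicate i L ++ List.replicate j M)) := by
      rw [iterate_chern, iterate_chern, ← cherns_append, cherns_fund]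
    exact (congrArg (action X (lazardCoeff i j)) h).trans (action_of_one _ _)

lemma isCobordismStructure : IsCobordismStructure (geometricFunctor S) where
  grade _ _ := rfl
  push := push_of
  pull f hf a c _ _ _ sq := pull_of f hf a c sq
  chern := chern_of
  prod := prod_of
  one := rfl
  Phi _ := rfl

end Omega

end RelCobordism

/-! ### Formal consequences of the axioms for an arbitrary functor `A`. -/

namespace RelCobordism

variable {S : Scheme.{u}}

lemma isProper_comp {X Y Z : Over S} {f : X ⟶ Y} {g : Y ⟶ Z} (hf : IsProper f.left)
    (hg : IsProper g.left) : IsProper (f ≫ g).left := by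
  rw [Over.comp_left]
  infer_instance

lemma isProper_of_comp {X Y Z : Over S} {f : X ⟶ Y} {g : Y ⟶ Z} {h : X ⟶ Z} (w : f ≫ g = h)
    (hh : IsProper h.left) (hg : IsProper g.left) : IsProper f.left := by
  have : IsProper (f.left ≫ g.left) := by rwa [← Over.comp_left, w]
  exact IsProper.of_comp f.left g.left

lemma smoothEquidim_of_iso {X Y : Over S} (e : X ≅ Y) : SmoothEquidim e.hom.left :=
  have : IsIso e.hom.left := inferInstanceAs (IsIso ((Over.forget S).map e.hom))
  smoothEquidim_of_isIso _

section Cartesian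

variable {C : Type*} [Category* C] [CartesianMonoidalCategory C]

lemma isPullback_leftUnitor {X Y : C} (f : X ⟶ Y) :
    IsPullback (𝟙 (𝟙_ C) ⊗ₘ f) (λ_ X).hom (λ_ Y).hom f :=
  IsPullback.of_vert_isIso ⟨by simp⟩

end Cartesian

namespace BMFunctor

variable {A : Over S → Type w} [∀ X, AddCommGroup (A X)] (T : BMFunctor S A)
  {X Y Z : Over S}

lemma pull_congr {f f' : X ⟶ Y} (h : f = f') (hf : SmoothEquidim f.left)
    (hf' : SmoothEquidim f'.left) (y : A Y) : T.pull f hf y = T.pull f' hf' y := by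
  subst h
  rfl

lemma push_push_of_eq {f : X ⟶ Y} {g : Y ⟶ Z} {h : X ⟶ Z} (w : f ≫ g = h) (hf : IsProper f.left)
    (hg : IsProper g.left) (hh : IsProper h.left) (x : A X) :
    T.push g hg (T.push f hf x) = T.push h hh x := by
  subst w
  exact (T.push_comp f g hf hg hh x).symm

lemma push_push_congr {Y' : Over S} {f : X ⟶ Y} {g : Y ⟶ Z} {f' : X ⟶ Y'} {g' : Y' ⟶ Z}
    (w : f ≫ g = f' ≫ g') (hf : IsProper f.left) (hg : IsProper g.left) (hf' : IsProper f'.left)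
    (hg' : IsProper g'.left) (x : A X) :
    T.push g hg (T.push f hf x) = T.push g' hg' (T.push f' hf' x) := by
  rw [T.push_push_of_eq w hf hg (isProper_comp hf' hg'), T.push_comp]

lemma pull_pull_of_eq {f : X ⟶ Y} {g : Y ⟶ Z} {h : X ⟶ Z} (w : f ≫ g = h)
    (hf : SmoothEquidim f.left) (hg : SmoothEquidim g.left) (hh : SmoothEquidim h.left) (z : A Z) :
    T.pull f hf (T.pull g hg z) = T.pull h hh z := by
  subst w
  exact (T.pull_comp f g hf hg hh z).symm

lemma pull_push_of_mono (f : X ⟶ Y) [Mono f] (hf : IsProper f.left) (hf' : SmoothEquidim f.left)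
    (x : A X) : T.pull f hf' (T.push f hf x) = x := by
  rw [T.base_change (𝟙 X) (𝟙 X) f f (IsKernelPair.id_of_mono f) hf hf' (isProper_id X)
    (smoothEquidim_of_isIso (𝟙 X.left)), T.push_id, T.pull_id]

lemma push_pull_of_iso (e : X ≅ Y) (y : A Y) :
    T.push e.hom (isProper_of_iso e) (T.pull e.hom (smoothEquidim_of_iso e) y) = y := by
  rw [← T.base_change e.hom e.hom (𝟙 Y) (𝟙 Y) (IsPullback.of_horiz_isIso ⟨rfl⟩) (isProper_id Y)
    (smoothEquidim_of_isIso (𝟙 Y.left)), T.push_id, T.pull_id]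

/-- Additivity writes `z` as `i_* x + j_* y`. By base change the pullbacks recover `x` and `y`,
because the mixed terms factor through the group of an empty scheme. -/
lemma push_pull_of_isDisjointUnion {i : X ⟶ Z} {j : Y ⟶ Z} (h : IsDisjointUnion i j)
    (hi : IsProper i.left) (hi' : SmoothEquidim i.left) (hj : IsProper j.left)
    (hj' : SmoothEquidim j.left) (z : A Z) :
    T.push i hi (T.pull i hi' z) + T.push j hj (T.pull j hj' z) = z := by
  obtain ⟨⟨x, y⟩, rfl⟩ := (T.additive i j hi hj h).2 z
  have := h.isOpenImmersion_left
  have := h.isOpenImmersion_right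
  have : Mono i := (Over.forget S).mono_of_mono_map (inferInstanceAs (Mono i.left))
  have : Mono j := (Over.forget S).mono_of_mono_map (inferInstanceAs (Mono j.left))
  have key {X Y : Over S} {i : X ⟶ Z} {j : Y ⟶ Z} (h : IsDisjointUnion i j)
      (hi' : SmoothEquidim i.left) (hj : IsProper j.left) (y : A Y) :
      T.pull i hi' (T.push j hj y) = 0 := by
    have sq := IsPullback.of_hasPullback j i
    have := T.additive_empty _ (h.isEmpty_of_comp_eq (pullback.snd j i) (pullback.fst j i) sq.w.symm)
    rw [T.base_change _ _ _ _ sq hj hi'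
      (MorphismProperty.of_isPullback (P := @IsProper) (sq.map (Over.forget S)) hj)
      (SmoothEquidim.of_isPullback (sq.map (Over.forget S)) hi'),
      Subsingleton.elim (T.pull _ _ y) 0, map_zero]
  simp only [map_add, T.pull_push_of_mono, key h, key h.symm, add_zero, zero_add]

lemma prod_chern (L : LineBundle Y.left) (x : A X) (y : A Y) :
    T.prod x (T.chern L y) = T.chern (L.pullback (snd X Y).left) (T.prod x y) := by
  rw [← T.prod_comm, T.chern_prod, ← T.prod_comm y x, ← T.push_chern,
    ← LineBundle.pullback_left_comp, braiding_hom_snd]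

/-- The composite of the Chern operators of the line bundles in a list. -/
def cherns : List (LineBundle X.left) → (A X →+ A X)
  | [] => AddMonoidHom.id _
  | L :: Ls => (T.chern L).comp (cherns Ls)

lemma cherns_cons (L : LineBundle X.left) (Ls : List (LineBundle X.left)) (x : A X) :
    T.cherns (L :: Ls) x = T.chern L (T.cherns Ls x) := rfl

lemma cherns_nil (x : A X) : T.cherns [] x = x := rfl

lemma foldr_chern (Ls : List (LineBundle X.left)) (x : A X) :
    Ls.foldr (fun L x => T.chern L x) x = T.cherns Ls x := by
  induction Ls with
  | nil => rfl
  | cons L Ls ih => rw [List.foldr_cons, ih, cherns_cons]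

lemma iterate_chern (L : LineBundle X.left) (n : ℕ) (x : A X) :
    (T.chern L)^[n] x = T.cherns (List.replicate n L) x := by
  induction n with
  | zero => rfl
  | succ n ih => rw [Function.iterate_succ_apply', ih, List.replicate_succ, cherns_cons]

lemma cherns_append (Ls Ms : List (LineBundle X.left)) (x : A X) :
    T.cherns (Ls ++ Ms) x = T.cherns Ls (T.cherns Ms x) := by
  induction Ls with
  | nil => rfl
  | cons L Ls ih => rw [List.cons_append, cherns_cons, cherns_cons, ih]

lemma cherns_perm {Ls Ms : List (LineBundle X.left)} (h : Ls.Perm Ms) (x : A X) :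
    T.cherns Ls x = T.cherns Ms x := by
  induction h with
  | nil => rfl
  | cons L _ ih => rw [cherns_cons, cherns_cons, ih]
  | swap L M Ls => rw [cherns_cons, cherns_cons, cherns_cons, cherns_cons, T.chern_comm]
  | trans _ _ ih ih' => rw [ih, ih']

lemma cherns_isom {Ls Ms : List (LineBundle X.left)} (h : List.Forall₂ LineBundle.Isom Ls Ms)
    (x : A X) : T.cherns Ls x = T.cherns Ms x := by
  induction h with
  | nil => rfl
  | cons h _ ih => rw [cherns_cons, cherns_cons, ih, T.chern_isom _ _ h]

lemma push_cherns (f : X ⟶ Y) (hf : IsProper f.left) (Ls : List (LineBundle Y.left)) (x : A X) :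
    T.push f hf (T.cherns (Ls.map (LineBundle.pullback f.left)) x) =
      T.cherns Ls (T.push f hf x) := by
  induction Ls with
  | nil => rfl
  | cons L Ls ih => rw [List.map_cons, cherns_cons, cherns_cons, T.push_chern, ih]

lemma pull_cherns (f : X ⟶ Y) (hf : SmoothEquidim f.left) (Ls : List (LineBundle Y.left))
    (y : A Y) : T.cherns (Ls.map (LineBundle.pullback f.left)) (T.pull f hf y) =
      T.pull f hf (T.cherns Ls y) := by
  induction Ls with
  | nil => rfl
  | cons L Ls ih => rw [List.map_cons, cherns_cons, cherns_cons, ih, T.pull_chern]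

lemma cherns_prod (Ls : List (LineBundle X.left)) (x : A X) (y : A Y) :
    T.prod (T.cherns Ls x) y =
      T.cherns (Ls.map (LineBundle.pullback (fst X Y).left)) (T.prod x y) := by
  induction Ls with
  | nil => rfl
  | cons L Ls ih => rw [List.map_cons, cherns_cons, cherns_cons, T.chern_prod, ih]

lemma prod_cherns (Ls : List (LineBundle Y.left)) (x : A X) (y : A Y) :
    T.prod x (T.cherns Ls y) =
      T.cherns (Ls.map (LineBundle.pullback (snd X Y).left)) (T.prod x y) := by
  induction Ls with
  | nil => rfl
  | cons L Ls ih => rw [List.map_cons, cherns_cons, cherns_cons, T.prod_chern, ih]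

lemma cherns_mem (Ls : List (LineBundle X.left)) {i : ℤ} {x : A X} (hx : x ∈ T.grade X i) :
    T.cherns Ls x ∈ T.grade X (i + Ls.length) := by
  induction Ls with
  | nil =>
    rw [List.length_nil, Nat.cast_zero, add_zero]
    exact hx
  | cons L Ls ih =>
    rw [List.length_cons, Nat.cast_succ, ← add_assoc]
    exact T.chern_mem L _ _ ih

lemma pull_fund (f : X ⟶ Y) (hf : SmoothEquidim f.left) (hX : SmoothEquidim X.hom)
    (hY : SmoothEquidim Y.hom) : T.pull f hf (T.fund Y hY) = T.fund X hX :=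
  T.pull_pull_of_eq (comp_toUnit f) _ _ _ _

lemma push_fund_iso (e : X ≅ Y) (hX : SmoothEquidim X.hom) (hY : SmoothEquidim Y.hom) :
    T.push e.hom (isProper_of_iso e) (T.fund X hX) = T.fund Y hY := by
  rw [← T.pull_fund e.hom (smoothEquidim_of_iso e) hX hY, T.push_pull_of_iso]

lemma fund_unit (h : SmoothEquidim (𝟙_ (Over S)).hom) : T.fund (𝟙_ (Over S)) h = T.one :=
  (T.pull_congr (toUnit_unique _ (𝟙 _)) _ (smoothEquidim_of_isIso (𝟙 S)) _).trans (T.pull_id _ _ _)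

lemma fund_mem (hX : SmoothEquidim X.hom) {d : ℕ} (hd : SmoothOfRelativeDimension d X.hom) :
    T.fund X hX ∈ T.grade X (-d) := by
  rw [← zero_sub]
  exact T.pull_mem _ _ d hd 0 _ T.one_mem

/-- Both sides are pullbacks of `1_S ×_S 1_S`, which the unit axiom identifies with the pullback of
`1_S` along `S ×_S S ≅ S`. -/
lemma prod_fund (hX : SmoothEquidim X.hom) (hY : SmoothEquidim Y.hom)
    (hXY : SmoothEquidim (X ⊗ Y).hom) :
    T.prod (T.fund X hX) (T.fund Y hY) = T.fund (X ⊗ Y) hXY := by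
  have h : T.prod T.one T.one = T.pull (λ_ (𝟙_ (Over S))).hom (smoothEquidim_of_iso _) T.one := by
    refine Eq.trans ?_ (congrArg _ (T.one_prod T.one))
    exact (T.pull_push_of_mono _ _ _ _).symm
  -- Up to the isomorphism `S ×_S S ≅ S` this is the structure morphism of `X ⊗ Y`.
  have hs : SmoothEquidim (toUnit X ⊗ₘ toUnit Y).left := by
    obtain ⟨d, hd⟩ := hXY
    have hw : (toUnit X ⊗ₘ toUnit Y) ≫ (λ_ (𝟙_ (Over S))).hom = toUnit (X ⊗ Y) := toUnit_unique _ _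
    have : IsIso (λ_ (𝟙_ (Over S))).hom.left :=
      inferInstanceAs (IsIso ((Over.forget S).map (λ_ (𝟙_ (Over S))).hom))
    have hw' : toUnit (X ⊗ Y) ≫ (λ_ (𝟙_ (Over S))).inv = (toUnit X ⊗ₘ toUnit Y) := by
      rw [← hw, Category.assoc, Iso.hom_inv_id, Category.comp_id]
    rw [← hw', Over.comp_left]
    exact SmoothEquidim.comp (smoothEquidim_toUnit ⟨d, hd⟩) (smoothEquidim_of_iso (λ_ _).symm)
  rw [fund, fund, T.pull_prod _ _ _ _ hs, h]
  exact T.pull_pull_of_eq (toUnit_unique _ _) _ _ _ _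

end BMFunctor

end RelCobordism

/-! ### The transformation from `Ω^*` to a functor of geometric type. -/

namespace RelCobordism

variable {S : Scheme.{u}}

namespace GeometricFunctor

variable {A : Over S → Type w} [∀ X, AddCommGroup (A X)] (T : GeometricFunctor S A)
  {X Y Z : Over S}

/-- The action of the Lazard ring on `A(X)`. -/
def action (X : Over S) : Lazard →+* AddMonoid.End (A X) where
  toFun a := (T.push (λ_ X).hom (isProper_of_iso _)).comp (T.prod (T.Phi a))
  map_one' := by
    ext x
    change T.push _ _ (T.prod (T.Phi 1) x) = x
    rw [T.Phi_one, T.one_prod]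
  map_zero' := by
    ext x
    change T.push _ _ (T.prod (T.Phi 0) x) = 0
    rw [map_zero, map_zero, AddMonoidHom.zero_apply, map_zero]
  map_add' a b := by
    ext x
    change T.push _ _ (T.prod (T.Phi (a + b)) x) =
      T.push _ _ (T.prod (T.Phi a) x) + T.push _ _ (T.prod (T.Phi b) x)
    rw [map_add, map_add, AddMonoidHom.add_apply, map_add]
  map_mul' a b := by
    ext x
    change T.push _ _ (T.prod (T.Phi (a * b)) x) =
      T.push _ _ (T.prod (T.Phi a) (T.push _ _ (T.prod (T.Phi b) x)))
    have h₁ := T.push_prod (λ_ (𝟙_ (Over S))).hom (𝟙 X) (isProper_of_iso _) (isProper_id X)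
      (T.prod (T.Phi a) (T.Phi b)) x
    have h₂ := T.push_prod (𝟙 (𝟙_ (Over S))) (λ_ X).hom (isProper_id _) (isProper_of_iso _)
      (T.Phi a) (T.prod (T.Phi b) x)
    rw [T.push_id] at h₁ h₂
    rw [T.Phi_mul, h₁, h₂, ← T.prod_assoc, T.push_push_of_eq rfl _ _ (isProper_comp
      (isProper_of_iso _) (isProper_tensor (isProper_id _) (isProper_of_iso _)))]
    -- Once the unitors are pulled out of the products and the product is reassociated,
    -- multiplicativity is a coherence identity for associator and unitors.
    refine T.push_push_congr ?_ _ _ _ _ _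
    simp

lemma action_apply (a : Lazard) (x : A X) :
    T.action X a x = T.push (λ_ X).hom (isProper_of_iso _) (T.prod (T.Phi a) x) := rfl

lemma action_push (a : Lazard) (f : X ⟶ Y) (hf : IsProper f.left) (x : A X) :
    T.action Y a (T.push f hf x) = T.push f hf (T.action X a x) := by
  have h := T.push_prod (𝟙 (𝟙_ (Over S))) f (isProper_id _) hf (T.Phi a) x
  rw [T.push_id] at h
  rw [action_apply, action_apply, h]
  refine T.push_push_congr ?_ _ _ _ _ _
  simp

lemma action_chern (a : Lazard) (L : LineBundle X.left) (x : A X) :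
    T.action X a (T.chern L x) = T.chern L (T.action X a x) := by
  have h : L.pullback (snd (𝟙_ (Over S)) X).left = L.pullback (λ_ X).hom.left := by
    rw [leftUnitor_hom]
  rw [action_apply, action_apply, T.prod_chern, ← T.push_chern, h]

lemma action_cherns (a : Lazard) (Ls : List (LineBundle X.left)) (x : A X) :
    T.action X a (T.cherns Ls x) = T.cherns Ls (T.action X a x) := by
  induction Ls with
  | nil => rfl
  | cons L Ls ih => rw [T.cherns_cons, T.cherns_cons, T.action_chern, ih]

lemma action_pull (a : Lazard) (f : X ⟶ Y) (hf : SmoothEquidim f.left) (y : A Y) :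
    T.action X a (T.pull f hf y) = T.pull f hf (T.action Y a y) := by
  have sq := isPullback_leftUnitor f
  have hf' := SmoothEquidim.of_isPullback (sq.map (Over.forget S)) hf
  have h := T.pull_prod (𝟙 (𝟙_ (Over S))) f (smoothEquidim_of_iso (Iso.refl _)) hf hf' (T.Phi a) y
  rw [T.pull_id] at h
  rw [action_apply, action_apply, h]
  exact (T.base_change _ _ _ _ sq _ _ _ _ _).symm

lemma action_prod_left (a : Lazard) (x : A X) (y : A Y) :
    T.prod (T.action X a x) y = T.action _ a (T.prod x y) := by
  have h := T.push_prod (λ_ X).hom (𝟙 Y) (isProper_of_iso _) (isProper_id _) (T.prod (T.Phi a) x) y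
  rw [T.push_id] at h
  rw [action_apply, action_apply, h, ← T.prod_assoc, T.push_push_of_eq _ _ _ _]
  simp

lemma action_prod_right (a : Lazard) (x : A X) (y : A Y) :
    T.prod x (T.action Y a y) = T.action _ a (T.prod x y) := by
  rw [← T.prod_comm, action_prod_left, ← action_push, T.prod_comm]

lemma action_one (a : Lazard) : T.action _ a T.one = T.Phi a := by
  -- After the swap of factors the pushforward is again the one along the unitor, as there is only
  -- one morphism to the final object.
  rw [action_apply, ← T.prod_comm, T.push_push_of_eq (toUnit_unique _ _) _ _ (isProper_of_iso _),
    T.one_prod]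

lemma action_mem {a : Lazard} {m : ℕ} (ha : a ∈ lazardGrade m) {i : ℤ} {x : A X}
    (hx : x ∈ T.grade X i) : T.action X a x ∈ T.grade X (i - m) := by
  rw [sub_eq_neg_add]
  exact T.push_mem _ _ _ _ (T.prod_mem _ _ _ _ (T.Phi_mem m a ha) hx)

/-- The element `h_* c̃₁(L₁) ⋯ c̃₁(L_r) π_V^* 1_S` of `A(X)` given by a cobordism cycle
`[h : V ⟶ X; L₁, …, L_r]`. -/
def cycleClass (c : Cycle X) : A X :=
  T.push c.map c.proper (T.cherns c.bundles (T.fund c.V c.smooth))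

lemma cycleClass_eq (c : Cycle X) :
    T.cycleClass c = T.push c.map c.proper (T.cherns c.bundles (T.fund c.V c.smooth)) := rfl

lemma cycleClass_eq_of_isRestriction {c c' : Cycle X} {i : c'.V ⟶ c.V}
    {Ls : List (LineBundle c.V.left)} (h : c'.IsRestriction c i Ls) (hi : IsProper i.left) :
    T.cycleClass c' = T.push c.map c.proper (T.cherns Ls (T.push i hi (T.fund c'.V c'.smooth))) := by
  rw [cycleClass, h.2, ← T.push_push_of_eq h.1 hi c.proper c'.proper, T.push_cherns]

/-- Isomorphisms are handled by the invariance and commutativity of Chern operators, disjoint unions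
by additivity. The dimension axiom on `S'` is pulled back along `π`. The section and formal group
law axioms on `c.V` are carried along by the remaining Chern operators and by `c.map`. -/
lemma compatible_cycleClass (X : Over S) :
    Omega.Compatible (T.action X) (fun c : Cycle X => T.cycleClass c) where
  isom c c' h := by
    obtain ⟨e, he, Ls, hp, hr⟩ := h
    rw [cycleClass, ← T.cherns_perm hp, T.cherns_isom hr,
      ← T.push_push_of_eq he (isProper_of_iso e) c'.proper c.proper, T.push_cherns,
      T.push_fund_iso e c.smooth c'.smooth]
    rfl
  disjointUnion c c₁ c₂ i₁ i₂ h h₁ h₂ := by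
    have := h.isOpenImmersion_left
    have := h.isOpenImmersion_right
    have hi₁ := isProper_of_comp h₁.1 c₁.proper c.proper
    have hi₂ := isProper_of_comp h₂.1 c₂.proper c.proper
    have key := T.push_pull_of_isDisjointUnion h hi₁ (smoothEquidim_of_isOpenImmersion _) hi₂
      (smoothEquidim_of_isOpenImmersion _) (T.fund c.V c.smooth)
    rw [T.pull_fund _ _ c₁.smooth, T.pull_fund _ _ c₂.smooth] at key
    rw [T.cycleClass_eq_of_isRestriction h₁ hi₁, T.cycleClass_eq_of_isRestriction h₂ hi₂, ← map_add,
      ← map_add, key]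
    rfl
  dim c S' π n Ls Ms hπ hn hlt hb := by
    have h := T.rel_dim S' ⟨n, hn⟩ n hn Ls hlt
    rw [T.foldr_chern] at h
    rw [cycleClass, hb, T.cherns_perm List.perm_append_comm, T.cherns_append,
      ← T.pull_fund π hπ c.smooth ⟨n, hn⟩, T.pull_cherns, h, map_zero, map_zero, map_zero]
  sect c cZ i Ls L s hb hs ht hZ := by
    have hi : IsProper i.left := have := hs.1; inferInstance
    rw [T.cycleClass_eq_of_isRestriction hZ hi, cycleClass, hb, T.cherns_append, T.cherns_cons,
      T.cherns_nil, T.rel_sect c.V cZ.V c.smooth cZ.smooth i hi L s hs ht]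
  fgl c d L M hd := by
    have h := congrArg (fun x => T.push c.map c.proper (T.cherns c.bundles x))
      (T.rel_fgl c.V c.smooth d hd L M)
    simp only [map_sum] at h
    have h' (Ls : List (LineBundle c.V.left)) : T.cycleClass (c.append Ls) =
        T.push c.map c.proper (T.cherns c.bundles (T.cherns Ls (T.fund c.V c.smooth))) := by
      rw [← T.cherns_append]
      rfl
    refine Eq.trans ?_ (h.trans (h' [L.tensor M]).symm)
    refine Finset.sum_congr rfl fun i _ => Finset.sum_congr rfl fun j _ => ?_
    rw [h', T.action_push, T.action_cherns, T.cherns_append, ← T.iterate_chern, ← T.iterate_chern,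
      T.action_apply]

/-- The natural transformation `Ω^*(- ⟶ S) → A`. -/
def fromOmega (X : Over S) : Omega X →+ A X := Omega.lift (T.compatible_cycleClass X)

lemma fromOmega_of (a : Lazard) (c : Cycle X) :
    T.fromOmega X (Omega.of a c) = T.action X a (T.cycleClass c) :=
  Omega.lift_of _ _ _

lemma cycleClass_mem (c : Cycle X) {d : ℕ} (hd : SmoothOfRelativeDimension d c.V.hom) :
    T.cycleClass c ∈ T.grade X (c.bundles.length - d) := by
  rw [sub_eq_neg_add]
  exact T.push_mem _ _ _ _ (T.cherns_mem _ (T.fund_mem _ hd))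

lemma cycleClass_push (f : X ⟶ Y) (hf : IsProper f.left) (c : Cycle X) :
    T.cycleClass (c.push f hf) = T.push f hf (T.cycleClass c) :=
  T.push_comp _ _ _ _ _ _

lemma cycleClass_pull (f : X ⟶ Y) (hf : SmoothEquidim f.left) (c : Cycle Y) {W : Over S}
    {g : W ⟶ c.V} {k : W ⟶ X} (sq : IsPullback g k c.map f) :
    T.cycleClass (c.pull f hf g k sq) = T.pull f hf (T.cycleClass c) := by
  have hg : SmoothEquidim g.left := SmoothEquidim.of_isPullback (sq.map (Over.forget S)) hf
  have hk : IsProper k.left := (c.pull f hf g k sq).proper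
  have hW : SmoothEquidim W.hom := (c.pull f hf g k sq).smooth
  rw [T.cycleClass_eq c, T.base_change g k c.map f sq c.proper hf hk hg, ← T.pull_cherns,
    T.pull_fund g hg hW]
  rfl

lemma cycleClass_chern (L : LineBundle X.left) (c : Cycle X) :
    T.cycleClass (c.chern L) = T.chern L (T.cycleClass c) := by
  have h : T.cherns (c.bundles ++ [L.pullback c.map.left]) (T.fund c.V c.smooth) =
      T.chern (L.pullback c.map.left) (T.cherns c.bundles (T.fund c.V c.smooth)) := by
    rw [T.cherns_perm List.perm_append_comm]
    rfl
  exact (congrArg (T.push c.map c.proper) h).trans (T.push_chern _ _ _ _)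

lemma cycleClass_prod (c : Cycle X) (c' : Cycle Y) :
    T.cycleClass (c.prod c') = T.prod (T.cycleClass c) (T.cycleClass c') := by
  rw [T.cycleClass_eq c, T.cycleClass_eq c', T.push_prod, T.cherns_prod, T.prod_cherns, ← T.cherns_append,
    T.prod_fund _ _ (c.prod c').smooth]
  rfl

lemma cycleClass_one : T.cycleClass (Cycle.one S) = T.one :=
  (T.push_id _ _ _).trans (T.fund_unit (Cycle.one S).smooth)

lemma isTransformation_fromOmega : IsTransformation (Omega.geometricFunctor S) T T.fromOmega where
  grade X i x hx := Omega.map_mem_of_mem_grade _ (fun m d a c ha hd hk => by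
    rw [fromOmega_of, hk]
    exact T.action_mem ha (T.cycleClass_mem c hd)) hx
  push {X Y} f hf x := by
    refine DFunLike.congr_fun (f := (T.fromOmega Y).comp (Omega.push f hf))
      (g := (T.push f hf).comp (T.fromOmega X)) (Omega.hom_ext fun a c => ?_) x
    rw [AddMonoidHom.comp_apply, AddMonoidHom.comp_apply, Omega.push_of, fromOmega_of, fromOmega_of,
      cycleClass_push, action_push]
  pull {X Y} f hf y := by
    refine DFunLike.congr_fun (f := (T.fromOmega X).comp (Omega.pull f hf))
      (g := (T.pull f hf).comp (T.fromOmega Y)) (Omega.hom_ext fun a c => ?_) y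
    rw [AddMonoidHom.comp_apply, AddMonoidHom.comp_apply,
      Omega.pull_of _ _ _ _ (IsPullback.of_hasPullback c.map f), fromOmega_of, fromOmega_of,
      cycleClass_pull, action_pull]
  chern {X} L x := by
    refine DFunLike.congr_fun (f := (T.fromOmega X).comp (Omega.chern L))
      (g := (T.chern L).comp (T.fromOmega X)) (Omega.hom_ext fun a c => ?_) x
    rw [AddMonoidHom.comp_apply, AddMonoidHom.comp_apply, Omega.chern_of, fromOmega_of,
      fromOmega_of, cycleClass_chern, action_chern]
  prod {X Y} x y := by
    refine Omega.ext₂ (fun x y => T.fromOmega (X ⊗ Y) (Omega.prod x y))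
      (fun x y => T.prod (T.fromOmega X x) (T.fromOmega Y y)) (fun a c b c' => ?_) (x := x) (y := y)
    rw [Omega.prod_of, fromOmega_of, fromOmega_of, fromOmega_of, cycleClass_prod, action_prod_left,
      action_prod_right, map_mul]
    rfl
  Phi a := by
    refine (T.fromOmega_of a (Cycle.one S)).trans ?_
    rw [cycleClass_one, action_one]
  one := by
    refine (T.fromOmega_of 1 (Cycle.one S)).trans ?_
    rw [cycleClass_one, action_one, T.Phi_one]

end GeometricFunctor

/-! ### Uniqueness of the transformation. -/

namespace IsTransformation

variable {A : Over S → Type*} [∀ X, AddCommGroup (A X)] {B : Over S → Type*}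
  [∀ X, AddCommGroup (B X)] {T : GeometricFunctor S A} {T' : GeometricFunctor S B}
  {τ : ∀ X : Over S, A X →+ B X} {X : Over S}

lemma map_action (h : IsTransformation T T' τ) (a : Lazard) (x : A X) :
    τ X (T.action X a x) = T'.action X a (τ X x) := by
  rw [T.action_apply, T'.action_apply, h.push, h.prod, h.Phi]

lemma map_cherns (h : IsTransformation T T' τ) (Ls : List (LineBundle X.left)) (x : A X) :
    τ X (T.cherns Ls x) = T'.cherns Ls (τ X x) := by
  induction Ls with
  | nil => rfl
  | cons L Ls ih => rw [T.cherns_cons, T'.cherns_cons, h.chern, ih]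

lemma map_cycleClass (h : IsTransformation T T' τ) (c : Cycle X) :
    τ X (T.cycleClass c) = T'.cycleClass c := by
  rw [T.cycleClass_eq, h.push, h.map_cherns, BMFunctor.fund, h.pull, h.one]
  rfl

end IsTransformation

namespace Omega

variable {X : Over S}

/-- In `Ω^*` every cycle is obtained from `1_S` by a pullback, Chern operators and a pushforward. A
transformation preserves all of these, so its values on cycles are forced. -/
lemma cycleClass_geometricFunctor (c : Cycle X) : (geometricFunctor S).cycleClass c = of 1 c := by
  have h (Ls : List (LineBundle c.V.left)) (x : Omega c.V) :
      (geometricFunctor S).cherns Ls x = cherns Ls x := by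
    rw [← BMFunctor.foldr_chern]
    exact foldr_chern Ls x
  rw [GeometricFunctor.cycleClass, h]
  refine (congrArg (fun x => push c.map c.proper (cherns c.bundles x))
    (fund_bmFunctor c.smooth)).trans ?_
  rw [cherns_fund, push_of]
  exact of_isom 1 (Cycle.isom_mk_self (Category.id_comp _).symm (List.Perm.refl _))

lemma action_geometricFunctor (a : Lazard) (x : Omega X) :
    (geometricFunctor S).action X a x = action X a x :=
  push_leftUnitor_prod_of_one a x

end Omega

lemma IsTransformation.eq_fromOmega {A : Over S → Type w} [∀ X, AddCommGroup (A X)]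
    {T : GeometricFunctor S A} {τ : ∀ X : Over S, Omega X →+ A X}
    (h : IsTransformation (Omega.geometricFunctor S) T τ) : τ = T.fromOmega := by
  funext X
  refine Omega.hom_ext fun a c => ?_
  rw [T.fromOmega_of, ← h.map_cycleClass, ← h.map_action, Omega.cycleClass_geometricFunctor,
    Omega.action_geometricFunctor, Omega.action_of_one]

end RelCobordism

end

theorem mainTheorem2 (S : Scheme.{u}) :
    ∃ O : RelCobordism.GeometricFunctor S (fun X : Over S => RelCobordism.Omega X),
      RelCobordism.IsCobordismStructure O ∧
      ∀ (A : Over S → Type w) [∀ X, AddCommGroup (A X)] (T : RelCobordism.GeometricFunctor S A),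
        ∃! τ : ∀ X : Over S, RelCobordism.Omega X →+ A X,
          RelCobordism.IsTransformation O T τ :=
  ⟨RelCobordism.Omega.geometricFunctor S, RelCobordism.Omega.isCobordismStructure,
    fun _ _ T => ⟨T.fromOmega, T.isTransformation_fromOmega, fun _ h => h.eq_fromOmega⟩⟩
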